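/- Let $d\in\{2,3\}$ and $M>0$. Write $G_2(x)=-\frac1{2\pi}\log|x|$ on $\mathbb R^2$, $G_3(x)=\frac1{4\pi|x|}$ on $\mathbb R^3$, and $(-\Delta)^{-1}f=G_d*f$. Let $\phi\in C^1(\mathbb R^d)$ have a globally Lipschitz gradient and satisfy $$\liminf_{|x|\to\infty}\frac{\phi(x)}{\log|x|}>d,\qquad \lim_{r\to\infty}\operatorname*{ess\,inf}_{|x|\ge r}\Big(\tfrac14|\nabla\phi|^2-\tfrac12\Delta\phi\Big)>0,\qquad \lim_{r\to\infty}\operatorname*{ess\,inf}_{|x|\ge r}|\nabla\phi|>0$$ (the limits exist in $(0,+\infty]$) and, if $d=2$, also $\liminf_{|x|\to\infty}\phi(x)/\log|x|>4+\frac M{2\pi}$. Let $n_0\in L^1(\mathbb R^d)$, $n_0\ge0$, $\int n_0\,dx=M$, have finite free energy $$\mathcal F[n_0]=\int n_0\log n_0\,dx+\int n_0\,\phi\,dx+\tfrac12\int n_0\,(-\Delta)^{-1}n_0\,dx<+\infty ,$$ where $\mathcal F[n_0]=+\infty$ by convention if one of the three terms is not well defined and finite. Let $n\ge0$ be a weak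 solution of $$\partial_t n=\Delta n+\nabla\cdot(n\nabla c)+\nabla\cdot(n\nabla\phi),\qquad c=G_d*n,\qquad n(0,\cdot)=n_0,$$ on $(0,\infty)\times\mathbb R^d$: $n\in C([0,\infty);L^1(\mathbb R^d))\cap L^\infty_{\rm loc}((0,\infty);L^2(\mathbb R^d))\cap L^2_{\rm loc}((0,\infty);H^1(\mathbb R^d))$, the convolution $c(t,\cdot)=G_d*n(t,\cdot)$ converges absolutely a.e. for every $t>0$ and has, for a.e. $t>0$, a weak gradient with $n\nabla c\in L^1_{\rm loc}((0,\infty)\times\mathbb R^d)$, and the equation holds in the sense of distributions. Then there is a time $T>0$ such that, for every $t\ge T$, $c(t,\cdot)$ has a weak gradient, and: (i) for every $q_0>2$ there is a constant $\mathcal C>0$ such that $\|\nabla c(t,\cdot)\|_{L^q(\mathbb R^d)}\le\mathcal C$ for all $t\ge T$ and all $q\in[q_0,+\infty]$ (in particular, for each $q\in(2,+\infty]$, $\|\nabla c(t,\cdot)\|_{L^q(\mathbb R^d)}$ is bounded uniformly in $t\ge T$); (ii) if $d=3$, there is one constant $\mathcal C>0$ such that $\|\nabla c(t,\cdot)\|_{L^q(\mathbb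 R^3)}\le\mathcal C$ for all $t\ge T$ and all $q\in(2,+\infty]$. -/

import Mathlib

open MeasureTheory Filter Topology Set
open scoped ENNReal NNReal ContDiff

noncomputable section

namespace NernstPlanck

/-- The Euclidean space `ℝ^d`. -/
abbrev E (d : ℕ) : Type := EuclideanSpace ℝ (Fin d)

/-- The Green function of `-Δ` in dimension two (`-log|x| / (2π)`) and three (`1 / (4π|x|)`).
It is only used for these two values of `d`. -/
def green (d : ℕ) (x : E d) : ℝ :=
  if d = 2 then -(1 / (2 * Real.pi)) * Real.log ‖x‖ else 1 / (4 * Real.pi * ‖x‖)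

/-- The convolution `G_d * f` converges absolutely at almost every point. -/
def HasPotential {d : ℕ} (f : E d → ℝ) : Prop :=
  ∀ᵐ x, Integrable (fun y => green d (x - y) * f y)

/-- `(-Δ)⁻¹ f = G_d * f`. -/
def potential {d : ℕ} (f : E d → ℝ) (x : E d) : ℝ :=
  ∫ y, green d (x - y) * f y

/-- `g` is the (distributional) gradient of `u` on `ℝ^d`. -/
def IsWeakGradient {d : ℕ} (u : E d → ℝ) (g : E d → E d) : Prop :=
  LocallyIntegrable u ∧ LocallyIntegrable g ∧
    ∀ ψ : E d → ℝ, ContDiff ℝ ∞ ψ → HasCompactSupport ψ →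
      ∫ x, u x • gradient ψ x = -∫ x, ψ x • g x

/-- `lim_{r → ∞} ess inf_{|x| ≥ r} f(x)` exists in `(0, +∞]`. -/
def EssPositiveAtInfinity {d : ℕ} (f : E d → ℝ) : Prop :=
  ∃ σ : EReal, 0 < σ ∧
    Tendsto (fun r : ℝ =>
      essInf (fun x => (f x : EReal)) (volume.restrict (Metric.ball (0 : E d) r)ᶜ)) atTop (𝓝 σ)

/-- Confinement potentials: `φ` is `C¹` with Lipschitz gradient, and satisfies the growth
and spectral conditions at infinity. As `∇φ` is Lipschitz, `Δφ` exists almost everywhere. -/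
structure IsConfining {d : ℕ} (M : ℝ) (φ : E d → ℝ) : Prop where
  contDiff : ContDiff ℝ 1 φ
  lipschitz_gradient : ∃ L : ℝ≥0, LipschitzWith L (gradient φ)
  growth : ((d : ℝ) : EReal) <
    liminf (fun x : E d => ((φ x / Real.log ‖x‖ : ℝ) : EReal)) (Bornology.cobounded (E d))
  spectral : EssPositiveAtInfinity
    (fun x : E d => 1 / 4 * ‖gradient φ x‖ ^ 2 - 1 / 2 * Laplacian.laplacian φ x)
  gradient_pos : EssPositiveAtInfinity (fun x : E d => ‖gradient φ x‖)
  growth_two : d = 2 → ((4 + M / (2 * Real.pi) : ℝ) : EReal) <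
    liminf (fun x : E d => ((φ x / Real.log ‖x‖ : ℝ) : EReal)) (Bornology.cobounded (E d))

open Classical in
/-- The free energy `∫ f log f + ∫ f φ + ½ ∫ f (-Δ)⁻¹ f`, with the value `+∞`
when one of the terms is not well defined and finite. -/
def freeEnergy {d : ℕ} (φ : E d → ℝ) (f : E d → ℝ) : EReal :=
  if Integrable (fun x => f x * Real.log (f x)) ∧ Integrable (fun x => f x * φ x) ∧
      HasPotential f ∧ Integrable (fun x => f x * potential f x) then
    (((∫ x, f x * Real.log (f x)) + (∫ x, f x * φ x)
      + 1 / 2 * ∫ x, f x * potential f x : ℝ) : EReal)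
  else ⊤

/-- `n` is a weak solution on `(0, ∞) × ℝ^d` of
`∂ₜ n = Δ n + ∇·(n ∇c) + ∇·(n ∇φ)`, `c = G_d * n`, with initial datum `n₀`;
`Dn` and `Dc` stand for the spatial gradients of `n` and of `c`. The solution is continuous in
time with values in `L¹` and lies, away from the initial time, in the energy space
`L^∞_loc((0, ∞); L²) ∩ L²_loc((0, ∞); H¹)`. -/
structure IsWeakSolutionWith {d : ℕ} (φ n₀ : E d → ℝ) (n : ℝ → E d → ℝ)
    (Dn Dc : ℝ → E d → E d) : Prop where
  nonneg : ∀ t, 0 ≤ t → ∀ᵐ x, 0 ≤ n t x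
  integrable : ∀ t, 0 ≤ t → Integrable (n t)
  continuous_L1 : ∀ t, 0 ≤ t →
    Tendsto (fun s => eLpNorm (fun x => n s x - n t x) 1 volume) (𝓝[Ici 0] t) (𝓝 0)
  initial : n 0 =ᵐ[volume] n₀
  measurable : AEStronglyMeasurable (fun p : ℝ × E d => n p.1 p.2)
    (volume.restrict (Ioi (0 : ℝ) ×ˢ (univ : Set (E d))))
  bounded_L2 : ∀ a b : ℝ, 0 < a → a < b →
    ∃ K : ℝ≥0, ∀ t ∈ Icc a b, eLpNorm (n t) 2 volume ≤ K
  gradient_n : ∀ᵐ t ∂(volume.restrict (Ioi (0 : ℝ))), IsWeakGradient (n t) (Dn t)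
  gradient_L2 : ∀ a b : ℝ, 0 < a → a < b →
    MemLp (fun p : ℝ × E d => Dn p.1 p.2) 2 (volume.restrict (Ioo a b ×ˢ (univ : Set (E d))))
  potential_c : ∀ t, 0 < t → HasPotential (n t)
  gradient_c : ∀ᵐ t ∂(volume.restrict (Ioi (0 : ℝ))), IsWeakGradient (potential (n t)) (Dc t)
  drift_integrable : LocallyIntegrableOn (fun p : ℝ × E d => n p.1 p.2 • Dc p.1 p.2)
    (Ioi (0 : ℝ) ×ˢ (univ : Set (E d)))
  equation : ∀ ψ : ℝ × E d → ℝ, ContDiff ℝ ∞ ψ → HasCompactSupport ψ →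
    tsupport ψ ⊆ Ioi (0 : ℝ) ×ˢ (univ : Set (E d)) →
    ∫ p : ℝ × E d, n p.1 p.2 * deriv (fun s => ψ (s, p.2)) p.1 =
      ∫ p : ℝ × E d, inner ℝ
        (Dn p.1 p.2 + n p.1 p.2 • Dc p.1 p.2 + n p.1 p.2 • gradient φ p.2)
        (gradient (fun y => ψ (p.1, y)) p.2)

/-- `n` is a weak solution of the confined Poisson-Nernst-Planck system with datum `n₀`. -/
def IsWeakSolution {d : ℕ} (φ n₀ : E d → ℝ) (n : ℝ → E d → ℝ) : Prop :=
  ∃ Dn Dc : ℝ → E d → E d, IsWeakSolutionWith φ n₀ n Dn Dc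

end NernstPlanck

end

/-! Put `B = ∇c + ∇φ`, so that `∂ₜn = Δn + ∇·(nB)`. Since `-Δc = n`, the drift has divergence `D =
Δφ - n`, and formally `∂ₜn = Δn + B·∇n + n(Δφ - n)`: the Poisson coupling acts as a logistic
absorption. If `L` is a Lipschitz constant of `∇φ` and `K = dL` bounds `|Δφ|`, then `U(t) = K + 1/t`
is a supersolution that is infinite at time zero. Hence `n(t) ≤ K + 1/t` whatever the size of the
datum (`ae_le_barrier`). The mass does not increase (`integral_le_of_le`), so `n(t)` is bounded in
`L¹ ∩ L^∞` uniformly in `t ≥ 1`.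

The gradient of `c` is the convolution of `n` with `kern` (`isWeakGradient_field`). Cut at radius
one, this kernel is the sum of an `L¹` piece and a bounded piece that lies in `L^q` once `(d-1)q >
d`. Young's inequality (`eLpNorm_field_le`) bounds the field in one `L^{q₀}` and in `L^∞`, and
`eLpNorm_le_max` covers all exponents in between with the same constant. The condition on `q` reads
`q > 2` for `d = 2` and `q > 3/2` for `d = 3`; in dimension three the endpoint `2` is therefore
available, which gives (ii).

The work lies in the comparison for weak solutions. For convex `β` one wants `∂ₜβ ≤ Δβ + ∇·(βB)` at
`β = β(n - U)`, under the sign condition `β'(n - U)(U' - nD) + β(n - U)D ≥ 0`. Mollification in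
space-time, with `Dn·B + nD` as a locally integrable source, gives Kato's inequality (`kato`). On
almost every time slice `integral_product_rule` puts the transport term back into divergence form,
which yields `DriftSystem.kato`. Dilated cutoffs then remove the spatial test function, because `B`
is a square integrable part plus a part of linear growth (`exists_norm_drift_le`). What is left says
that `t ↦ ∫ β(n - U)` has nonpositive distributional derivative. This function is continuous because
`n` is continuous into `L¹`, so it is antitone (`antitoneOn_integral_comp`). With `β` a smooth
positive part it tends to zero as `t → 0+`, hence vanishes; with `β = id` and `U = 0` it is the
mass. -/

namespace NernstPlanck

/-! ### The gradient of the Green function -/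

/-- The measure of the unit sphere in dimension two and three. -/
noncomputable def sphereArea (d : ℕ) : ℝ := if d = 2 then 2 * Real.pi else 4 * Real.pi

/-- The gradient `-x / (ω_d |x|^d)` of the Green function. -/
noncomputable def kern (d : ℕ) (x : E d) : E d := -((sphereArea d)⁻¹ * (‖x‖ ^ d)⁻¹) • x

lemma sphereArea_pos (d : ℕ) : 0 < sphereArea d := by
  unfold sphereArea; split_ifs <;> positivity

lemma nontrivial_E {d : ℕ} (hd : d = 2 ∨ d = 3) : Nontrivial (E d) := by
  rcases hd with rfl | rfl <;> infer_instance

lemma measurable_kern (d : ℕ) : Measurable (kern d) := by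
  unfold kern; fun_prop

lemma measurable_green (d : ℕ) : Measurable (green d) := by
  unfold green; split_ifs <;> fun_prop

lemma norm_kern {d : ℕ} (hd : d = 2 ∨ d = 3) (x : E d) :
    ‖kern d x‖ = (sphereArea d)⁻¹ * (‖x‖ ^ (d - 1))⁻¹ := by
  have h := sphereArea_pos d
  rw [kern, norm_smul, norm_neg, Real.norm_of_nonneg (by positivity)]
  -- At the origin both sides are `0`, because `0⁻¹ = 0` and `d - 1 > 0`.
  rcases eq_or_ne x 0 with rfl | hx
  · rcases hd with rfl | rfl <;> simp
  · have : ‖x‖ ≠ 0 := norm_ne_zero_iff.2 hx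
    rcases hd with rfl | rfl <;> field_simp
    simp

lemma norm_kern_le_of_one_le {d : ℕ} (hd : d = 2 ∨ d = 3) {x : E d} (hx : 1 ≤ ‖x‖) :
    ‖kern d x‖ ≤ (sphereArea d)⁻¹ := by
  rw [norm_kern hd]
  have h := sphereArea_pos d
  have : (‖x‖ ^ (d - 1))⁻¹ ≤ 1 := inv_le_one_of_one_le₀ (one_le_pow₀ hx)
  exact mul_le_of_le_one_right (by positivity) this

/-- In polar coordinates the Jacobian `s^(d-1)` cancels the singularity exactly, leaving a constant
on a bounded interval. -/
lemma integrableOn_kern_ball {d : ℕ} (hd : d = 2 ∨ d = 3) (r : ℝ) :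
    IntegrableOn (kern d) (Metric.ball 0 r) := by
  have := nontrivial_E hd
  have h1 : IntegrableOn (fun x : E d => (fun s : ℝ => (sphereArea d)⁻¹ * (s ^ (d - 1))⁻¹) ‖x‖)
      (Metric.ball 0 r) := by
    rw [integrableOn_fun_norm_addHaar volume
      (f := fun s : ℝ => (sphereArea d)⁻¹ * (s ^ (d - 1))⁻¹)]
    have : IntegrableOn (fun _ : ℝ => (sphereArea d)⁻¹) (Ioo 0 r) := by
      exact integrableOn_const (by simp)
    refine this.congr_fun (fun y hy => ?_) measurableSet_Ioo
    have hy' : y ≠ 0 := hy.1.ne'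
    simp only [finrank_euclideanSpace, Fintype.card_fin, smul_eq_mul]
    field_simp
  refine Integrable.mono' h1 (measurable_kern d).aestronglyMeasurable (ae_of_all _ fun x => ?_)
  exact (norm_kern hd x).le

lemma toSphere_real_univ {d : ℕ} (hd : d = 2 ∨ d = 3) :
    (volume : Measure (E d)).toSphere.real univ = sphereArea d := by
  rw [Measure.toSphere_real_apply_univ]
  rcases hd with rfl | rfl
  · simp [Measure.real, sphereArea, EuclideanSpace.volume_ball_fin_two, Real.pi_pos.le]
  · simp [Measure.real, sphereArea, EuclideanSpace.volume_ball_fin_three]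
    rw [ENNReal.toReal_ofReal (by positivity)]
    ring

/-- Integration in polar coordinates. -/
lemma integral_polar {V : Type*} [NormedAddCommGroup V] [NormedSpace ℝ V] [Nontrivial V]
    [MeasurableSpace V] [BorelSpace V] [FiniteDimensional ℝ V]
    (μ : Measure V) [μ.IsAddHaarMeasure] {g : V → ℝ} (hg : Integrable g μ) :
    ∫ x, g x ∂μ = ∫ s, (∫ r in Ioi (0 : ℝ),
      r ^ (Module.finrank ℝ V - 1) * g (r • (s : V))) ∂μ.toSphere := by
  have hmp := μ.measurePreserving_homeomorphUnitSphereProd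
  have hemb := (homeomorphUnitSphereProd V).measurableEmbedding
  have hcomp : ∀ x : ({(0)}ᶜ : Set V), g ((homeomorphUnitSphereProd V x).2.1 •
      ((homeomorphUnitSphereProd V x).1 : V)) = g x := by
    intro x
    have hx : ‖(x : V)‖ ≠ 0 := norm_ne_zero_iff.2 x.2
    simp [smul_smul, hx]
  have hint : Integrable (fun p : Metric.sphere (0 : V) 1 × Ioi (0 : ℝ) => g (p.2.1 • (p.1 : V)))
      (μ.toSphere.prod (Measure.volumeIoiPow (Module.finrank ℝ V - 1))) := by
    rw [← hmp.integrable_comp_emb hemb]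
    simp only [Function.comp_def, hcomp]
    -- Polar coordinates parametrise only the punctured space; the origin is a null set.
    rw [← restrict_compl_singleton (μ := μ) 0, ← IntegrableOn,
      integrableOn_iff_comap_subtypeVal (by measurability)] at hg
    exact hg
  calc ∫ x, g x ∂μ = ∫ x : ({(0)}ᶜ : Set V), g x ∂(μ.comap (↑)) := by
        rw [integral_subtype_comap (measurableSet_singleton _).compl fun x ↦ g x,
          restrict_compl_singleton]
    _ = ∫ p, g (p.2.1 • (p.1 : V))
          ∂(μ.toSphere.prod (Measure.volumeIoiPow (Module.finrank ℝ V - 1))) := by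
        rw [← hmp.integral_comp hemb]
        exact integral_congr_ae (ae_of_all _ fun x => (hcomp x).symm)
    _ = _ := by
        rw [integral_prod _ hint]
        refine integral_congr_ae (ae_of_all _ fun s => ?_)
        simp only [Measure.volumeIoiPow, ENNReal.ofReal]
        rw [integral_withDensity_eq_integral_smul
          ((measurable_subtype_coe.pow_const _).real_toNNReal),
          integral_subtype_comap measurableSet_Ioi fun a ↦
            Real.toNNReal (a ^ (Module.finrank ℝ V - 1)) • g (a • (s : V)),
          setIntegral_congr_fun measurableSet_Ioi fun x hx ↦ ?_]
        rw [NNReal.smul_def, Real.coe_toNNReal _ (pow_nonneg (le_of_lt hx) _), smul_eq_mul]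

lemma integrable_kern_smul {d : ℕ} (hd : d = 2 ∨ d = 3) {h : E d → ℝ} (hc : Continuous h) (hs : HasCompactSupport h) :
    Integrable (fun x => h x • kern d x) := by
  obtain ⟨r, hr⟩ := hs.isCompact.isBounded.subset_ball (0 : E d)
  obtain ⟨C, hC⟩ := hc.bounded_above_of_compact_support hs
  have h1 : IntegrableOn (fun x => h x • kern d x) (Metric.ball 0 r) := by
    exact (integrableOn_kern_ball hd r).bdd_smul C hc.aestronglyMeasurable
      (ae_of_all _ hC)
  refine (integrableOn_iff_integrable_of_support_subset ?_).1 h1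
  intro x hx
  apply hr
  apply subset_tsupport
  intro h0
  exact hx (by simp [h0])

/-- `kern` has divergence `-δ₀`. -/
lemma integral_inner_kern_gradient {d : ℕ} (hd : d = 2 ∨ d = 3) {w : E d → ℝ}
    (hw : ContDiff ℝ 1 w) (hs : HasCompactSupport w) :
    ∫ x, inner ℝ (kern d x) (gradient w x) = w 0 := by
  have := nontrivial_E hd
  have hω := sphereArea_pos d
  have hgc : Continuous (gradient w) := by
    unfold gradient
    exact (LinearIsometryEquiv.continuous _).comp (hw.continuous_fderiv (by simp))
  have hgs : HasCompactSupport (gradient w) := by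
    refine (hs.fderiv ℝ).comp_left (g := (InnerProductSpace.toDual ℝ (E d)).symm) (by simp)
  have hint : Integrable (fun x => inner ℝ (kern d x) (gradient w x)) := by
    have h1 := (integrable_kern_smul hd hgc.norm hgs.norm).norm
    refine h1.mono' ?_ (ae_of_all _ fun x => ?_)
    · exact (measurable_kern d).aestronglyMeasurable.inner hgc.aestronglyMeasurable
    · rw [norm_smul, norm_norm, mul_comm]
      exact norm_inner_le_norm _ _
  rw [integral_polar _ hint]
  -- On a ray, `r^(d-1)` times the kernel is the constant vector `-s/ω`, where `ω` is the area of
  -- the sphere. The integrand is thus `-ω⁻¹` times the derivative of `r ↦ w(r s)`, and the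
  -- fundamental theorem of calculus gives `ω⁻¹ w(0)` in every direction.
  have key : ∀ s : Metric.sphere (0 : E d) 1, ∫ r in Ioi (0 : ℝ),
      r ^ (Module.finrank ℝ (E d) - 1) * inner ℝ (kern d (r • (s : E d)))
        (gradient w (r • (s : E d))) = (sphereArea d)⁻¹ * w 0 := by
    intro s
    have hsn : ‖(s : E d)‖ = 1 := by simp
    have hder : ∀ r : ℝ, HasDerivAt (fun r : ℝ => -((sphereArea d)⁻¹ * w (r • (s : E d))))
        (-((sphereArea d)⁻¹ * inner ℝ (gradient w (r • (s : E d))) (s : E d))) r := by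
      intro r
      have h1 : HasDerivAt (fun r : ℝ => r • (s : E d)) ((1 : ℝ) • (s : E d)) r :=
        (hasDerivAt_id r).smul_const _
      have h2 := ((hw.differentiable (by simp)).differentiableAt
        (x := r • (s : E d))).hasFDerivAt.comp_hasDerivAt r h1
      have h3 : fderiv ℝ w (r • (s : E d)) ((1 : ℝ) • (s : E d))
          = inner ℝ (gradient w (r • (s : E d))) (s : E d) := by
        rw [one_smul, gradient, InnerProductSpace.toDual_symm_apply]
      rw [h3] at h2
      exact (h2.const_mul _).neg
    have hcont : Continuous (fun r : ℝ => r • (s : E d)) := by fun_prop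
    have hcl : Topology.IsClosedEmbedding (fun r : ℝ => r • (s : E d)) :=
      isClosedEmbedding_smul_left (by intro h; simp [h] at hsn)
    have hgi : Integrable (fun r : ℝ =>
        -((sphereArea d)⁻¹ * inner ℝ (gradient w (r • (s : E d))) (s : E d))) := by
      refine Continuous.integrable_of_hasCompactSupport (by fun_prop) ?_
      refine (hgs.comp_isClosedEmbedding hcl).mono' ?_
      intro r hr
      apply subset_tsupport
      intro h0
      simp only [Function.comp_apply] at h0
      exact hr (by simp [h0])
    have hlim : Tendsto (fun r : ℝ => -((sphereArea d)⁻¹ * w (r • (s : E d)))) atTop (𝓝 0) := by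
      have h1 := (hs.comp_isClosedEmbedding hcl).is_zero_at_infty
      rw [cocompact_eq_atBot_atTop] at h1
      have h2 := (h1.mono_left le_sup_right).const_mul (-(sphereArea d)⁻¹)
      simpa using h2
    have h1 := integral_Ioi_of_hasDerivAt_of_tendsto' (a := (0 : ℝ)) (fun r _ => hder r)
      hgi.integrableOn hlim
    rw [zero_smul, zero_sub, neg_neg] at h1
    rw [← h1]
    refine setIntegral_congr_fun measurableSet_Ioi fun r hr => ?_
    have hr : (0 : ℝ) < r := hr
    have hr' : r ≠ 0 := hr.ne'
    have hp : r ^ (d - 1) * r = r ^ d := by rcases hd with rfl | rfl <;> simp <;> ring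
    simp only [finrank_euclideanSpace, Fintype.card_fin, kern, norm_smul, hsn, mul_one,
      Real.norm_of_nonneg hr.le, neg_smul, inner_neg_left, inner_smul_left, real_inner_comm]
    simp
    rw [← hp]
    field_simp
  simp_rw [key]
  rw [integral_const, toSphere_real_univ hd, smul_eq_mul]
  field_simp

/-! ### The Green function and its distributional gradient -/

/-- The radial profile of the Green function. -/
noncomputable def greenRad (d : ℕ) (s : ℝ) : ℝ :=
  if d = 2 then -(1 / (2 * Real.pi)) * Real.log s else 1 / (4 * Real.pi * s)

lemma abs_log_le_add_inv {s : ℝ} (hs : 0 < s) : |Real.log s| ≤ s + s⁻¹ := by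
  have h1 := Real.log_le_sub_one_of_pos hs
  have h2 := Real.log_le_sub_one_of_pos (inv_pos.2 hs)
  rw [Real.log_inv] at h2
  have := inv_pos.2 hs
  exact abs_le.2 ⟨by linarith, by linarith⟩

lemma abs_greenRad_le (d : ℕ) {s : ℝ} (hs : 0 < s) : |greenRad d s| ≤ s + s⁻¹ := by
  have hpi := Real.pi_gt_three
  have hs' := inv_pos.2 hs
  unfold greenRad
  split_ifs with h
  · rw [abs_mul, abs_neg, abs_of_pos (by positivity : 0 < 1 / (2 * Real.pi))]
    refine le_trans (mul_le_of_le_one_left (abs_nonneg _) ?_) (abs_log_le_add_inv hs)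
    rw [div_le_one (by positivity)]; linarith
  · rw [abs_of_pos (by positivity), one_div, mul_inv]
    have : (4 * Real.pi)⁻¹ ≤ 1 := inv_le_one_of_one_le₀ (by linarith)
    nlinarith

lemma continuousOn_greenRad (d : ℕ) : ContinuousOn (greenRad d) (Ioi 0) := by
  unfold greenRad
  split_ifs
  · exact continuousOn_const.mul (Real.continuousOn_log.mono fun x hx => ne_of_gt hx)
  · refine continuousOn_const.div (by fun_prop) fun x hx => ?_
    have : (0 : ℝ) < x := hx
    positivity

lemma hasDerivAt_greenRad {d : ℕ} (hd : d = 2 ∨ d = 3) {s : ℝ} (hs : 0 < s) :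
    HasDerivAt (greenRad d) (-((sphereArea d)⁻¹ * (s ^ (d - 1))⁻¹)) s := by
  have hpi := Real.pi_pos
  rcases hd with rfl | rfl
  · have h := (Real.hasDerivAt_log hs.ne').const_mul (-(1 / (2 * Real.pi)))
    have e : greenRad 2 = fun s => -(1 / (2 * Real.pi)) * Real.log s := by
      funext s; simp [greenRad]
    rw [e]
    refine h.congr_deriv ?_
    simp [sphereArea]
  · have h := (hasDerivAt_inv hs.ne').const_mul (1 / (4 * Real.pi))
    have e : greenRad 3 = fun s => 1 / (4 * Real.pi) * s⁻¹ := by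
      funext s; simp [greenRad]; ring
    rw [e]
    refine h.congr_deriv ?_
    simp [sphereArea]

lemma integrableOn_inv_norm_ball {d : ℕ} (hd : d = 2 ∨ d = 3) (r : ℝ) :
    IntegrableOn (fun x : E d => ‖x‖⁻¹) (Metric.ball 0 r) := by
  have := nontrivial_E hd
  rw [integrableOn_fun_norm_addHaar volume (f := fun s : ℝ => s⁻¹)]
  have h : IntegrableOn (fun y : ℝ => y ^ (d - 2)) (Ioo 0 r) :=
    ((by fun_prop : Continuous fun y : ℝ => y ^ (d - 2)).integrableOn_Icc
      (a := 0) (b := r)).mono_set Ioo_subset_Icc_self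
  refine h.congr_fun (fun y hy => ?_) measurableSet_Ioo
  have hy' : y ≠ 0 := hy.1.ne'
  simp only [finrank_euclideanSpace, Fintype.card_fin, smul_eq_mul]
  rcases hd with rfl | rfl <;> (simp; try field_simp)

/-- A bound comparing the Green function at two points. -/
lemma abs_green_le {d : ℕ} (hd : d = 2 ∨ d = 3) (z z₀ : E d) :
    |green d z| ≤ ‖z‖⁻¹ + ‖z - z₀‖ + 1 + 7 * |green d z₀| := by
  have hpi := Real.pi_gt_three
  have hpi' := Real.pi_lt_d2
  have hz := norm_nonneg z
  have hz0 := norm_nonneg z₀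
  have hzz := norm_nonneg (z - z₀)
  have hzi := inv_nonneg.2 hz
  rcases hd with rfl | rfl
  · have hg : ∀ x : E 2, |green 2 x| = 1 / (2 * Real.pi) * |Real.log ‖x‖| := by
      intro x
      simp only [green, if_true]
      rw [abs_mul, abs_neg, abs_of_pos (by positivity : 0 < 1 / (2 * Real.pi))]
    have h1 : |Real.log ‖z‖| ≤ ‖z‖⁻¹ + Real.log (1 + ‖z‖) := by
      rcases hz.eq_or_lt with h0 | h0
      · simp [← h0]
      have h2 := Real.log_le_sub_one_of_pos (inv_pos.2 h0)
      rw [Real.log_inv] at h2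
      have h3 : Real.log ‖z‖ ≤ Real.log (1 + ‖z‖) := Real.log_le_log h0 (by linarith)
      have h4 : 0 ≤ Real.log (1 + ‖z‖) := Real.log_nonneg (by linarith)
      exact abs_le.2 ⟨by linarith, by linarith⟩
    -- The function `1 + ‖·‖` is submultiplicative under addition, so the logarithm at `z` exceeds
    -- the one at `z₀` by at most a function of `z - z₀`.
    have h2 : Real.log (1 + ‖z‖) ≤ ‖z - z₀‖ + Real.log (1 + ‖z₀‖) := by
      have h3 : 1 + ‖z‖ ≤ (1 + ‖z - z₀‖) * (1 + ‖z₀‖) := by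
        have : ‖z‖ ≤ ‖z - z₀‖ + ‖z₀‖ := by simpa using norm_add_le (z - z₀) z₀
        nlinarith [mul_nonneg hzz hz0]
      have h4 := Real.log_le_log (by linarith) h3
      rw [Real.log_mul (by positivity) (by positivity)] at h4
      have h5 := Real.log_le_sub_one_of_pos (by linarith : 0 < 1 + ‖z - z₀‖)
      linarith
    have h3 : Real.log (1 + ‖z₀‖) ≤ 1 + |Real.log ‖z₀‖| := by
      rcases le_total ‖z₀‖ 1 with h | h
      · have h5 := Real.log_le_sub_one_of_pos (by linarith : 0 < 1 + ‖z₀‖)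
        have := abs_nonneg (Real.log ‖z₀‖)
        linarith
      · have h4 : Real.log (1 + ‖z₀‖) ≤ Real.log (2 * ‖z₀‖) :=
          Real.log_le_log (by linarith) (by linarith)
        rw [Real.log_mul (by norm_num) (by positivity)] at h4
        have h5 := Real.log_le_sub_one_of_pos (by norm_num : (0 : ℝ) < 2)
        have := le_abs_self (Real.log ‖z₀‖)
        linarith
    -- The constant `7` only has to dominate `2π`.
    have h4 : |Real.log ‖z₀‖| ≤ 7 * |green 2 z₀| := by
      rw [hg, ← mul_assoc, mul_one_div]
      refine le_mul_of_one_le_left (abs_nonneg _) ?_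
      rw [le_div_iff₀ (by positivity)]; linarith
    have h5 : |green 2 z| ≤ |Real.log ‖z‖| := by
      rw [hg]
      refine mul_le_of_le_one_left (abs_nonneg _) ?_
      rw [div_le_one (by positivity)]; linarith
    linarith
  · have h1 : |green 3 z| ≤ ‖z‖⁻¹ := by
      simp only [green, show (3 : ℕ) ≠ 2 by norm_num, if_false]
      rw [abs_of_nonneg (by positivity), one_div, mul_inv]
      have : (4 * Real.pi)⁻¹ ≤ 1 := inv_le_one_of_one_le₀ (by linarith)
      nlinarith
    have := abs_nonneg (green 3 z₀)
    linarith

/-- Replacing `‖x‖` by `√(‖x‖² + ε²)` removes the singularity, so that integration by parts is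
available for every `ε > 0`. The derivative is the kernel with this same replacement in its
denominator. -/
lemma hasLineDerivAt_greenRad_sqrt {d : ℕ} (hd : d = 2 ∨ d = 3) {ε : ℝ} (hε : 0 < ε) (x v : E d) :
    HasLineDerivAt ℝ (fun x : E d => greenRad d (Real.sqrt (‖x‖ ^ 2 + ε ^ 2)))
      (-((sphereArea d)⁻¹ * (Real.sqrt (‖x‖ ^ 2 + ε ^ 2) ^ d)⁻¹ * inner ℝ x v)) x v := by
  have hpos : 0 < ‖x‖ ^ 2 + ε ^ 2 := by positivity
  have hsq : 0 < Real.sqrt (‖x‖ ^ 2 + ε ^ 2) := Real.sqrt_pos.2 hpos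
  have h0 : HasDerivAt (fun t : ℝ => x + t • v) v 0 := by
    simpa using ((hasDerivAt_id (0 : ℝ)).smul_const v).const_add x
  have h1 := (h0.norm_sq.add_const (ε ^ 2)).sqrt (by simpa using hpos.ne')
  have h2 := HasDerivAt.comp (0 : ℝ) (h₂ := greenRad d)
    (h := fun t : ℝ => Real.sqrt (‖x + t • v‖ ^ 2 + ε ^ 2)) (by
      simpa using hasDerivAt_greenRad hd hsq) h1
  unfold HasLineDerivAt
  refine HasDerivAt.congr_deriv (f := fun t => greenRad d (Real.sqrt (‖x + t • v‖ ^ 2 + ε ^ 2))) h2 ?_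
  have hp : Real.sqrt (‖x‖ ^ 2 + ε ^ 2) ^ (d - 1) * Real.sqrt (‖x‖ ^ 2 + ε ^ 2) =
    Real.sqrt (‖x‖ ^ 2 + ε ^ 2) ^ d := by rcases hd with rfl | rfl <;> simp <;> ring
  simp only [zero_smul, add_zero]
  rw [← hp]
  field_simp

/-- `kern` is the distributional gradient of the Green function. -/
lemma integral_green_mul_fderiv {d : ℕ} (hd : d = 2 ∨ d = 3) {ψ : E d → ℝ}
    (hψ : ContDiff ℝ 1 ψ) (hs : HasCompactSupport ψ) (v : E d) :
    ∫ x, green d x * fderiv ℝ ψ x v = -∫ x, inner ℝ (kern d x) v * ψ x := by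
  have hω := sphereArea_pos d
  have := nontrivial_E hd
  set ρ : ℕ → E d → ℝ := fun j x => Real.sqrt (‖x‖ ^ 2 + (1 / ((j : ℝ) + 1)) ^ 2) with hρ
  have hj : ∀ j : ℕ, 0 < 1 / ((j : ℝ) + 1) := fun j => by positivity
  have hρpos : ∀ j x, 0 < ρ j x := fun j x => Real.sqrt_pos.2 (by have := hj j; positivity)
  have hρge : ∀ j x, ‖x‖ ≤ ρ j x := fun j x => Real.le_sqrt_of_sq_le (by
    have := hj j; nlinarith [sq_nonneg (1 / ((j : ℝ) + 1))])
  have hρle : ∀ j x, ρ j x ≤ ‖x‖ + 1 := fun j x => by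
    refine Real.sqrt_le_iff.2 ⟨by positivity, ?_⟩
    have h1 : 1 / ((j : ℝ) + 1) ≤ 1 := by
      rw [div_le_one (by positivity)]; have : (0 : ℝ) ≤ j := j.cast_nonneg
      linarith
    nlinarith [hj j, norm_nonneg x]
  have hρlim : ∀ x, Tendsto (fun j => ρ j x) atTop (𝓝 ‖x‖) := fun x => by
    have h1 : Tendsto (fun j : ℕ => ‖x‖ ^ 2 + (1 / ((j : ℝ) + 1)) ^ 2) atTop
        (𝓝 (‖x‖ ^ 2 + 0 ^ 2)) :=
      tendsto_const_nhds.add (tendsto_one_div_add_atTop_nhds_zero_nat.pow 2)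
    have h2 := (Real.continuous_sqrt.tendsto _).comp h1
    rw [zero_pow two_ne_zero, add_zero, Real.sqrt_sq (norm_nonneg x)] at h2
    exact h2
  have hρc : ∀ j, Continuous (ρ j) := fun j => by simp only [hρ]; fun_prop
  have hgc : ∀ j, Continuous (fun x : E d => greenRad d (ρ j x)) := fun j =>
    (continuousOn_greenRad d).comp_continuous (hρc j) (fun x => hρpos j x)
  have hfc : Continuous (fun x => fderiv ℝ ψ x v) :=
    (hψ.continuous_fderiv (by simp)).clm_apply continuous_const
  have hfs : HasCompactSupport (fun x => fderiv ℝ ψ x v) := hs.fderiv_apply (𝕜 := ℝ) v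
  have hkc : ∀ j, Continuous (fun x : E d =>
      -((sphereArea d)⁻¹ * (ρ j x ^ d)⁻¹ * inner ℝ x v)) := fun j => by
    have h1 : Continuous (fun x => (ρ j x ^ d)⁻¹) :=
      ((hρc j).pow d).inv₀ fun x => (pow_pos (hρpos j x) d).ne'
    fun_prop
  have hparts : ∀ j, ∫ x, greenRad d (ρ j x) * fderiv ℝ ψ x v =
      -∫ x, -((sphereArea d)⁻¹ * (ρ j x ^ d)⁻¹ * inner ℝ x v) * ψ x := by
    intro j
    refine integral_bilinear_hasLineDerivAt_right_eq_neg_left_of_integrable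
      (B := ContinuousLinearMap.mul ℝ ℝ) (v := v)
      (f' := fun x => -((sphereArea d)⁻¹ * (ρ j x ^ d)⁻¹ * inner ℝ x v)) ?_ ?_ ?_ ?_ ?_
    · exact ((hkc j).mul hψ.continuous).integrable_of_hasCompactSupport hs.mul_left
    · exact ((hgc j).mul hfc).integrable_of_hasCompactSupport hfs.mul_left
    · exact ((hgc j).mul hψ.continuous).integrable_of_hasCompactSupport hs.mul_left
    · exact fun x _ => hasLineDerivAt_greenRad_sqrt hd (hj j) x v
    · exact fun x _ => ((hψ.differentiable (by simp)).differentiableAt).hasFDerivAt.hasLineDerivAt v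
  have hne : ∀ᵐ x : E d, x ≠ 0 := by simp [ae_iff]
  have hlim1 : Tendsto (fun j => ∫ x, greenRad d (ρ j x) * fderiv ℝ ψ x v) atTop
      (𝓝 (∫ x, green d x * fderiv ℝ ψ x v)) := by
    obtain ⟨C, hC⟩ := hfc.bounded_above_of_compact_support hfs
    obtain ⟨r, hr⟩ := hfs.isCompact.isBounded.subset_ball (0 : E d)
    -- The majorant comes from `|greenRad d ρ| ≤ ρ + ρ⁻¹` together with `‖x‖ ≤ ρ ≤ ‖x‖ + 1`.
    refine tendsto_integral_of_dominated_convergence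
      ((Metric.ball (0 : E d) r).indicator fun x => (r + 1 + ‖x‖⁻¹) * C) ?_ ?_ ?_ ?_
    · exact fun j => ((hgc j).mul hfc).aestronglyMeasurable
    · rw [integrable_indicator_iff measurableSet_ball]
      exact ((integrableOn_const measure_ball_lt_top.ne).add (integrableOn_inv_norm_ball hd r)).mul_const C
    · intro j
      filter_upwards [hne] with x hx
      by_cases hxr : x ∈ Metric.ball (0 : E d) r
      · rw [indicator_of_mem hxr, norm_mul]
        have hxp := norm_pos_iff.2 hx
        have h1 := abs_greenRad_le d (hρpos j x)
        have h2 : (ρ j x)⁻¹ ≤ ‖x‖⁻¹ := inv_anti₀ hxp (hρge j x)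
        have h3 := hρle j x
        rw [mem_ball_zero_iff] at hxr
        exact mul_le_mul (by rw [Real.norm_eq_abs]; linarith) (hC x) (norm_nonneg _)
          (by have := inv_pos.2 hxp; linarith)
      · have : fderiv ℝ ψ x v = 0 := by
          by_contra h; exact hxr (hr (subset_tsupport _ h))
        simp [this, hxr]
    · filter_upwards [hne] with x hx
      refine Tendsto.mul_const _ ?_
      exact ((continuousOn_greenRad d).continuousAt (Ioi_mem_nhds (norm_pos_iff.2 hx))).tendsto.comp
        (hρlim x)
  have hlim2 : Tendsto (fun j => ∫ x, -((sphereArea d)⁻¹ * (ρ j x ^ d)⁻¹ * inner ℝ x v) * ψ x)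
      atTop (𝓝 (∫ x, inner ℝ (kern d x) v * ψ x)) := by
    -- Since `ρ ≥ ‖x‖`, the regularised kernels are all dominated by the norm of `kern` itself.
    have hb := ((integrable_kern_smul hd hψ.continuous hs).norm).mul_const ‖v‖
    refine tendsto_integral_of_dominated_convergence _ ?_ hb ?_ ?_
    · exact fun j => ((hkc j).mul hψ.continuous).aestronglyMeasurable
    · intro j
      filter_upwards [hne] with x hx
      have hxp := norm_pos_iff.2 hx
      rw [norm_mul, norm_neg, norm_mul, norm_smul, kern, norm_smul, norm_neg,
        Real.norm_of_nonneg (by have := hρpos j x; positivity),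
        Real.norm_of_nonneg (by positivity : 0 ≤ (sphereArea d)⁻¹ * (‖x‖ ^ d)⁻¹)]
      have h1 : (ρ j x ^ d)⁻¹ ≤ (‖x‖ ^ d)⁻¹ :=
        inv_anti₀ (by positivity) (pow_le_pow_left₀ hxp.le (hρge j x) d)
      have h2 := norm_inner_le_norm (𝕜 := ℝ) x v
      have h3 := hρpos j x
      calc _ ≤ (sphereArea d)⁻¹ * (‖x‖ ^ d)⁻¹ * (‖x‖ * ‖v‖) * ‖ψ x‖ := by gcongr
        _ = _ := by ring
    · filter_upwards [hne] with x hx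
      have hxp := norm_pos_iff.2 hx
      refine Tendsto.mul_const _ ?_
      have h1 := (((hρlim x).pow d).inv₀ (by positivity)).const_mul (sphereArea d)⁻¹
      have h2 := (h1.mul_const (inner ℝ x v)).neg
      convert h2 using 2
      rw [kern, inner_smul_left]; simp
  refine tendsto_nhds_unique hlim1 ?_
  simp_rw [hparts]
  exact hlim2.neg

/-! ### Convolution inequalities -/

section Young

variable {G : Type*} [NormedAddCommGroup G] [MeasurableSpace G] [BorelSpace G]
  [SecondCountableTopology G] {μ : Measure G} [SigmaFinite μ] [μ.IsAddLeftInvariant]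
  [μ.IsNegInvariant]

/-- Hölder applied to the factorisation `a · h = a^(1/p') · (a^(1/p) h)` bounds the `p`-th power of
the convolution by `‖a‖₁^(p-1)` times `a * h^p`; Tonelli then supplies the last factor `‖a‖₁`. -/
lemma lintegral_conv_mul_rpow_le_aux {a h : G → ℝ≥0∞} (ha : Measurable a) (hh : Measurable h)
    {p : ℝ} (hp : 1 ≤ p) :
    ∫⁻ x, (∫⁻ y, a (x - y) * h y ∂μ) ^ p ∂μ ≤ (∫⁻ x, a x ∂μ) ^ p * ∫⁻ y, h y ^ p ∂μ := by
  have hax : ∀ x, ∫⁻ y, a (x - y) ∂μ = ∫⁻ y, a y ∂μ := fun x =>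
    lintegral_sub_left_eq_self a x
  have hax' : ∀ y, ∫⁻ x, a (x - y) ∂μ = ∫⁻ y, a y ∂μ := fun y =>
    lintegral_sub_right_eq_self a y
  have key : ∀ x, (∫⁻ y, a (x - y) * h y ∂μ) ^ p ≤
      (∫⁻ y, a y ∂μ) ^ (p - 1) * ∫⁻ y, a (x - y) * h y ^ p ∂μ := by
    intro x
    rcases hp.eq_or_lt with rfl | hp1
    · simp
    have hp0 : 0 < p := by linarith
    have hpq := Real.HolderConjugate.conjExponent hp1
    have hq0 : 0 < p.conjExponent := hpq.symm.pos
    have hm : Measurable fun y => a (x - y) := ha.comp (measurable_const.sub measurable_id)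
    have h1 := ENNReal.lintegral_mul_le_Lp_mul_Lq μ hpq.symm
      (f := fun y => a (x - y) ^ (1 / p.conjExponent))
      (g := fun y => a (x - y) ^ (1 / p) * h y)
      (hm.pow_const _).aemeasurable ((hm.pow_const _).mul hh).aemeasurable
    have e1 : ∀ y, ((fun y => a (x - y) ^ (1 / p.conjExponent)) *
        (fun y => a (x - y) ^ (1 / p) * h y)) y = a (x - y) * h y := by
      intro y
      simp only [Pi.mul_apply]
      rw [← mul_assoc, ← ENNReal.rpow_add_of_nonneg _ _ (by positivity) (by positivity)]
      have : 1 / p.conjExponent + 1 / p = 1 := by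
        have := hpq.inv_add_inv_eq_one
        rw [one_div, one_div, add_comm]; exact this
      rw [this, ENNReal.rpow_one]
    simp_rw [e1] at h1
    have e2 : ∀ y, (a (x - y) ^ (1 / p.conjExponent)) ^ p.conjExponent = a (x - y) := fun y => by
      rw [← ENNReal.rpow_mul, one_div, inv_mul_cancel₀ hq0.ne', ENNReal.rpow_one]
    have e3 : ∀ y, (a (x - y) ^ (1 / p) * h y) ^ p = a (x - y) * h y ^ p := fun y => by
      rw [ENNReal.mul_rpow_of_nonneg _ _ hp0.le, ← ENNReal.rpow_mul, one_div,
        inv_mul_cancel₀ hp0.ne', ENNReal.rpow_one]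
    simp_rw [e2, e3, hax] at h1
    have h2 := ENNReal.rpow_le_rpow h1 hp0.le
    rw [ENNReal.mul_rpow_of_nonneg _ _ hp0.le, ← ENNReal.rpow_mul, ← ENNReal.rpow_mul] at h2
    have e4 : 1 / p.conjExponent * p = p - 1 := by
      have := hpq.sub_one_mul_conj
      rw [one_div, ← div_eq_inv_mul, div_eq_iff hq0.ne', this]
    rw [e4, one_div, inv_mul_cancel₀ hp0.ne', ENNReal.rpow_one] at h2
    exact h2
  calc ∫⁻ x, (∫⁻ y, a (x - y) * h y ∂μ) ^ p ∂μ
      ≤ ∫⁻ x, (∫⁻ y, a y ∂μ) ^ (p - 1) * ∫⁻ y, a (x - y) * h y ^ p ∂μ ∂μ :=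
        lintegral_mono key
    _ = (∫⁻ y, a y ∂μ) ^ (p - 1) * ∫⁻ x, ∫⁻ y, a (x - y) * h y ^ p ∂μ ∂μ := by
        refine lintegral_const_mul _ (Measurable.lintegral_prod_right' (f := fun z : G × G =>
          a (z.1 - z.2) * h z.2 ^ p) ?_)
        exact (ha.comp (measurable_fst.sub measurable_snd)).mul
          ((hh.comp measurable_snd).pow_const _)
    _ = (∫⁻ y, a y ∂μ) ^ (p - 1) * ((∫⁻ y, a y ∂μ) * ∫⁻ y, h y ^ p ∂μ) := by
        congr 1
        rw [lintegral_lintegral_swap]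
        · have h1 : ∀ y, ∫⁻ x, a (x - y) * h y ^ p ∂μ = (∫⁻ y, a y ∂μ) * h y ^ p := fun y => by
            have hm : Measurable fun x => a (x - y) := ha.comp (measurable_id.sub_const y)
            rw [lintegral_mul_const _ hm, hax']
          simp_rw [h1]
          exact lintegral_const_mul _ (hh.pow_const _)
        · exact ((ha.comp (measurable_fst.sub measurable_snd)).mul
            ((hh.comp measurable_snd).pow_const _)).aemeasurable
    _ = _ := by
        rw [← mul_assoc]
        congr 1
        nth_rw 2 [← ENNReal.rpow_one (∫⁻ y, a y ∂μ)]
        rw [← ENNReal.rpow_add_of_nonneg _ _ (by linarith) zero_le_one, sub_add_cancel]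

/-- **Young's convolution inequality** `‖a * h‖_p ≤ ‖a‖_1 ‖h‖_p`. -/
lemma lintegral_conv_mul_rpow_le {a h : G → ℝ≥0∞} (ha : AEMeasurable a μ) (hh : AEMeasurable h μ)
    {p : ℝ} (hp : 1 ≤ p) :
    ∫⁻ x, (∫⁻ y, a (x - y) * h y ∂μ) ^ p ∂μ ≤ (∫⁻ x, a x ∂μ) ^ p * ∫⁻ y, h y ^ p ∂μ := by
  have h1 : ∀ x, ∫⁻ y, a (x - y) * h y ∂μ = ∫⁻ y, ha.mk a (x - y) * hh.mk h y ∂μ := by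
    intro x
    -- For every `x`, and not just almost every one, `y ↦ x - y` pulls null sets back to null sets,
    -- so the representatives give the same convolution everywhere.
    have hq : ∀ᵐ y ∂μ, a (x - y) = ha.mk a (x - y) :=
      (quasiMeasurePreserving_sub_left μ x).ae ha.ae_eq_mk
    refine lintegral_congr_ae ?_
    filter_upwards [hq, hh.ae_eq_mk] with y h1 h2
    rw [h1, h2]
  have h2 : ∫⁻ y, h y ^ p ∂μ = ∫⁻ y, hh.mk h y ^ p ∂μ :=
    lintegral_congr_ae (hh.ae_eq_mk.mono fun y hy => by simp only; rw [hy])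
  simp_rw [h1, h2]
  rw [lintegral_congr_ae ha.ae_eq_mk]
  exact lintegral_conv_mul_rpow_le_aux ha.measurable_mk hh.measurable_mk hp

/-- The domination form of Young's inequality, including `p = ∞`. It serves for both pieces of the
field and for mollification. -/
lemma eLpNorm_le_of_le_conv {V W : Type*} [ENorm V] [TopologicalSpace W] [ContinuousENorm W]
    {F : G → V} {g : G → W} {a : G → ℝ≥0∞} (ha : AEMeasurable a μ)
    (hg : AEStronglyMeasurable g μ) {p : ℝ≥0∞} (hp : 1 ≤ p)
    (hF : ∀ᵐ x ∂μ, ‖F x‖ₑ ≤ ∫⁻ y, a (x - y) * ‖g y‖ₑ ∂μ) :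
    eLpNorm F p μ ≤ (∫⁻ x, a x ∂μ) * eLpNorm g p μ := by
  rcases eq_or_ne p ⊤ with rfl | hpt
  · rw [eLpNorm_exponent_top, eLpNorm_exponent_top]
    refine essSup_le_of_ae_le _ ?_
    filter_upwards [hF] with x hx
    refine hx.trans ?_
    have : ∫⁻ y, a (x - y) * ‖g y‖ₑ ∂μ ≤ ∫⁻ y, a (x - y) * eLpNormEssSup g μ ∂μ := by
      refine lintegral_mono_ae ?_
      filter_upwards [enorm_ae_le_eLpNormEssSup g μ] with y hy
      gcongr
    refine this.trans ?_
    have hax : AEMeasurable (fun y => a (x - y)) μ :=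
      ha.comp_quasiMeasurePreserving (quasiMeasurePreserving_sub_left μ x)
    rw [lintegral_mul_const'' _ hax, lintegral_sub_left_eq_self a x]
  · have hp0 : p ≠ 0 := (zero_lt_one.trans_le hp).ne'
    have hpr : 1 ≤ p.toReal := by
      rw [← ENNReal.toReal_one]; exact ENNReal.toReal_mono hpt hp
    have hpr0 : 0 < p.toReal := by linarith
    rw [eLpNorm_eq_lintegral_rpow_enorm_toReal hp0 hpt,
      eLpNorm_eq_lintegral_rpow_enorm_toReal hp0 hpt]
    have h1 : ∫⁻ x, ‖F x‖ₑ ^ p.toReal ∂μ ≤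
        (∫⁻ x, a x ∂μ) ^ p.toReal * ∫⁻ y, ‖g y‖ₑ ^ p.toReal ∂μ := by
      refine le_trans (lintegral_mono_ae ?_) (lintegral_conv_mul_rpow_le ha hg.enorm hpr)
      filter_upwards [hF] with x hx
      exact ENNReal.rpow_le_rpow hx hpr0.le
    have h2 := ENNReal.rpow_le_rpow h1 (by positivity : 0 ≤ 1 / p.toReal)
    rw [ENNReal.mul_rpow_of_nonneg _ _ (by positivity), ← ENNReal.rpow_mul,
      mul_one_div_cancel hpr0.ne', ENNReal.rpow_one] at h2
    exact h2

end Young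

/-- Interpolation between an `L^p` space and `L^∞`. -/
lemma eLpNorm_le_max {α V : Type*} [MeasurableSpace α] {μ : Measure α} [NormedAddCommGroup V]
    {f : α → V} {p q : ℝ≥0∞} (hf : AEStronglyMeasurable f μ) (hp : p ≠ 0)
    (hpq : p ≤ q) :
    eLpNorm f q μ ≤ max (eLpNorm f p μ) (eLpNorm f ⊤ μ) := by
  rcases eq_or_ne q ⊤ with rfl | hq
  · exact le_max_right _ _
  have hpt : p ≠ ⊤ := ne_top_of_le_ne_top hq hpq
  have hq0 : q ≠ 0 := (pos_iff_ne_zero.2 hp |>.trans_le hpq).ne'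
  have hpr : 0 < p.toReal := ENNReal.toReal_pos hp hpt
  have hqr : 0 < q.toReal := ENNReal.toReal_pos hq0 hq
  have hpqr : p.toReal ≤ q.toReal := ENNReal.toReal_mono hq hpq
  set m := max (eLpNorm f p μ) (eLpNorm f ⊤ μ) with hm
  have h1 : ∫⁻ x, ‖f x‖ₑ ^ q.toReal ∂μ ≤ m ^ q.toReal := by
    calc ∫⁻ x, ‖f x‖ₑ ^ q.toReal ∂μ
        -- Almost everywhere `|f| ≤ m`, so `q - p` of the `q` factors can be replaced by `m`.
        ≤ ∫⁻ x, m ^ (q.toReal - p.toReal) * ‖f x‖ₑ ^ p.toReal ∂μ := by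
          refine lintegral_mono_ae ?_
          filter_upwards [enorm_ae_le_eLpNormEssSup f μ] with x hx
          have hx' : ‖f x‖ₑ ≤ m := hx.trans (by
            rw [hm, eLpNorm_exponent_top]; exact le_max_right _ _)
          have e : q.toReal = (q.toReal - p.toReal) + p.toReal := by ring
          conv_lhs => rw [e]
          rw [ENNReal.rpow_add_of_nonneg _ _ (by linarith) hpr.le]
          gcongr
      _ ≤ m ^ (q.toReal - p.toReal) * ∫⁻ x, ‖f x‖ₑ ^ p.toReal ∂μ := by
          rw [lintegral_const_mul'' _ (hf.enorm.pow_const _)]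
      _ ≤ m ^ (q.toReal - p.toReal) * m ^ p.toReal := by
          gcongr
          have : ∫⁻ x, ‖f x‖ₑ ^ p.toReal ∂μ = (eLpNorm f p μ) ^ p.toReal := by
            rw [eLpNorm_eq_lintegral_rpow_enorm_toReal hp hpt, ← ENNReal.rpow_mul,
              one_div_mul_cancel hpr.ne', ENNReal.rpow_one]
          rw [this]
          exact ENNReal.rpow_le_rpow (le_max_left _ _) hpr.le
      _ = m ^ q.toReal := by
          rw [← ENNReal.rpow_add_of_nonneg _ _ (by linarith) hpr.le, sub_add_cancel]
  rw [eLpNorm_eq_lintegral_rpow_enorm_toReal hq0 hq]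
  have h2 := ENNReal.rpow_le_rpow h1 (by positivity : 0 ≤ 1 / q.toReal)
  rwa [← ENNReal.rpow_mul, mul_one_div_cancel hqr.ne', ENNReal.rpow_one] at h2

/-! ### The field generated by a density -/

/-- The convolution of `f` with the gradient of the Green function. -/
noncomputable def field {d : ℕ} (f : E d → ℝ) (x : E d) : E d := ∫ y, f y • kern d (x - y)

/-! ### Fubini for convolutions tested against compactly supported functions -/

section Conv

variable {d : ℕ} {V : Type*} [NormedAddCommGroup V] [InnerProductSpace ℝ V]

/-- Tonelli with `x` integrated first. The bound `k` may depend on `y`, which is needed for the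
logarithmic kernel: its mass on a ball is not bounded as the centre moves away. -/
lemma integrable_conv_prod {κ : E d → V} (hκ : StronglyMeasurable κ) {f : E d → ℝ}
    (hf : AEStronglyMeasurable f) {S : Set (E d)} {k : E d → ℝ≥0∞}
    (hk : ∀ y, ∫⁻ x in S, ‖κ (x - y)‖ₑ ≤ k y) (hfk : ∫⁻ y, ‖f y‖ₑ * k y ≠ ⊤) :
    Integrable (fun p : E d × E d => f p.2 • κ (p.1 - p.2)) ((volume.restrict S).prod volume) := by
  have hm1 : StronglyMeasurable (fun p : E d × E d => κ (p.1 - p.2)) :=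
    hκ.comp_measurable (measurable_fst.sub measurable_snd)
  have hm : AEStronglyMeasurable (fun p : E d × E d => f p.2 • κ (p.1 - p.2))
      ((volume.restrict S).prod volume) := hf.comp_snd.smul hm1.aestronglyMeasurable
  refine ⟨hm, ?_⟩
  rw [HasFiniteIntegral, lintegral_prod_symm _ hm.enorm]
  refine lt_of_le_of_lt (lintegral_mono fun y => ?_) (lt_top_iff_ne_top.2 hfk)
  simp only [enorm_smul]
  rw [lintegral_const_mul]
  · gcongr; exact hk y
  · exact (hκ.comp_measurable (measurable_id.sub_const y)).enorm

/-- The convolution of a density with a kernel such that all the integrals below converge. -/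
def ConvLocInt (κ : E d → V) (f : E d → ℝ) : Prop :=
  ∀ R : ℝ, Integrable (fun p : E d × E d => f p.2 • κ (p.1 - p.2))
    ((volume.restrict (Metric.ball 0 R)).prod volume)

lemma ConvLocInt.locallyIntegrable {κ : E d → V} {f : E d → ℝ} (h : ConvLocInt κ f) :
    LocallyIntegrable (fun x => ∫ y, f y • κ (x - y)) := by
  intro x
  refine ⟨Metric.ball 0 (‖x‖ + 1), Metric.isOpen_ball.mem_nhds (by simp), ?_⟩
  exact (h (‖x‖ + 1)).integral_prod_left

/-- Fubini moves the test field onto the kernel. Distributional identities for a convolution are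
thereby reduced to the corresponding identities for the kernel. -/
lemma ConvLocInt.integral_inner [CompleteSpace V] {κ : E d → V} {f : E d → ℝ}
    (h : ConvLocInt κ f) {H : E d → V} (hH : Continuous H) (hHs : HasCompactSupport H) :
    ∫ x, inner ℝ (∫ y, f y • κ (x - y)) (H x) = ∫ y, f y * ∫ x, inner ℝ (κ (x - y)) (H x) := by
  -- Integrability on the product is known only over balls in `x`, so everything is restricted to a
  -- ball containing the support of `H`.
  obtain ⟨R, hR⟩ := hHs.isCompact.isBounded.subset_ball (0 : E d)
  obtain ⟨C, hC⟩ := hH.bounded_above_of_compact_support hHs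
  have hH0 : ∀ x ∉ Metric.ball (0 : E d) R, H x = 0 := fun x hx => by
    by_contra h0; exact hx (hR (subset_tsupport _ h0))
  have h1 : ∀ g : E d → V, ∫ x, inner ℝ (g x) (H x) =
      ∫ x in Metric.ball (0 : E d) R, inner ℝ (g x) (H x) := fun g =>
    (setIntegral_eq_integral_of_forall_compl_eq_zero fun x hx => by simp [hH0 x hx]).symm
  have hi : Integrable (fun p : E d × E d => inner ℝ (f p.2 • κ (p.1 - p.2)) (H p.1))
      ((volume.restrict (Metric.ball 0 R)).prod volume) := by
    refine ((h R).norm.mul_const C).mono' ?_ (ae_of_all _ fun p => ?_)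
    · exact (h R).aestronglyMeasurable.inner (hH.comp continuous_fst).aestronglyMeasurable
    · exact (norm_inner_le_norm _ _).trans (by gcongr; exact hC _)
  rw [h1]
  have h2 : ∀ᵐ x ∂(volume.restrict (Metric.ball (0 : E d) R)),
      inner ℝ (∫ y, f y • κ (x - y)) (H x) = ∫ y, inner ℝ (f y • κ (x - y)) (H x) := by
    filter_upwards [(h R).prod_right_ae] with x hx
    rw [real_inner_comm, ← _root_.integral_inner hx]
    simp_rw [real_inner_comm]
  rw [integral_congr_ae h2, integral_integral_swap hi]
  refine integral_congr_ae (ae_of_all _ fun y => ?_)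
  simp only
  rw [h1 (fun x => κ (x - y)), ← integral_const_mul]
  simp_rw [real_inner_smul_left]

end Conv

/-! ### Splitting the kernel at radius one -/

section Field

variable {d : ℕ}

/-- The singular part of the kernel. -/
noncomputable def kernIn (d : ℕ) (x : E d) : ℝ≥0∞ :=
  (Metric.ball (0 : E d) 1).indicator (fun x => ‖kern d x‖ₑ) x

/-- The part of the kernel at infinity. -/
noncomputable def kernOut (d : ℕ) (x : E d) : ℝ≥0∞ :=
  (Metric.ball (0 : E d) 1)ᶜ.indicator (fun x => ‖kern d x‖ₑ) x

lemma measurable_kernIn (d : ℕ) : Measurable (kernIn d) :=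
  (measurable_kern d).enorm.indicator measurableSet_ball

lemma measurable_kernOut (d : ℕ) : Measurable (kernOut d) :=
  (measurable_kern d).enorm.indicator measurableSet_ball.compl

lemma enorm_kern_eq (d : ℕ) (x : E d) : ‖kern d x‖ₑ = kernIn d x + kernOut d x :=
  (indicator_self_add_compl_apply (Metric.ball (0 : E d) 1) (fun x => ‖kern d x‖ₑ) x).symm

lemma lintegral_kernIn_lt_top (hd : d = 2 ∨ d = 3) : ∫⁻ x, kernIn d x < ⊤ := by
  unfold kernIn
  rw [lintegral_indicator measurableSet_ball]
  exact (integrableOn_kern_ball hd 1).2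

lemma kernOut_le (hd : d = 2 ∨ d = 3) (x : E d) :
    kernOut d x ≤ ENNReal.ofReal (sphereArea d)⁻¹ := by
  unfold kernOut
  refine indicator_le (M := ℝ≥0∞) (s := (Metric.ball (0 : E d) 1)ᶜ) (g := fun _ => ENNReal.ofReal (sphereArea d)⁻¹) (fun x hx => ?_) x
  rw [← ofReal_norm]
  exact ENNReal.ofReal_le_ofReal (norm_kern_le_of_one_le hd (by simpa using hx))

/-- The kernel decays like `‖x‖^(-(d-1))`, and its `q`-th power is integrable at infinity when
`(d-1)q > d`. This is the source of the admissible range of exponents in the theorem. -/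
lemma lintegral_kernOut_rpow_lt_top (hd : d = 2 ∨ d = 3) {q : ℝ} (hq : (d : ℝ) < (d - 1) * q) :
    ∫⁻ x, kernOut d x ^ q < ⊤ := by
  have hω := sphereArea_pos d
  have hd1 : (0 : ℝ) < d - 1 := by rcases hd with rfl | rfl <;> norm_num
  have hd0 : (0 : ℝ) < d := by linarith
  have hq0 : 0 < q := by
    by_contra h
    nlinarith [mul_nonneg hd1.le (by linarith : 0 ≤ -q)]
  -- The factor `2^(d-1)` comes from `1 + ‖x‖ ≤ 2‖x‖` outside the unit ball.
  set C := ((sphereArea d)⁻¹ * 2 ^ (d - 1)) with hC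
  have hCpos : 0 < C := by positivity
  have h1 : ∀ x : E d, kernOut d x ^ q ≤
      ENNReal.ofReal (C ^ q) * ENNReal.ofReal ((1 + ‖x‖) ^ (-((d - 1) * q))) := by
    intro x
    by_cases hx : x ∈ (Metric.ball (0 : E d) 1)ᶜ
    · have hx1 : 1 ≤ ‖x‖ := by simpa using hx
      rw [kernOut, indicator_of_mem hx, ← ofReal_norm, ENNReal.ofReal_rpow_of_nonneg
        (norm_nonneg _) hq0.le, ← ENNReal.ofReal_mul (by positivity)]
      refine ENNReal.ofReal_le_ofReal ?_
      have h2 : ‖kern d x‖ ≤ C * (1 + ‖x‖) ^ (-((d : ℝ) - 1)) := by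
        have e : (1 + ‖x‖) ^ (-((d : ℝ) - 1)) = ((1 + ‖x‖) ^ (d - 1))⁻¹ := by
          rw [Real.rpow_neg (by positivity)]
          congr 1
          rcases hd with rfl | rfl
          · norm_num
          · rw [show ((3 : ℕ) : ℝ) - 1 = (2 : ℕ) by norm_num, Real.rpow_natCast]
        rw [norm_kern hd, e, hC, mul_assoc]
        gcongr
        rw [← div_eq_mul_inv, le_div_iff₀ (by positivity), inv_mul_le_iff₀ (by positivity),
          ← mul_pow]
        gcongr
        linarith
      calc ‖kern d x‖ ^ q ≤ (C * (1 + ‖x‖) ^ (-((d : ℝ) - 1))) ^ q := by gcongr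
        _ = _ := by
          rw [Real.mul_rpow (by positivity) (by positivity), ← Real.rpow_mul (by positivity)]
          ring_nf
    · rw [kernOut, indicator_of_notMem hx, ENNReal.zero_rpow_of_pos hq0]
      exact zero_le
  refine lt_of_le_of_lt (lintegral_mono h1) ?_
  rw [lintegral_const_mul' _ _ ENNReal.ofReal_ne_top]
  refine ENNReal.mul_lt_top ENNReal.ofReal_lt_top ?_
  exact finite_integral_one_add_norm (by simpa using hq)

lemma enorm_field_le {f : E d → ℝ} (hf : AEStronglyMeasurable f) (x : E d) :
    ‖field f x‖ₑ ≤ (∫⁻ y, kernIn d (x - y) * ‖f y‖ₑ) + ∫⁻ y, kernOut d (x - y) * ‖f y‖ₑ := by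
  refine (enorm_integral_le_lintegral_enorm _).trans (le_of_eq ?_)
  rw [← lintegral_add_left']
  · refine lintegral_congr fun y => ?_
    rw [enorm_smul, enorm_kern_eq, mul_comm, add_mul]
  · exact ((measurable_kernIn d).comp (measurable_const.sub measurable_id)).aemeasurable.mul
      hf.enorm

lemma aestronglyMeasurable_field {f : E d → ℝ} (hf : AEStronglyMeasurable f) :
    AEStronglyMeasurable (field f) := by
  have : AEStronglyMeasurable (fun p : E d × E d => f p.2 • kern d (p.1 - p.2)) :=
    hf.comp_snd.smul
      ((measurable_kern d).comp (measurable_fst.sub measurable_snd)).aestronglyMeasurable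
  exact AEStronglyMeasurable.integral_prod_right' this

lemma lintegral_kernOut_le (hd : d = 2 ∨ d = 3) (f : E d → ℝ) (x : E d) :
    ∫⁻ y, kernOut d (x - y) * ‖f y‖ₑ ≤ ENNReal.ofReal (sphereArea d)⁻¹ * eLpNorm f 1 volume := by
  rw [eLpNorm_one_eq_lintegral_enorm, ← lintegral_const_mul' _ _ ENNReal.ofReal_ne_top]
  refine lintegral_mono fun y => ?_
  gcongr
  exact kernOut_le hd _

lemma aemeasurable_conv {a b : E d → ℝ≥0∞} (ha : Measurable a) (hb : AEMeasurable b) :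
    AEMeasurable (fun x => ∫⁻ y, a (x - y) * b y) := by
  have : AEMeasurable (fun p : E d × E d => a (p.1 - p.2) * b p.2) :=
    (ha.comp (measurable_fst.sub measurable_snd)).aemeasurable.mul hb.comp_snd
  exact this.lintegral_prod_right'

lemma eLpNorm_kernIn_conv_le {f : E d → ℝ} (hf : AEStronglyMeasurable f) {q : ℝ≥0∞}
    (hq : 1 ≤ q) : eLpNorm (fun x => ∫⁻ y, kernIn d (x - y) * ‖f y‖ₑ) q volume ≤
      (∫⁻ x, kernIn d x) * eLpNorm f q volume :=
  eLpNorm_le_of_le_conv (measurable_kernIn d).aemeasurable hf hq (ae_of_all _ fun _ => le_rfl)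

/-- Young's inequality is used twice with opposite roles: near the origin the kernel is the `L¹`
factor, at infinity the density is. -/
lemma eLpNorm_field_le {f : E d → ℝ} (hf : AEStronglyMeasurable f)
    {q : ℝ≥0∞} (hq : 1 ≤ q) :
    eLpNorm (field f) q volume ≤ (∫⁻ x, kernIn d x) * eLpNorm f q volume
      + eLpNorm (kernOut d) q volume * eLpNorm f 1 volume := by
  have h1 : eLpNorm (field f) q volume ≤ eLpNorm (fun x => (∫⁻ y, kernIn d (x - y) * ‖f y‖ₑ)
      + ∫⁻ y, kernOut d (x - y) * ‖f y‖ₑ) q volume :=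
    eLpNorm_mono_enorm fun x => by simpa using enorm_field_le hf x
  refine h1.trans ((eLpNorm_add_le
    (aemeasurable_conv (measurable_kernIn d) hf.enorm).aestronglyMeasurable
    (aemeasurable_conv (measurable_kernOut d) hf.enorm).aestronglyMeasurable hq).trans ?_)
  refine add_le_add (eLpNorm_kernIn_conv_le hf hq) ?_
  -- Here the convolution is commuted so that `‖f‖ₑ` takes the place of the integrable kernel.
  rw [mul_comm, eLpNorm_one_eq_lintegral_enorm]
  refine eLpNorm_le_of_le_conv hf.enorm (measurable_kernOut d).aestronglyMeasurable hq
    (ae_of_all _ fun x => ?_)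
  rw [enorm_eq_self, ← lintegral_sub_left_eq_self _ x]
  simp [mul_comm]

lemma eLpNorm_kernOut_top_le (hd : d = 2 ∨ d = 3) :
    eLpNorm (kernOut d) ⊤ volume ≤ ENNReal.ofReal (sphereArea d)⁻¹ := by
  rw [eLpNorm_exponent_top]
  exact essSup_le_of_ae_le _ (ae_of_all _ fun x => by simpa using kernOut_le hd x)

lemma eLpNorm_kernOut_lt_top (hd : d = 2 ∨ d = 3) {q : ℝ≥0∞} (hq0 : q ≠ 0) (hqt : q ≠ ⊤)
    (hq : (d : ℝ) < (d - 1) * q.toReal) : eLpNorm (kernOut d) q volume < ⊤ := by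
  rw [eLpNorm_eq_lintegral_rpow_enorm_toReal hq0 hqt]
  simp only [enorm_eq_self]
  exact ENNReal.rpow_lt_top_of_nonneg (by positivity)
    (lintegral_kernOut_rpow_lt_top hd hq).ne

end Field

/-! ### The potential, its weak gradient and the Poisson equation -/

section Potential

variable {d : ℕ}

/-- The singular piece has finite total mass and the outer piece is bounded, so the mass of a
translate of the kernel on a ball is bounded uniformly in the translation. -/
lemma convLocInt_kern (hd : d = 2 ∨ d = 3) {f : E d → ℝ} (hf : Integrable f) :
    ConvLocInt (kern d) f := by
  intro R
  refine integrable_conv_prod (measurable_kern d).stronglyMeasurable hf.aestronglyMeasurable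
    (k := fun _ => (∫⁻ x, kernIn d x) + ENNReal.ofReal (sphereArea d)⁻¹ *
      volume (Metric.ball (0 : E d) R)) (fun y => ?_) ?_
  · simp_rw [enorm_kern_eq]
    rw [lintegral_add_left]
    · refine add_le_add ?_ ?_
      · refine (setLIntegral_le_lintegral _ _).trans ?_
        rw [lintegral_sub_right_eq_self (kernIn d) y]
      · refine (lintegral_mono fun x => kernOut_le hd _).trans ?_
        simp
    · exact (measurable_kernIn d).comp (measurable_id.sub_const y)
  · rw [lintegral_mul_const'' _ hf.aestronglyMeasurable.enorm]
    refine ENNReal.mul_ne_top hf.2.ne ?_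
    exact ENNReal.add_ne_top.2 ⟨(lintegral_kernIn_lt_top hd).ne,
      ENNReal.mul_ne_top ENNReal.ofReal_ne_top measure_ball_lt_top.ne⟩

/-- Uniformity in `y` follows by splitting at `‖x - y‖ = 1`: the near part is translation invariant,
and the far part is at most the volume of the ball. -/
lemma exists_lintegral_inv_norm_sub_le (hd : d = 2 ∨ d = 3) (R : ℝ) :
    ∃ C : ℝ≥0∞, C ≠ ⊤ ∧ ∀ y, ∫⁻ x in Metric.ball (0 : E d) R, ‖‖x - y‖⁻¹‖ₑ ≤ C := by
  refine ⟨(∫⁻ x in Metric.ball (0 : E d) 1, ‖‖x‖⁻¹‖ₑ) + volume (Metric.ball (0 : E d) R), ?_, ?_⟩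
  · exact ENNReal.add_ne_top.2 ⟨(integrableOn_inv_norm_ball hd 1).2.ne, measure_ball_lt_top.ne⟩
  · intro y
    have h1 : ∀ z : E d, ‖‖z‖⁻¹‖ₑ ≤
        (Metric.ball (0 : E d) 1).indicator (fun z => ‖‖z‖⁻¹‖ₑ) z + 1 := by
      intro z
      by_cases hz : z ∈ Metric.ball (0 : E d) 1
      · rw [indicator_of_mem hz]; exact le_self_add
      · rw [indicator_of_notMem hz, zero_add, ← ofReal_norm, norm_inv, norm_norm]
        refine ENNReal.ofReal_le_one.2 (inv_le_one_of_one_le₀ (by simpa using hz))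
    refine (lintegral_mono fun x => h1 (x - y)).trans ?_
    rw [lintegral_add_right _ measurable_const]
    refine add_le_add ?_ (by simp)
    refine (setLIntegral_le_lintegral _ _).trans ?_
    rw [lintegral_sub_right_eq_self
      ((Metric.ball (0 : E d) 1).indicator (fun z => ‖‖z‖⁻¹‖ₑ)) y,
      lintegral_indicator measurableSet_ball]

/-- Absolute convergence at one point `x₀` is enough. By `abs_green_le`, for `x` in a ball the Green
function at `x - y` is controlled by `‖x - y‖⁻¹`, a constant and its value at `x₀ - y`. -/
lemma convLocInt_green (hd : d = 2 ∨ d = 3) {f : E d → ℝ} (hf : Integrable f)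
    (hp : HasPotential f) : ConvLocInt (green d) f := by
  intro R
  have := nontrivial_E hd
  obtain ⟨x₀, hx₀⟩ := hp.exists
  obtain ⟨C, hC, hCb⟩ := exists_lintegral_inv_norm_sub_le hd R
  set B : ℝ := |R| + ‖x₀‖ + 1 with hB
  refine integrable_conv_prod (measurable_green d).stronglyMeasurable hf.aestronglyMeasurable
    (k := fun y => C + (ENNReal.ofReal B + 7 * ‖green d (x₀ - y)‖ₑ) *
      volume (Metric.ball (0 : E d) R)) (fun y => ?_) ?_
  · have h1 : ∀ x ∈ Metric.ball (0 : E d) R, ‖green d (x - y)‖ₑ ≤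
        ‖‖x - y‖⁻¹‖ₑ + (ENNReal.ofReal B + 7 * ‖green d (x₀ - y)‖ₑ) := by
      intro x hx
      have h2 := abs_green_le hd (x - y) (x₀ - y)
      have h3 : ‖x - y - (x₀ - y)‖ ≤ |R| + ‖x₀‖ := by
        rw [sub_sub_sub_cancel_right]
        refine (norm_sub_le _ _).trans (add_le_add ?_ le_rfl)
        exact (mem_ball_zero_iff.1 hx).le.trans (le_abs_self R)
      have h7 : (7 : ℝ≥0∞) = ENNReal.ofReal 7 := by simp
      rw [← ofReal_norm, ← ofReal_norm, ← ofReal_norm, h7,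
        ← ENNReal.ofReal_mul (by norm_num), ← ENNReal.ofReal_add (by positivity) (by positivity),
        ← ENNReal.ofReal_add (by positivity) (by positivity)]
      refine ENNReal.ofReal_le_ofReal ?_
      rw [norm_inv, norm_norm, Real.norm_eq_abs, Real.norm_eq_abs]
      linarith
    refine (setLIntegral_mono' measurableSet_ball h1).trans ?_
    rw [lintegral_add_right _ measurable_const]
    exact add_le_add (hCb y) (by simp)
  · have h2 : ∫⁻ y, ‖f y‖ₑ * ‖green d (x₀ - y)‖ₑ ≠ ⊤ := by
      have := hx₀.2.ne
      simp_rw [enorm_mul, mul_comm (‖green d _‖ₑ)] at this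
      exact this
    have h3 : ∀ y, ‖f y‖ₑ * (C + (ENNReal.ofReal B + 7 * ‖green d (x₀ - y)‖ₑ) *
        volume (Metric.ball (0 : E d) R)) = ‖f y‖ₑ * (C + ENNReal.ofReal B *
        volume (Metric.ball (0 : E d) R)) + (‖f y‖ₑ * ‖green d (x₀ - y)‖ₑ) *
        (7 * volume (Metric.ball (0 : E d) R)) := fun y => by ring
    simp_rw [h3]
    rw [lintegral_add_left' (hf.aestronglyMeasurable.enorm.mul_const _),
      lintegral_mul_const'' _ hf.aestronglyMeasurable.enorm, lintegral_mul_const']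
    · refine ENNReal.add_ne_top.2 ⟨ENNReal.mul_ne_top hf.2.ne (ENNReal.add_ne_top.2 ⟨hC,
        ENNReal.mul_ne_top ENNReal.ofReal_ne_top measure_ball_lt_top.ne⟩),
        ENNReal.mul_ne_top h2 (ENNReal.mul_ne_top (by norm_num) measure_ball_lt_top.ne)⟩
    · exact ENNReal.mul_ne_top (by norm_num) measure_ball_lt_top.ne

lemma contDiff_comp_add {n : WithTop ℕ∞} {w : E d → ℝ} (hw : ContDiff ℝ n w) (y : E d) :
    ContDiff ℝ n (fun z => w (z + y)) := hw.comp (contDiff_id.add contDiff_const)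

lemma hasCompactSupport_comp_add {F : Type*} [Zero F] {w : E d → F} (hw : HasCompactSupport w)
    (y : E d) : HasCompactSupport (fun z => w (z + y)) :=
  hw.comp_homeomorph (Homeomorph.addRight y)

lemma continuous_gradient {w : E d → ℝ} (hw : ContDiff ℝ 1 w) : Continuous (gradient w) :=
  (LinearIsometryEquiv.continuous _).comp (hw.continuous_fderiv (by simp))

lemma hasCompactSupport_gradient {w : E d → ℝ} (hw : HasCompactSupport w) :
    HasCompactSupport (gradient w) :=
  (hw.fderiv ℝ).comp_left (g := (InnerProductSpace.toDual ℝ (E d)).symm) (by simp)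

lemma inner_gradient (w : E d → ℝ) (x v : E d) : inner ℝ (gradient w x) v = fderiv ℝ w x v := by
  rw [gradient, InnerProductSpace.toDual_symm_apply]

/-- `-div (field f) = f`. -/
lemma integral_inner_field_gradient (hd : d = 2 ∨ d = 3) {f : E d → ℝ} (hf : Integrable f)
    {w : E d → ℝ} (hw : ContDiff ℝ 1 w) (hs : HasCompactSupport w) :
    ∫ x, inner ℝ (field f x) (gradient w x) = ∫ x, f x * w x := by
  have h := (convLocInt_kern hd hf).integral_inner (continuous_gradient hw)
    (hasCompactSupport_gradient hs)
  unfold field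
  rw [h]
  refine integral_congr_ae (ae_of_all _ fun y => ?_)
  simp only
  congr 1
  rw [← integral_add_right_eq_self _ y]
  have h1 := integral_inner_kern_gradient hd (contDiff_comp_add hw y)
    (hasCompactSupport_comp_add hs y)
  rw [zero_add] at h1
  rw [← h1]
  refine integral_congr_ae (ae_of_all _ fun z => ?_)
  simp only [add_sub_cancel_right, gradient, fderiv_comp_add_right]

/-- The field is the weak gradient of the potential. -/
lemma isWeakGradient_field (hd : d = 2 ∨ d = 3) {f : E d → ℝ} (hf : Integrable f)
    (hp : HasPotential f) : IsWeakGradient (potential f) (field f) := by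
  have hg := convLocInt_green hd hf hp
  have hk := convLocInt_kern hd hf
  have hpot : potential f = fun x => ∫ y, f y • green d (x - y) := by
    funext x; simp only [potential, smul_eq_mul, mul_comm]
  rw [hpot]
  refine ⟨hg.locallyIntegrable, hk.locallyIntegrable, fun ψ hψ hs => ?_⟩
  have hψ1 : ContDiff ℝ 1 ψ := hψ.of_le (by exact_mod_cast le_top)
  -- Pairing with a fixed vector turns the two sides into integrals to which
  -- `ConvLocInt.integral_inner` applies, one with a scalar kernel and one with a vector kernel.
  refine ext_inner_right ℝ fun v => ?_
  have hgi : Integrable (fun x => (∫ y, f y • green d (x - y)) • gradient ψ x) :=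
    hg.locallyIntegrable.integrable_smul_right_of_hasCompactSupport (continuous_gradient hψ1)
      (hasCompactSupport_gradient hs)
  have hki : Integrable (fun x => ψ x • field f x) :=
    hk.locallyIntegrable.integrable_smul_left_of_hasCompactSupport hψ.continuous hs
  rw [inner_neg_left, real_inner_comm, ← integral_inner hgi, real_inner_comm,
    ← integral_inner hki]
  have e1 := hg.integral_inner (H := fun x => fderiv ℝ ψ x v)
    ((hψ1.continuous_fderiv (by simp)).clm_apply continuous_const) (hs.fderiv_apply (𝕜 := ℝ) v)
  have e2 := hk.integral_inner (H := fun x => ψ x • v) (hψ.continuous.smul continuous_const)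
    hs.smul_right
  have e3 : ∀ x, inner ℝ v ((∫ y, f y • green d (x - y)) • gradient ψ x) =
      inner ℝ (∫ y, f y • green d (x - y)) (fderiv ℝ ψ x v) := fun x => by
    rw [real_inner_comm, real_inner_smul_left, inner_gradient]; simp [mul_comm]
  have e4 : ∀ x, inner ℝ v (ψ x • field f x) = inner ℝ (∫ y, f y • kern d (x - y)) (ψ x • v) :=
    fun x => by rw [real_inner_smul_right, real_inner_smul_right, real_inner_comm, field]
  simp_rw [e3, e4]
  rw [e1, e2, ← integral_neg]
  refine integral_congr_ae (ae_of_all _ fun y => ?_)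
  simp only
  rw [← mul_neg]
  congr 1
  -- Translation by `y` centres the kernel and shifts the test function instead.
  rw [← integral_add_right_eq_self _ y, ← integral_add_right_eq_self (fun x =>
    inner ℝ (kern d (x - y)) (ψ x • v)) y]
  have h1 := integral_green_mul_fderiv hd (contDiff_comp_add hψ1 y)
    (hasCompactSupport_comp_add hs y) v
  simp only [add_sub_cancel_right, real_inner_smul_right]
  simp only [fderiv_comp_add_right] at h1
  rw [show (∫ x, inner ℝ (green d x) (fderiv ℝ ψ (x + y) v)) =
    ∫ x, green d x * fderiv ℝ ψ (x + y) v from by simp [mul_comm], h1]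
  simp only [mul_comm]

/-- Uniqueness of weak gradients; it identifies the `Dc` of a weak solution with the explicit
convolution. -/
lemma IsWeakGradient.ae_eq {u : E d → ℝ} {g₁ g₂ : E d → E d} (h₁ : IsWeakGradient u g₁)
    (h₂ : IsWeakGradient u g₂) : ∀ᵐ x, g₁ x = g₂ x := by
  refine ae_eq_of_integral_contDiff_smul_eq h₁.2.1 h₂.2.1 fun ψ hψ hs => ?_
  have := (h₁.2.2 ψ hψ hs).symm.trans (h₂.2.2 ψ hψ hs)
  exact neg_inj.1 this

end Potential

/-! ### Mollification -/

section Mollify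

set_option linter.unusedSectionVars false

variable {G : Type*} [NormedAddCommGroup G] [NormedSpace ℝ G] [FiniteDimensional ℝ G]
  [MeasureSpace G] [BorelSpace G] [(volume : Measure G).IsAddHaarMeasure]
  {F : Type*} [NormedAddCommGroup F] [NormedSpace ℝ F] [CompleteSpace F]

/-- A sequence of bump functions concentrating at the origin. -/
noncomputable def bumpSeq (G : Type*) [NormedAddCommGroup G] [NormedSpace ℝ G]
    [HasContDiffBump G] (i : ℕ) : ContDiffBump (0 : G) where
  rIn := 1 / (i + 1)
  rOut := 2 / (i + 1)
  rIn_pos := by positivity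
  rIn_lt_rOut := by gcongr; norm_num

/-- A mollifier. -/
noncomputable def mollifier (G : Type*) [NormedAddCommGroup G] [NormedSpace ℝ G]
    [FiniteDimensional ℝ G] [MeasureSpace G] (i : ℕ) (x : G) : ℝ :=
  (bumpSeq G i).normed volume x

/-- The convolution of a function with a smooth function of compact support. -/
noncomputable def smoothConv (ψ : G → ℝ) (f : G → F) (x : G) : F := ∫ y, ψ (x - y) • f y

lemma smoothConv_eq (ψ : G → ℝ) (f : G → F) :
    smoothConv ψ f = convolution ψ f (ContinuousLinearMap.lsmul ℝ ℝ) volume := by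
  funext x
  rw [convolution_lsmul_swap]; rfl

lemma tendsto_bumpSeq_rOut : Tendsto (fun i => (bumpSeq G i).rOut) atTop (𝓝 0) := by
  have := tendsto_one_div_add_atTop_nhds_zero_nat (𝕜 := ℝ) |>.const_mul 2
  simpa [bumpSeq, div_eq_mul_inv] using this

lemma contDiff_mollifier (i : ℕ) : ContDiff ℝ ∞ (mollifier G i) :=
  (bumpSeq G i).contDiff_normed

lemma hasCompactSupport_mollifier (i : ℕ) : HasCompactSupport (mollifier G i) :=
  (bumpSeq G i).hasCompactSupport_normed

lemma mollifier_nonneg (i : ℕ) (x : G) : 0 ≤ mollifier G i x := (bumpSeq G i).nonneg_normed x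

lemma tsupport_mollifier (i : ℕ) :
    tsupport (mollifier G i) = Metric.closedBall 0 (bumpSeq G i).rOut :=
  (bumpSeq G i).tsupport_normed_eq

lemma lintegral_mollifier (i : ℕ) : ∫⁻ x, ‖mollifier G i x‖ₑ = 1 := by
  have h1 : ∀ x, ‖mollifier G i x‖ₑ = ENNReal.ofReal (mollifier G i x) := fun x => by
    rw [← ofReal_norm, Real.norm_of_nonneg (mollifier_nonneg i x)]
  simp_rw [h1]
  rw [← ofReal_integral_eq_lintegral_ofReal _ (ae_of_all _ (mollifier_nonneg i))]
  · have := (bumpSeq G i).integral_normed (μ := volume)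
    simp only [mollifier, this, ENNReal.ofReal_one]
  · exact (contDiff_mollifier i).continuous.integrable_of_hasCompactSupport
      (hasCompactSupport_mollifier i)

/-- Convergence at Lebesgue points. The outer and inner radii of the bumps have fixed ratio `2`, as
differentiation along these kernels requires. -/
lemma ae_tendsto_mollify {f : G → F} (hf : LocallyIntegrable f) :
    ∀ᵐ x, Tendsto (fun i => smoothConv (mollifier G i) f x) atTop (𝓝 (f x)) := by
  simp_rw [smoothConv_eq]
  refine ContDiffBump.ae_convolution_tendsto_right_of_locallyIntegrable (K := 2)
    tendsto_bumpSeq_rOut (Eventually.of_forall fun i => ?_) hf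
  simp [bumpSeq, div_eq_mul_inv]

lemma integrable_smoothConv {ψ : G → ℝ} (hψ : Continuous ψ) (hs : HasCompactSupport ψ)
    {f : G → F} (hf : LocallyIntegrable f) (x : G) : Integrable (fun y => ψ (x - y) • f y) := by
  refine hf.integrable_smul_left_of_hasCompactSupport (by fun_prop) ?_
  exact hs.comp_homeomorph (Homeomorph.subLeft x)

lemma contDiff_smoothConv {ψ : G → ℝ} (hψ : ContDiff ℝ ∞ ψ) (hs : HasCompactSupport ψ)
    {f : G → F} (hf : LocallyIntegrable f) : ContDiff ℝ ∞ (smoothConv ψ f) := by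
  rw [smoothConv_eq]
  exact hs.contDiff_convolution_left _ hψ hf

lemma fderiv_smoothConv {ψ : G → ℝ} (hψ : ContDiff ℝ ∞ ψ) (hs : HasCompactSupport ψ)
    {f : G → F} (hf : LocallyIntegrable f) (x v : G) :
    fderiv ℝ (smoothConv ψ f) x v = smoothConv (fun z => fderiv ℝ ψ z v) f x := by
  have hψ1 : ContDiff ℝ 1 ψ := hψ.of_le (by exact_mod_cast le_top)
  have h := hs.hasFDerivAt_convolution_left (ContinuousLinearMap.lsmul ℝ ℝ) hψ1 hf x
  rw [← smoothConv_eq] at h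
  rw [h.fderiv, convolution_eq_swap, ContinuousLinearMap.integral_apply]
  · simp [smoothConv]
  · have hc := (hs.fderiv ℝ).convolutionExists_left
      ((ContinuousLinearMap.lsmul ℝ ℝ : ℝ →L[ℝ] F →L[ℝ] F).precompL G)
      (hψ1.continuous_fderiv (by simp)) hf x
    exact hc.integrable_swap

/-- Young's inequality with a kernel of total mass one. -/
lemma eLpNorm_mollify_le {f : G → F} {p : ℝ≥0∞} (hp : 1 ≤ p) (hf : AEStronglyMeasurable f)
    (i : ℕ) : eLpNorm (smoothConv (mollifier G i) f) p volume ≤ eLpNorm f p volume := by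
  have h := eLpNorm_le_of_le_conv (μ := volume) (F := smoothConv (mollifier G i) f) (g := f)
    (a := fun x => ‖mollifier G i x‖ₑ) (contDiff_mollifier i).continuous.enorm.aemeasurable
    hf hp (ae_of_all _ fun x => by
      refine (enorm_integral_le_lintegral_enorm _).trans (le_of_eq ?_)
      simp_rw [enorm_smul])
  rwa [lintegral_mollifier, one_mul] at h

/-- Uniform continuity gives uniform convergence, and all the differences are supported in one
compact set, so every `L^p` norm tends to zero. -/
lemma tendsto_eLpNorm_mollify_of_continuous {g : G → F} (hg : Continuous g)
    (hs : HasCompactSupport g) (p : ℝ≥0∞) :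
    Tendsto (fun i => eLpNorm (fun x => smoothConv (mollifier G i) g x - g x) p volume)
      atTop (𝓝 0) := by
  -- Thickening by `2` suffices because the outer radii `2 / (i + 1)` never exceed `2`.
  set K := Metric.cthickening 2 (tsupport g) with hK
  have hKc : IsCompact K := hs.isCompact.cthickening
  have hrle : ∀ i, (bumpSeq G i).rOut ≤ 2 := fun i => by
    simp only [bumpSeq]
    rw [div_le_iff₀ (by positivity)]
    have : (0 : ℝ) ≤ i := i.cast_nonneg
    linarith
  have hzero : ∀ i, ∀ x ∉ K, smoothConv (mollifier G i) g x - g x = 0 := by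
    intro i x hx
    have hgx : ∀ y, dist x y ≤ 2 → g y = 0 := by
      intro y hy
      by_contra h0
      exact hx (Metric.mem_cthickening_of_dist_le x y 2 _ (subset_tsupport _ h0) hy)
    rw [hgx x (by simp), sub_zero]
    refine integral_eq_zero_of_ae (ae_of_all _ fun y => ?_)
    simp only [Pi.zero_apply]
    by_cases hy : dist x y ≤ 2
    · rw [hgx y hy, smul_zero]
    · have : mollifier G i (x - y) = 0 := by
        by_contra h0
        have := subset_tsupport _ h0
        rw [tsupport_mollifier, mem_closedBall_zero_iff, ← dist_eq_norm] at this
        exact hy (this.trans (hrle i))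
      rw [this, zero_smul]
  have hunif := hs.uniformContinuous_of_continuous hg
  have hbound : ∀ ε : ℝ, 0 < ε → ∀ᶠ i in atTop,
      eLpNorm (fun x => smoothConv (mollifier G i) g x - g x) p volume ≤
        (volume K) ^ p.toReal⁻¹ * ENNReal.ofReal ε := by
    intro ε hε
    obtain ⟨δ, hδ, hδg⟩ := Metric.uniformContinuous_iff.1 hunif ε hε
    filter_upwards [tendsto_bumpSeq_rOut (G := G) |>.eventually_lt_const hδ] with i hi
    have hd : ∀ x, ‖smoothConv (mollifier G i) g x - g x‖ ≤ ε := by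
      intro x
      rw [← dist_eq_norm, smoothConv_eq]
      refine (bumpSeq G i).dist_normed_convolution_le hg.aestronglyMeasurable fun y hy => ?_
      exact (hδg (lt_trans (Metric.mem_ball.1 hy) hi)).le
    have hsub : Function.support (fun x => smoothConv (mollifier G i) g x - g x) ⊆ K := by
      intro x hx
      by_contra h0
      exact hx (hzero i x h0)
    rw [← eLpNorm_restrict_eq_of_support_subset hsub]
    refine (eLpNorm_le_of_ae_bound (ae_of_all _ hd)).trans (le_of_eq ?_)
    simp
  have hfin : (volume K) ^ p.toReal⁻¹ ≠ ⊤ :=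
    (ENNReal.rpow_lt_top_of_nonneg (by positivity) hKc.measure_lt_top.ne).ne
  rw [ENNReal.tendsto_nhds_zero]
  intro ε hε
  have h1 : Tendsto (fun η : ℝ => (volume K) ^ p.toReal⁻¹ * ENNReal.ofReal η) (𝓝[>] 0)
      (𝓝 ((volume K) ^ p.toReal⁻¹ * ENNReal.ofReal 0)) :=
    ENNReal.Tendsto.const_mul
      ((ENNReal.continuous_ofReal.tendsto 0).mono_left nhdsWithin_le_nhds) (Or.inr hfin)
  rw [ENNReal.ofReal_zero, mul_zero] at h1
  obtain ⟨η, hη, hη0⟩ := ((h1.eventually (gt_mem_nhds hε)).and self_mem_nhdsWithin).exists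
  filter_upwards [hbound η hη0] with i hi
  exact hi.trans hη.le

/-- Mollification converges in `L^p`. -/
lemma tendsto_eLpNorm_mollify {f : G → F} {p : ℝ≥0∞} [hp : Fact (1 ≤ p)] (hpt : p ≠ ⊤)
    (hf : MemLp f p) :
    Tendsto (fun i => eLpNorm (fun x => smoothConv (mollifier G i) f x - f x) p volume)
      atTop (𝓝 0) := by
  rw [ENNReal.tendsto_nhds_zero]
  intro ε hε
  rcases eq_or_ne ε ⊤ with rfl | hεt
  · exact Eventually.of_forall fun _ => le_top
  have hε3 : ε / 3 ≠ 0 := (ENNReal.div_pos hε.ne' (by norm_num)).ne'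
  obtain ⟨g, hgs, hgf, hgc, hgp⟩ := hf.exists_hasCompactSupport_eLpNorm_sub_le hpt hε3
  have h1 := (ENNReal.tendsto_nhds_zero.1
    (tendsto_eLpNorm_mollify_of_continuous hgc hgs p)) (ε / 3) (pos_iff_ne_zero.2 hε3)
  filter_upwards [h1] with i hi
  have hfl : LocallyIntegrable f := hf.locallyIntegrable hp.out
  have hgl : LocallyIntegrable g := hgc.locallyIntegrable
  have hψ := contDiff_mollifier (G := G) i
  have hψs := hasCompactSupport_mollifier (G := G) i
  have e1 : ∀ x, smoothConv (mollifier G i) (f - g) x =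
      smoothConv (mollifier G i) f x - smoothConv (mollifier G i) g x := fun x => by
    unfold smoothConv
    rw [← integral_sub (integrable_smoothConv hψ.continuous hψs hfl x)
      (integrable_smoothConv hψ.continuous hψs hgl x)]
    simp_rw [Pi.sub_apply, smul_sub]
  -- Three-term splitting through the continuous approximation `g`. Mollification does not increase
  -- the norm of `f - g`, so each term costs at most `ε / 3`.
  have e : (fun x => smoothConv (mollifier G i) f x - f x) =
      (smoothConv (mollifier G i) (f - g) + (fun x => smoothConv (mollifier G i) g x - g x))
        - (f - g) := by
    funext x
    simp only [Pi.sub_apply, Pi.add_apply, e1]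
    abel
  have hfg : AEStronglyMeasurable (f - g) := (hf.sub hgp).aestronglyMeasurable
  have m1 : AEStronglyMeasurable (smoothConv (mollifier G i) (f - g)) :=
    (contDiff_smoothConv hψ hψs (hfl.sub hgl)).continuous.aestronglyMeasurable
  have m2 : AEStronglyMeasurable (fun x => smoothConv (mollifier G i) g x - g x) :=
    ((contDiff_smoothConv hψ hψs hgl).continuous.sub hgc).aestronglyMeasurable
  rw [e]
  calc _ ≤ eLpNorm (smoothConv (mollifier G i) (f - g) +
          (fun x => smoothConv (mollifier G i) g x - g x)) p volume + eLpNorm (f - g) p volume :=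
        eLpNorm_sub_le (m1.add m2) hfg hp.out
    _ ≤ (eLpNorm (smoothConv (mollifier G i) (f - g)) p volume + eLpNorm
          (fun x => smoothConv (mollifier G i) g x - g x) p volume) + eLpNorm (f - g) p volume :=
        add_le_add (eLpNorm_add_le m1 m2 hp.out) le_rfl
    _ ≤ (ε / 3 + ε / 3) + ε / 3 := by
        gcongr
        exact (eLpNorm_mollify_le hp.out hfg i).trans hgf
    _ = ε := by rw [ENNReal.add_thirds]

end Mollify

/-! ### Passing to the limit -/

section Limits

variable {α : Type*} [MeasurableSpace α] {μ : Measure α}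

/-- Write `a i * g i = a i * h + a i * (g i - h)`: the first term converges by domination, the
second because the `a i` are uniformly bounded. With `a = b = 1` this says that `L¹` convergence
implies convergence of integrals. -/
lemma tendsto_integral_mul_of_L1 {a : ℕ → α → ℝ} {b : α → ℝ} {g : ℕ → α → ℝ} {h : α → ℝ} {C : ℝ}
    (ha : ∀ i, AEStronglyMeasurable (a i) μ) (haC : ∀ i, ∀ᵐ x ∂μ, ‖a i x‖ ≤ C)
    (hab : ∀ᵐ x ∂μ, h x ≠ 0 → Tendsto (fun i => a i x) atTop (𝓝 (b x)))
    (hg : ∀ i, Integrable (g i) μ) (hh : Integrable h μ)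
    (hgh : Tendsto (fun i => eLpNorm (fun x => g i x - h x) 1 μ) atTop (𝓝 0)) :
    Tendsto (fun i => ∫ x, a i x * g i x ∂μ) atTop (𝓝 (∫ x, b x * h x ∂μ)) := by
  have h1 : Tendsto (fun i => ∫ x, a i x * h x ∂μ) atTop (𝓝 (∫ x, b x * h x ∂μ)) := by
    refine tendsto_integral_of_dominated_convergence (fun x => C * ‖h x‖)
      (fun i => (ha i).mul hh.aestronglyMeasurable) (hh.norm.const_mul C) (fun i => ?_) ?_
    · filter_upwards [haC i] with x hx
      rw [norm_mul]
      gcongr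
    · filter_upwards [hab] with x hx
      by_cases h0 : h x = 0
      · simp [h0]
      · exact (hx h0).mul_const _
  have h2 : Tendsto (fun i => ∫ x, a i x * (g i x - h x) ∂μ) atTop (𝓝 0) := by
    have h3 : Tendsto (fun i => ENNReal.ofReal C * eLpNorm (fun x => g i x - h x) 1 μ)
        atTop (𝓝 0) := by
      have := ENNReal.Tendsto.const_mul hgh (Or.inr (ENNReal.ofReal_ne_top (r := C)))
      rwa [mul_zero] at this
    rw [tendsto_iff_edist_tendsto_0]
    refine tendsto_of_tendsto_of_tendsto_of_le_of_le tendsto_const_nhds h3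
      (fun _ => zero_le) (fun i => ?_)
    simp only [edist_zero_right]
    refine (enorm_integral_le_lintegral_enorm _).trans ?_
    rw [eLpNorm_one_eq_lintegral_enorm, ← lintegral_const_mul' _ _ ENNReal.ofReal_ne_top]
    refine lintegral_mono_ae ?_
    filter_upwards [haC i] with x hx
    rw [enorm_mul]
    gcongr
    rw [← ofReal_norm]
    exact ENNReal.ofReal_le_ofReal hx
  have h3 := h1.add h2
  rw [add_zero] at h3
  refine h3.congr fun i => ?_
  rw [← integral_add]
  · refine integral_congr_ae (ae_of_all _ fun x => ?_)
    simp only; ring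
  · exact hh.bdd_mul (ha i) (haC i)
  · exact ((hg i).sub hh).bdd_mul (ha i) (haC i)

/-- Cauchy–Schwarz with one factor tending to zero in `L²` and the other fixed. -/
lemma tendsto_eLpNorm_one_of_eLpNorm_two {V : Type*} [NormedAddCommGroup V]
    {W : Type*} [NormedAddCommGroup W] {f : ℕ → α → V} {h : α → W} {g : ℕ → α → ℝ} {C : ℝ≥0}
    (hf : ∀ i, AEStronglyMeasurable (f i) μ) (hh : MemLp h 2 μ)
    (hg : ∀ i, ∀ᵐ x ∂μ, ‖g i x‖ ≤ C * ‖f i x‖ * ‖h x‖)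
    (hlim : Tendsto (fun i => eLpNorm (f i) 2 μ) atTop (𝓝 0)) :
    Tendsto (fun i => eLpNorm (g i) 1 μ) atTop (𝓝 0) := by
  have h1 : Tendsto (fun i => (C * eLpNorm (f i) 2 μ) * eLpNorm h 2 μ) atTop (𝓝 0) := by
    have := ENNReal.Tendsto.mul_const (ENNReal.Tendsto.const_mul hlim
      (Or.inr (ENNReal.coe_ne_top (r := C)))) (Or.inr hh.2.ne)
    rwa [mul_zero, zero_mul] at this
  refine tendsto_of_tendsto_of_tendsto_of_le_of_le tendsto_const_nhds h1
      (fun _ => zero_le) (fun i => ?_)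
  have h2 := eLpNorm_le_eLpNorm_mul_eLpNorm'_of_norm (p := 2) (q := 2) (r := 1) (hf i)
    hh.aestronglyMeasurable (fun (a : V) (b : W) => (C : ℝ) * (‖a‖ * ‖b‖)) C
    (ae_of_all _ fun x => by
      rw [Real.norm_of_nonneg (by positivity), mul_assoc])
  refine (eLpNorm_mono_ae_real ?_).trans h2
  filter_upwards [hg i] with x hx
  rwa [mul_assoc] at hx

lemma memLp_of_support_subset {V : Type*} [NormedAddCommGroup V] {F : α → V} {p : ℝ≥0∞}
    {S : Set α} (hS : MeasurableSet S) (hF : ∀ x ∉ S, F x = 0) (h : MemLp F p (μ.restrict S)) :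
    MemLp F p μ := by
  have := (memLp_indicator_iff_restrict hS).2 h
  rwa [indicator_eq_self.2] at this
  intro x hx
  by_contra h0
  exact hx (hF x h0)

lemma integrable_inner_of_memLp {V : Type*} [NormedAddCommGroup V] [InnerProductSpace ℝ V]
    {f g : α → V} (hf : MemLp f 2 μ) (hg : MemLp g 2 μ) :
    Integrable (fun x => (inner ℝ (f x) (g x) : ℝ)) μ :=
  (hf.norm.integrable_mul hg.norm).mono' (hf.1.inner hg.1)
    (ae_of_all _ fun _ => norm_inner_le_norm _ _)

end Limits

/-! ### The product rule for a Sobolev function and a field with a divergence -/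

section ProductRule

variable {d : ℕ}

/-- The weak gradient is tested against `y ↦ ψ (x - y)`; the sign from the reflection cancels the
one in the definition. -/
lemma IsWeakGradient.fderiv_smoothConv {n : E d → ℝ} {Dn : E d → E d} (h : IsWeakGradient n Dn)
    {ψ : E d → ℝ} (hψ : ContDiff ℝ ∞ ψ) (hs : HasCompactSupport ψ) (x v : E d) :
    fderiv ℝ (smoothConv ψ n) x v = inner ℝ (smoothConv ψ Dn x) v := by
  rw [NernstPlanck.fderiv_smoothConv hψ hs h.1]
  have hψ' : ContDiff ℝ ∞ (fun y => ψ (x - y)) := hψ.comp (contDiff_const.sub contDiff_id)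
  have hs' : HasCompactSupport (fun y => ψ (x - y)) :=
    hs.comp_homeomorph (Homeomorph.subLeft x)
  have h1 := h.2.2 _ hψ' hs'
  have hg : ∀ y, inner ℝ (gradient (fun y => ψ (x - y)) y) v = -fderiv ℝ ψ (x - y) v := by
    intro y
    have h0 : HasFDerivAt (fun y => ψ (x - y))
        ((fderiv ℝ ψ (x - y)).comp (-ContinuousLinearMap.id ℝ (E d))) y :=
      HasFDerivAt.comp y ((hψ.differentiable (by simp)).differentiableAt.hasFDerivAt)
        ((hasFDerivAt_id y).const_sub x)
    rw [inner_gradient, h0.fderiv]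
    simp
  have hψ1 : ContDiff ℝ 1 (fun y => ψ (x - y)) := hψ'.of_le (by exact_mod_cast le_top)
  have i1 : Integrable (fun y => n y • gradient (fun y => ψ (x - y)) y) :=
    h.1.integrable_smul_right_of_hasCompactSupport (continuous_gradient hψ1)
      (hasCompactSupport_gradient hs')
  have i2 : Integrable (fun y => ψ (x - y) • Dn y) :=
    h.2.1.integrable_smul_left_of_hasCompactSupport hψ'.continuous hs'
  have h2 := congrArg (fun z => inner ℝ v z) h1
  simp only [inner_neg_right] at h2
  rw [← integral_inner i1, ← integral_inner i2] at h2
  unfold smoothConv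
  rw [real_inner_comm, ← integral_inner i2, ← neg_inj, ← h2, ← integral_neg]
  refine integral_congr_ae (ae_of_all _ fun y => ?_)
  simp only
  rw [real_inner_comm, real_inner_smul_left, hg, smul_eq_mul]
  ring

/-- For smooth `n` the function `β(n - u)ψ` is an admissible test function for `div B = D`. In
general only `n` is mollified: `n` and `Dn` converge in `L²`, and `B` and `D` are square integrable
on the support of `ψ`, so both sides pass to the limit. -/
lemma integral_product_rule {β β' : ℝ → ℝ} (hβ : ∀ s, HasDerivAt β (β' s) s)
    (hβc : Continuous β') {C : ℝ≥0} (hC : ∀ s, |β' s| ≤ C) (u : ℝ) {n : E d → ℝ}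
    {Dn B : E d → E d} {D : E d → ℝ} (hn : MemLp n 2) (hDn : MemLp Dn 2)
    (hw : IsWeakGradient n Dn)
    (hB : ∀ R : ℝ, MemLp B 2 (volume.restrict (Metric.ball 0 R)))
    (hD : ∀ R : ℝ, MemLp D 2 (volume.restrict (Metric.ball 0 R)))
    (hdiv : ∀ w : E d → ℝ, ContDiff ℝ 1 w → HasCompactSupport w →
      ∫ x, inner ℝ (B x) (gradient w x) = -∫ x, D x * w x)
    {ψ : E d → ℝ} (hψ : ContDiff ℝ 1 ψ) (hs : HasCompactSupport ψ) :
    ∫ x, β' (n x - u) * (inner ℝ (Dn x) (B x) * ψ x) =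
      -∫ x, β (n x - u) * (D x * ψ x + inner ℝ (B x) (gradient ψ x)) := by
  have hβ1 : ContDiff ℝ 1 β := by
    rw [contDiff_one_iff_deriv]
    refine ⟨fun s => (hβ s).differentiableAt, ?_⟩
    rwa [funext fun s => (hβ s).deriv]
  have hlip : ∀ s t, |β s - β t| ≤ C * |s - t| := by
    intro s t
    have := Convex.norm_image_sub_le_of_norm_hasDerivWithin_le (f := β) (f' := β') (s := univ)
      (C := C) (fun x _ => (hβ x).hasDerivWithinAt) (fun x _ => hC x) convex_univ (mem_univ t)
      (mem_univ s)
    simpa using this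
  obtain ⟨R, hR⟩ := hs.isCompact.isBounded.subset_ball (0 : E d)
  have hψ0 : ∀ x ∉ Metric.ball (0 : E d) R, ψ x = 0 := fun x hx => by
    by_contra h0; exact hx (hR (subset_tsupport _ h0))
  have hg0 : ∀ x ∉ Metric.ball (0 : E d) R, gradient ψ x = 0 := fun x hx => by
    have : x ∉ tsupport ψ := fun h => hx (hR h)
    rw [gradient, fderiv_of_notMem_tsupport (𝕜 := ℝ) this, map_zero]
  obtain ⟨K, hK⟩ := hψ.continuous.bounded_above_of_compact_support hs
  obtain ⟨K', hK'⟩ := (continuous_gradient hψ).bounded_above_of_compact_support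
    (hasCompactSupport_gradient hs)
  -- the two auxiliary square integrable factors
  have hP : MemLp (fun x => ψ x • B x) 2 := by
    refine memLp_of_support_subset measurableSet_ball (fun x hx => by simp [hψ0 x hx])
      (S := Metric.ball 0 R) ?_
    refine (hB R).of_le_mul (c := K) (hψ.continuous.aestronglyMeasurable.smul (hB R).1)
      (ae_of_all _ fun x => ?_)
    rw [norm_smul]; gcongr; exact hK x
  have hHball : MemLp (fun x => D x * ψ x + inner ℝ (B x) (gradient ψ x)) 2
      (volume.restrict (Metric.ball 0 R)) := by
    refine MemLp.add ?_ ?_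
    · refine (hD R).of_le_mul (c := K) ((hD R).1.mul hψ.continuous.aestronglyMeasurable)
        (ae_of_all _ fun x => ?_)
      rw [norm_mul, mul_comm]; gcongr; exact hK x
    · refine (hB R).of_le_mul (c := K')
        ((hB R).1.inner (continuous_gradient hψ).aestronglyMeasurable)
        (ae_of_all _ fun x => ?_)
      refine (norm_inner_le_norm _ _).trans ?_
      rw [mul_comm]; gcongr; exact hK' x
  have hH0 : ∀ x ∉ Metric.ball (0 : E d) R, D x * ψ x + inner ℝ (B x) (gradient ψ x) = 0 :=
    fun x hx => by simp [hψ0 x hx, hg0 x hx]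
  set H := fun x => D x * ψ x + inner ℝ (B x) (gradient ψ x) with hHdef
  have hH : MemLp H 2 := memLp_of_support_subset measurableSet_ball hH0 hHball
  have hHi : Integrable H := by
    rw [← memLp_one_iff_integrable]
    refine memLp_of_support_subset measurableSet_ball hH0 ?_
    have : IsFiniteMeasure (volume.restrict (Metric.ball (0 : E d) R)) :=
      ⟨by simpa using measure_ball_lt_top⟩
    exact hHball.mono_exponent (by norm_num)
  -- mollification
  set m : ℕ → E d → ℝ := fun i => smoothConv (mollifier (E d) i) n with hm
  set Dm : ℕ → E d → E d := fun i => smoothConv (mollifier (E d) i) Dn with hDm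
  have hnl : LocallyIntegrable n := hw.1
  have hmc : ∀ i, ContDiff ℝ 1 (m i) := fun i =>
    (contDiff_smoothConv (contDiff_mollifier i) (hasCompactSupport_mollifier i) hnl).of_le
      (by exact_mod_cast le_top)
  have hDmc : ∀ i, Continuous (Dm i) := fun i =>
    (contDiff_smoothConv (contDiff_mollifier i) (hasCompactSupport_mollifier i) hw.2.1).continuous
  have hfd : ∀ i x v, fderiv ℝ (m i) x v = inner ℝ (Dm i x) v := fun i x v =>
    hw.fderiv_smoothConv (contDiff_mollifier i) (hasCompactSupport_mollifier i) x v
  have hmn : Tendsto (fun i => eLpNorm (fun x => m i x - n x) 2 volume) atTop (𝓝 0) :=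
    tendsto_eLpNorm_mollify (by norm_num) hn
  have hDmn : Tendsto (fun i => eLpNorm (fun x => Dm i x - Dn x) 2 volume) atTop (𝓝 0) :=
    tendsto_eLpNorm_mollify (by norm_num) hDn
  have hae : ∀ᵐ x, Tendsto (fun i => m i x) atTop (𝓝 (n x)) := ae_tendsto_mollify hnl
  have hmL : ∀ i, MemLp (Dm i) 2 := fun i =>
    ⟨(hDmc i).aestronglyMeasurable, (eLpNorm_mollify_le (by norm_num) hDn.1 i).trans_lt hDn.2⟩
  have hβcont : Continuous β := hβ1.continuous
  have i1 : ∀ i, Integrable (fun x => inner ℝ (Dm i x) (ψ x • B x)) := fun i => 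
    integrable_inner_of_memLp (hmL i) hP
  have i1' : ∀ i, Integrable (fun x => β' (m i x - u) * inner ℝ (Dm i x) (ψ x • B x)) := fun i =>
    (i1 i).bdd_mul (c := C) (hβc.comp ((hmc i).continuous.sub continuous_const)).aestronglyMeasurable
      (ae_of_all _ fun x => hC _)
  have i2 : Integrable (fun x => inner ℝ (Dn x) (ψ x • B x)) := integrable_inner_of_memLp hDn hP
  have i3 : ∀ i, Integrable (fun x => β (m i x - u) * H x) := fun i => by
    have : IntegrableOn (fun x => β (m i x - u) * H x) (Metric.ball 0 R) := by
      obtain ⟨K₂, hK₂⟩ := (isCompact_closedBall (0 : E d) R).exists_bound_of_continuousOn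
        (hβcont.comp ((hmc i).continuous.sub continuous_const)).continuousOn
      refine hHi.integrableOn.bdd_mul (c := K₂)
        (hβcont.comp ((hmc i).continuous.sub continuous_const)).aestronglyMeasurable ?_
      filter_upwards [ae_restrict_mem measurableSet_ball] with x hx
      exact hK₂ x (Metric.ball_subset_closedBall hx)
    refine (integrableOn_iff_integrable_of_support_subset ?_).1 this
    intro x hx
    by_contra h0
    exact hx (by simp only [H, hH0 x h0, mul_zero])
  -- A Lipschitz `β` grows at most linearly, so the integrand is dominated by a multiple of `|H|`
  -- plus a multiple of `|n| |H|`.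
  have i4 : Integrable (fun x => β (n x - u) * H x) := by
    have h1 : Integrable (fun x => (‖β 0‖ + C * |u|) * ‖H x‖ + C * (‖n x‖ * ‖H x‖)) :=
      (hHi.norm.const_mul _).add ((hn.norm.integrable_mul hH.norm).const_mul _)
    refine h1.mono' (((hβcont.comp_aestronglyMeasurable
      (hn.1.sub aestronglyMeasurable_const)).mul hHi.1)) (ae_of_all _ fun x => ?_)
    have h2 : ‖β (n x - u)‖ ≤ ‖β 0‖ + C * (|n x| + |u|) := by
      have h3 := hlip (n x - u) 0
      have h4 : |β (n x - u)| ≤ |β 0| + |β (n x - u) - β 0| := by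
        simpa using abs_add_le (β 0) (β (n x - u) - β 0)
      have h5 : |n x - u - 0| ≤ |n x| + |u| := by rw [sub_zero]; exact abs_sub _ _
      have h6 : (C : ℝ) * |n x - u - 0| ≤ C * (|n x| + |u|) := by gcongr
      rw [Real.norm_eq_abs, Real.norm_eq_abs]; linarith
    calc ‖β (n x - u) * H x‖ = ‖β (n x - u)‖ * ‖H x‖ := norm_mul _ _
      _ ≤ (‖β 0‖ + C * (|n x| + |u|)) * ‖H x‖ := by gcongr
      _ = _ := by rw [Real.norm_eq_abs (n x)]; ring
  -- The identity for smooth `m i`: the chain rule in the gradient of the test function produces the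
  -- term with `β'`.
  have hid : ∀ i, ∫ x, β' (m i x - u) * inner ℝ (Dm i x) (ψ x • B x) =
      -∫ x, β (m i x - u) * H x := by
    intro i
    have hw1 : ContDiff ℝ 1 (fun x => β (m i x - u) * ψ x) :=
      (hβ1.comp ((hmc i).sub contDiff_const)).mul hψ
    have hgrad : ∀ x, gradient (fun x => β (m i x - u) * ψ x) x =
        (β' (m i x - u) * ψ x) • Dm i x + β (m i x - u) • gradient ψ x := by
      intro x
      refine ext_inner_right ℝ fun v => ?_
      have e1 : HasFDerivAt (fun x => β (m i x - u)) (β' (m i x - u) • fderiv ℝ (m i) x) x :=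
        (hβ (m i x - u)).comp_hasFDerivAt x
          ((((hmc i).differentiable (by simp)).differentiableAt.hasFDerivAt).sub_const u)
      have e2 : HasFDerivAt (fun x => β (m i x - u) * ψ x) _ x := e1.mul ((hψ.differentiable (by simp)).differentiableAt (x := x)).hasFDerivAt
      rw [inner_gradient, e2.fderiv, inner_add_left, real_inner_smul_left, real_inner_smul_left,
        inner_gradient]
      simp only [_root_.add_apply, _root_.smul_apply, smul_eq_mul, hfd]
      ring
    have h1 := hdiv _ hw1 hs.mul_left
    have h2 : ∀ x, inner ℝ (B x) (gradient (fun x => β (m i x - u) * ψ x) x) =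
        β' (m i x - u) * inner ℝ (Dm i x) (ψ x • B x) +
          (β (m i x - u) * H x - D x * (β (m i x - u) * ψ x)) := fun x => by
      rw [hgrad, inner_add_right, real_inner_smul_right, real_inner_smul_right,
        real_inner_smul_right, real_inner_comm (B x) (Dm i x)]
      simp only [hHdef]
      ring
    simp_rw [h2] at h1
    have i5 : Integrable (fun x => D x * (β (m i x - u) * ψ x)) := by
      have hDi : IntegrableOn D (Metric.ball 0 R) := by
        have : IsFiniteMeasure (volume.restrict (Metric.ball (0 : E d) R)) :=
          ⟨by simpa using measure_ball_lt_top⟩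
        exact memLp_one_iff_integrable.1 ((hD R).mono_exponent (by norm_num))
      obtain ⟨K₂, hK₂⟩ := hw1.continuous.bounded_above_of_compact_support hs.mul_left
      have := hDi.mul_bdd (c := K₂) hw1.continuous.aestronglyMeasurable (ae_of_all _ hK₂)
      refine (integrableOn_iff_integrable_of_support_subset ?_).1 this
      intro x hx
      by_contra h0
      exact hx (by simp [hψ0 x h0])
    have i6 : Integrable (fun x => β (m i x - u) * H x - D x * (β (m i x - u) * ψ x)) :=
      (i3 i).sub i5
    rw [integral_add (i1' i) i6, integral_sub (i3 i) i5] at h1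
    linarith
  -- Here `β'` is only bounded and continuous, so almost everywhere convergence of `m i` is combined
  -- with `L¹` convergence of the remaining factor.
  have hA : Tendsto (fun i => ∫ x, β' (m i x - u) * inner ℝ (Dm i x) (ψ x • B x)) atTop
      (𝓝 (∫ x, β' (n x - u) * inner ℝ (Dn x) (ψ x • B x))) := by
    refine tendsto_integral_mul_of_L1 (C := C)
      (fun i => (hβc.comp ((hmc i).continuous.sub continuous_const)).aestronglyMeasurable)
      (fun i => ae_of_all _ fun x => hC _) ?_ i1 i2 ?_
    · filter_upwards [hae] with x hx _
      exact (hβc.tendsto _).comp (hx.sub_const u)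
    · refine tendsto_eLpNorm_one_of_eLpNorm_two (C := 1)
        (fun i => (hDmc i).aestronglyMeasurable.sub hDn.1) hP (fun i => ae_of_all _ fun x => ?_)
        hDmn
      rw [← inner_sub_left, NNReal.coe_one, one_mul]
      exact norm_inner_le_norm _ _
  have hZ : Tendsto (fun i => ∫ x, β (m i x - u) * H x) atTop
      (𝓝 (∫ x, β (n x - u) * H x)) := by
    have := tendsto_integral_mul_of_L1 (μ := volume) (a := fun _ _ => 1) (b := fun _ => 1) (C := 1)
      (g := fun i x => β (m i x - u) * H x) (h := fun x => β (n x - u) * H x)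
      (fun _ => aestronglyMeasurable_const) (fun _ => ae_of_all _ fun _ => by simp)
      (ae_of_all _ fun _ _ => tendsto_const_nhds) i3 i4 ?_
    · simpa using this
    · refine tendsto_eLpNorm_one_of_eLpNorm_two (C := C)
        (fun i => (hmc i).continuous.aestronglyMeasurable.sub hn.1) hH
        (fun i => ae_of_all _ fun x => ?_) hmn
      rw [← sub_mul, norm_mul]
      gcongr
      refine (hlip _ _).trans (le_of_eq ?_)
      simp
  have hfin := tendsto_nhds_unique (hA.congr hid) hZ.neg
  rw [← hfin]
  refine integral_congr_ae (ae_of_all _ fun x => ?_)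
  simp only [real_inner_smul_right]
  ring

end ProductRule

/-! ### Convex functions of distributional solutions of the heat equation -/

lemma tendsto_eLpNorm_of_le_mul {α : Type*} [MeasurableSpace α] {μ : Measure α} {V W : Type*}
    [NormedAddCommGroup V] [NormedAddCommGroup W] {f : ℕ → α → V} {g : ℕ → α → W} {C : ℝ}
    {p : ℝ≥0∞} (hg : ∀ i, ∀ᵐ x ∂μ, ‖g i x‖ ≤ C * ‖f i x‖)
    (hlim : Tendsto (fun i => eLpNorm (f i) p μ) atTop (𝓝 0)) :
    Tendsto (fun i => eLpNorm (g i) p μ) atTop (𝓝 0) := by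
  have h1 : Tendsto (fun i => ENNReal.ofReal C * eLpNorm (f i) p μ) atTop (𝓝 0) := by
    have := ENNReal.Tendsto.const_mul hlim (Or.inr (ENNReal.ofReal_ne_top (r := C)))
    rwa [mul_zero] at this
  exact tendsto_of_tendsto_of_tendsto_of_le_of_le tendsto_const_nhds h1
      (fun _ => zero_le) (fun i => eLpNorm_le_mul_eLpNorm_of_ae_le_mul (hg i) p)

section Kato

variable {d : ℕ}

/-- Mollification takes place in space and time together, so the mollifier lemmas must apply to the
product space. -/
instance isAddHaarMeasure_spaceTime (d : ℕ) :
    (volume : Measure (ℝ × E d)).IsAddHaarMeasure :=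
  inferInstanceAs ((volume : Measure ℝ).prod (volume : Measure (E d))).IsAddHaarMeasure

/-- The time direction. -/
def dirT (d : ℕ) : ℝ × E d := (1, 0)

/-- The coordinate directions in space. -/
noncomputable def dirX (d : ℕ) (i : Fin d) : ℝ × E d := (0, EuclideanSpace.single i 1)

/-- The spatial Laplacian. -/
noncomputable def lapX (ψ : ℝ × E d → ℝ) (p : ℝ × E d) : ℝ :=
  ∑ i, fderiv ℝ (fun q => fderiv ℝ ψ q (dirX d i)) p (dirX d i)

/-- The formal adjoint `∂ₜ + Δ` of the heat operator. -/
noncomputable def heatAdj (ψ : ℝ × E d → ℝ) (p : ℝ × E d) : ℝ :=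
  fderiv ℝ ψ p (dirT d) + lapX ψ p

lemma contDiff_fderiv_apply {G : Type*} [NormedAddCommGroup G] [NormedSpace ℝ G] {ψ : G → ℝ}
    (hψ : ContDiff ℝ ∞ ψ) (v : G) : ContDiff ℝ ∞ (fun q => fderiv ℝ ψ q v) :=
  (hψ.fderiv_right (m := ∞) (by simp)).clm_apply contDiff_const

lemma continuous_lapX {ψ : ℝ × E d → ℝ} (hψ : ContDiff ℝ ∞ ψ) : Continuous (lapX ψ) :=
  continuous_finsetSum _ fun i _ =>
    (contDiff_fderiv_apply (contDiff_fderiv_apply hψ (dirX d i)) (dirX d i)).continuous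

lemma continuous_heatAdj {ψ : ℝ × E d → ℝ} (hψ : ContDiff ℝ ∞ ψ) : Continuous (heatAdj ψ) :=
  (contDiff_fderiv_apply hψ _).continuous.add (continuous_lapX hψ)

lemma fderiv_apply_eq_zero {G : Type*} [NormedAddCommGroup G] [NormedSpace ℝ G] {ψ : G → ℝ} {p : G}
    (hp : p ∉ tsupport ψ) (v : G) : fderiv ℝ ψ p v = 0 := by
  rw [fderiv_of_notMem_tsupport (𝕜 := ℝ) hp]; rfl

lemma tsupport_fderiv_apply_subset' {G : Type*} [NormedAddCommGroup G] [NormedSpace ℝ G] (ψ : G → ℝ)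
    (v : G) : tsupport (fun q => fderiv ℝ ψ q v) ⊆ tsupport ψ :=
  tsupport_fderiv_apply_subset ℝ v

lemma lapX_eq_zero {ψ : ℝ × E d → ℝ} {p : ℝ × E d} (hp : p ∉ tsupport ψ) : lapX ψ p = 0 :=
  Finset.sum_eq_zero fun _ _ =>
    fderiv_apply_eq_zero (fun h => hp (tsupport_fderiv_apply_subset' _ _ h)) _

lemma heatAdj_eq_zero {ψ : ℝ × E d → ℝ} {p : ℝ × E d} (hp : p ∉ tsupport ψ) : heatAdj ψ p = 0 := by
  rw [heatAdj, fderiv_apply_eq_zero hp, lapX_eq_zero hp, add_zero]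

lemma integrable_mul_of_continuousOn {G : Type*} [NormedAddCommGroup G] [MeasurableSpace G]
    [BorelSpace G] {μ : Measure G} [IsFiniteMeasureOnCompacts μ] {h g : G → ℝ} {S : Set G}
    (hS : IsCompact S) (hh : ContinuousOn h S) (hg : ContinuousOn g S) (h0 : ∀ x ∉ S, g x = 0) :
    Integrable (fun x => h x * g x) μ := by
  refine (integrableOn_iff_integrable_of_support_subset ?_).1
    ((hh.mul hg).integrableOn_compact hS (μ := μ))
  intro x hx
  by_contra hxS
  exact hx (by simp [h0 x hxS])

lemma fderiv_comp_const_sub {G : Type*} [NormedAddCommGroup G] [NormedSpace ℝ G] {ψ : G → ℝ}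
    (hψ : Differentiable ℝ ψ) (p y v : G) :
    fderiv ℝ (fun y => ψ (p - y)) y v = -fderiv ℝ ψ (p - y) v := by
  have h0 : HasFDerivAt (fun y => ψ (p - y))
      ((fderiv ℝ ψ (p - y)).comp (-ContinuousLinearMap.id ℝ G)) y :=
    HasFDerivAt.comp y hψ.differentiableAt.hasFDerivAt ((hasFDerivAt_id y).const_sub p)
  rw [h0.fderiv]
  simp

lemma lapX_comp_const_sub {ψ : ℝ × E d → ℝ} (hψ : ContDiff ℝ ∞ ψ) (p y : ℝ × E d) :
    lapX (fun y => ψ (p - y)) y = lapX ψ (p - y) := by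
  refine Finset.sum_congr rfl fun i _ => ?_
  have h1 : (fun q => fderiv ℝ (fun y => ψ (p - y)) q (dirX d i)) =
      fun q => -(fun z => fderiv ℝ ψ z (dirX d i)) (p - q) := by
    funext q
    exact fderiv_comp_const_sub (hψ.differentiable (by simp)) p q _
  rw [h1, fderiv_fun_neg, _root_.neg_apply, fderiv_comp_const_sub
    ((contDiff_fderiv_apply hψ _).differentiable (by simp)), neg_neg]

lemma lapX_smoothConv {ψ N : ℝ × E d → ℝ} (hψ : ContDiff ℝ ∞ ψ) (hs : HasCompactSupport ψ)
    (hN : LocallyIntegrable N) (p : ℝ × E d) :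
    lapX (smoothConv ψ N) p = ∫ y, lapX ψ (p - y) * N y := by
  have h1 : ∀ i, fderiv ℝ (fun q => fderiv ℝ (smoothConv ψ N) q (dirX d i)) p (dirX d i) =
      ∫ y, fderiv ℝ (fun z => fderiv ℝ ψ z (dirX d i)) (p - y) (dirX d i) * N y := by
    intro i
    have e : (fun q => fderiv ℝ (smoothConv ψ N) q (dirX d i)) =
        smoothConv (fun z => fderiv ℝ ψ z (dirX d i)) N :=
      funext fun q => fderiv_smoothConv hψ hs hN q _
    rw [e, fderiv_smoothConv (contDiff_fderiv_apply hψ _) (hs.fderiv_apply (𝕜 := ℝ) _) hN]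
    rfl
  unfold lapX
  simp_rw [h1, Finset.sum_mul]
  rw [integral_finsetSum]
  intro i _
  exact integrable_smoothConv
    (contDiff_fderiv_apply (contDiff_fderiv_apply hψ _) _).continuous
    ((hs.fderiv_apply (𝕜 := ℝ) _).fderiv_apply (𝕜 := ℝ) _) hN p

/-- A mollified distributional solution solves the equation. -/
lemma heat_smoothConv {Ω K : Set (ℝ × E d)} {n f : ℝ × E d → ℝ} (hK : IsCompact K) (hKΩ : K ⊆ Ω)
    (hn : IntegrableOn n K)
    (heq : ∀ ψ : ℝ × E d → ℝ, ContDiff ℝ ∞ ψ → HasCompactSupport ψ → tsupport ψ ⊆ Ω →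
      ∫ p, n p * heatAdj ψ p = -∫ p, f p * ψ p) {ψ : ℝ × E d → ℝ} (hψ : ContDiff ℝ ∞ ψ)
    (hs : HasCompactSupport ψ) (p : ℝ × E d) (hp : ∀ y, p - y ∈ tsupport ψ → y ∈ K) :
    fderiv ℝ (smoothConv ψ (K.indicator n)) p (dirT d) - lapX (smoothConv ψ (K.indicator n)) p =
      smoothConv ψ (K.indicator f) p := by
  have hN : LocallyIntegrable (K.indicator n) :=
    ((integrable_indicator_iff hK.measurableSet).2 hn).locallyIntegrable
  -- The equation is tested with the reflected mollifier centred at `p`. It lives in `K`, so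
  -- truncating `n` and `f` to `K` is invisible at `p`.
  have hts : tsupport (fun y => ψ (p - y)) ⊆ K := fun y hy =>
    hp y (tsupport_comp_subset_preimage (f := fun y => p - y) ψ (by fun_prop) hy)
  have hs' : HasCompactSupport (fun y => ψ (p - y)) := hs.comp_homeomorph (Homeomorph.subLeft p)
  have hψ' : ContDiff ℝ ∞ (fun y => ψ (p - y)) := hψ.comp (contDiff_const.sub contDiff_id)
  have h := heq _ hψ' hs' (hts.trans hKΩ)
  rw [fderiv_smoothConv hψ hs hN, lapX_smoothConv hψ hs hN]
  unfold smoothConv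
  rw [← integral_sub]
  · have e1 : ∫ y, ψ (p - y) • K.indicator f y = ∫ y, f y * ψ (p - y) := by
      refine integral_congr_ae (ae_of_all _ fun y => ?_)
      by_cases hy : y ∈ K
      · simp [hy, mul_comm]
      · have : ψ (p - y) = 0 := by
          by_contra h0; exact hy (hts (subset_tsupport _ h0))
        simp [this]
    rw [e1, ← neg_inj, ← h, ← integral_neg]
    refine integral_congr_ae (ae_of_all _ fun y => ?_)
    simp only [heatAdj, smul_eq_mul]
    -- Reflection flips the time derivative but not the Laplacian, which turns the adjoint operator
    -- `∂ₜ + Δ` into `-(∂ₜ - Δ)`.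
    rw [lapX_comp_const_sub hψ, fderiv_comp_const_sub (hψ.differentiable (by simp))]
    by_cases hy : y ∈ K
    · rw [indicator_of_mem hy]; ring
    · have h1 : fderiv ℝ ψ (p - y) (dirT d) = 0 :=
        fderiv_apply_eq_zero (fun h => hy (hp y h)) _
      have h2 : lapX ψ (p - y) = 0 := lapX_eq_zero (fun h => hy (hp y h))
      rw [h1, h2]; simp
  · exact integrable_smoothConv (contDiff_fderiv_apply hψ _).continuous
      (hs.fderiv_apply (𝕜 := ℝ) _) hN p
  · refine integrable_smoothConv (continuous_lapX hψ) ?_ hN p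
    exact hs.of_isClosed_subset (isClosed_tsupport _) (closure_minimal (fun x hx => by
      by_contra h0; exact hx (lapX_eq_zero h0)) (isClosed_tsupport _))

/-- Kato's inequality for smooth functions. -/
lemma kato_smooth {Ω : Set (ℝ × E d)} {m g : ℝ × E d → ℝ} (hm : ContDiff ℝ ∞ m)
    {β β' β'' : ℝ → ℝ} (hβ : ∀ s, HasDerivAt β (β' s) s) (hβ' : ∀ s, HasDerivAt β' (β'' s) s)
    (hβc : Continuous β'') (hβ0 : ∀ s, 0 ≤ β'' s) {U U' : ℝ → ℝ}
    (hU : ∀ p ∈ Ω, HasDerivAt U (U' p.1) p.1) (hU' : ContinuousOn (fun p : ℝ × E d => U' p.1) Ω)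
    {ψ : ℝ × E d → ℝ} (hψ : ContDiff ℝ ∞ ψ) (hs : HasCompactSupport ψ) (hsΩ : tsupport ψ ⊆ Ω)
    (hψ0 : ∀ p, 0 ≤ ψ p)
    (hg : ∀ p ∈ tsupport ψ, fderiv ℝ m p (dirT d) - lapX m p = g p) :
    ∫ p, β' (m p - U p.1) * ((U' p.1 - g p) * ψ p) ≤ ∫ p, β (m p - U p.1) * heatAdj ψ p := by
  set S := tsupport ψ with hS
  have hSc : IsCompact S := hs
  set v : ℝ × E d → ℝ := fun p => m p - U p.1 with hv
  have hvd : ∀ p ∈ S, HasFDerivAt v (fderiv ℝ m p - U' p.1 • ContinuousLinearMap.fst ℝ ℝ (E d)) p :=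
    fun p hp => (hm.differentiable (by simp)).differentiableAt.hasFDerivAt.sub
      ((hU p (hsΩ hp)).comp_hasFDerivAt p hasFDerivAt_fst)
  have hvc : ContinuousOn v S := fun p hp => (hvd p hp).continuousAt.continuousWithinAt
  have hU'c : ContinuousOn (fun p : ℝ × E d => U' p.1) S := hU'.mono hsΩ
  have hβcont : Continuous β := continuous_iff_continuousAt.2 fun s => (hβ s).continuousAt
  have hβ'cont : Continuous β' := continuous_iff_continuousAt.2 fun s => (hβ' s).continuousAt
  have c0 : ContinuousOn (fun p => β (v p)) S := hβcont.comp_continuousOn hvc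
  have c1 : ContinuousOn (fun p => β' (v p)) S := hβ'cont.comp_continuousOn hvc
  have c2 : ContinuousOn (fun p => β'' (v p)) S := hβc.comp_continuousOn hvc
  have cm : ∀ w, Continuous (fun p => fderiv ℝ m p w) := fun w =>
    (contDiff_fderiv_apply hm w).continuous
  have cmm : ∀ w, Continuous (fun p => fderiv ℝ (fun q => fderiv ℝ m q w) p w) := fun w =>
    (contDiff_fderiv_apply (contDiff_fderiv_apply hm w) w).continuous
  have cψ : Continuous ψ := hψ.continuous
  have cψ1 : ∀ w, Continuous (fun p => fderiv ℝ ψ p w) := fun w =>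
    (contDiff_fderiv_apply hψ w).continuous
  have cψ2 : ∀ w, Continuous (fun p => fderiv ℝ (fun q => fderiv ℝ ψ q w) p w) := fun w =>
    (contDiff_fderiv_apply (contDiff_fderiv_apply hψ w) w).continuous
  have zψ : ∀ p ∉ S, ψ p = 0 := fun p hp => image_eq_zero_of_notMem_tsupport hp
  have zψ1 : ∀ w, ∀ p ∉ S, fderiv ℝ ψ p w = 0 := fun w p hp => fderiv_apply_eq_zero hp w
  have zψ2 : ∀ w, ∀ p ∉ S, fderiv ℝ (fun q => fderiv ℝ ψ q w) p w = 0 := fun w p hp =>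
    fderiv_apply_eq_zero (fun h => hp (tsupport_fderiv_apply_subset' _ _ h)) w
  have lβ : ∀ p ∈ S, ∀ w, HasLineDerivAt ℝ (fun p => β (v p))
      (β' (v p) * (fderiv ℝ m p w - U' p.1 * w.1)) p w := fun p hp w => by
    have := HasFDerivAt.hasLineDerivAt (f := fun p => β (v p))
      ((hβ (v p)).comp_hasFDerivAt p (hvd p hp)) w
    exact HasDerivAt.congr_deriv this (by simp)
  have dT : ∫ p, β (v p) * fderiv ℝ ψ p (dirT d) =
      -∫ p, β' (v p) * (fderiv ℝ m p (dirT d) - U' p.1) * ψ p := by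
    refine integral_bilinear_hasLineDerivAt_right_eq_neg_left_of_integrable
      (B := ContinuousLinearMap.mul ℝ ℝ) (v := dirT d) (f := fun p => β (v p))
      (f' := fun p => β' (v p) * (fderiv ℝ m p (dirT d) - U' p.1)) (g := ψ)
      (g' := fun p => fderiv ℝ ψ p (dirT d)) ?_ ?_ ?_ ?_ ?_
    · exact integrable_mul_of_continuousOn hSc
        (c1.mul ((cm _).continuousOn.sub hU'c)) cψ.continuousOn zψ
    · exact integrable_mul_of_continuousOn hSc c0 (cψ1 _).continuousOn (zψ1 _)
    · exact integrable_mul_of_continuousOn hSc c0 cψ.continuousOn zψ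
    · intro p hp
      simpa [dirT] using lβ p hp (dirT d)
    · exact fun p _ => ((hψ.differentiable (by simp)).differentiableAt).hasFDerivAt.hasLineDerivAt _
  have dX1 : ∀ i, ∫ p, β (v p) * fderiv ℝ (fun q => fderiv ℝ ψ q (dirX d i)) p (dirX d i) =
      -∫ p, β' (v p) * fderiv ℝ m p (dirX d i) * fderiv ℝ ψ p (dirX d i) := by
    intro i
    refine integral_bilinear_hasLineDerivAt_right_eq_neg_left_of_integrable
      (B := ContinuousLinearMap.mul ℝ ℝ) (v := dirX d i) (f := fun p => β (v p))
      (f' := fun p => β' (v p) * fderiv ℝ m p (dirX d i))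
      (g := fun p => fderiv ℝ ψ p (dirX d i))
      (g' := fun p => fderiv ℝ (fun q => fderiv ℝ ψ q (dirX d i)) p (dirX d i)) ?_ ?_ ?_ ?_ ?_
    · exact integrable_mul_of_continuousOn hSc
        (c1.mul (cm _).continuousOn) (cψ1 _).continuousOn (zψ1 _)
    · exact integrable_mul_of_continuousOn hSc c0 (cψ2 _).continuousOn (zψ2 _)
    · exact integrable_mul_of_continuousOn hSc c0 (cψ1 _).continuousOn (zψ1 _)
    · intro p hp
      simpa [dirX] using lβ p (tsupport_fderiv_apply_subset' _ _ hp) (dirX d i)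
    · exact fun p _ => (((contDiff_fderiv_apply hψ _).differentiable
        (by simp)).differentiableAt).hasFDerivAt.hasLineDerivAt _
  -- The second integration by parts creates the term `β''(v) (∂ᵢ m)²`. The barrier depends on time
  -- only, so it does not contribute to spatial derivatives.
  have dX2 : ∀ i, ∫ p, β' (v p) * fderiv ℝ m p (dirX d i) * fderiv ℝ ψ p (dirX d i) =
      -∫ p, (β'' (v p) * fderiv ℝ m p (dirX d i) ^ 2 + β' (v p) *
        fderiv ℝ (fun q => fderiv ℝ m q (dirX d i)) p (dirX d i)) * ψ p := by
    intro i
    refine integral_bilinear_hasLineDerivAt_right_eq_neg_left_of_integrable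
      (B := ContinuousLinearMap.mul ℝ ℝ) (v := dirX d i)
      (f := fun p => β' (v p) * fderiv ℝ m p (dirX d i))
      (f' := fun p => β'' (v p) * fderiv ℝ m p (dirX d i) ^ 2 + β' (v p) *
        fderiv ℝ (fun q => fderiv ℝ m q (dirX d i)) p (dirX d i))
      (g := ψ) (g' := fun p => fderiv ℝ ψ p (dirX d i)) ?_ ?_ ?_ ?_ ?_
    · exact integrable_mul_of_continuousOn hSc
        ((c2.mul ((cm _).pow 2).continuousOn).add (c1.mul (cmm _).continuousOn))
        cψ.continuousOn zψ
    · exact integrable_mul_of_continuousOn hSc (c1.mul (cm _).continuousOn)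
        (cψ1 _).continuousOn (zψ1 _)
    · exact integrable_mul_of_continuousOn hSc (c1.mul (cm _).continuousOn) cψ.continuousOn zψ
    · intro p hp
      have h1 := (hβ' (v p)).comp_hasFDerivAt p (hvd p hp)
      have h2 := (((contDiff_fderiv_apply hm (dirX d i)).differentiable
        (by simp)).differentiableAt (x := p)).hasFDerivAt
      have h3 : HasFDerivAt (fun p => β' (v p) * fderiv ℝ m p (dirX d i)) _ p := h1.mul h2
      have h4 := h3.hasLineDerivAt (dirX d i)
      refine HasDerivAt.congr_deriv h4 ?_
      simp [dirX]
      ring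
    · exact fun p _ => ((hψ.differentiable (by simp)).differentiableAt).hasFDerivAt.hasLineDerivAt _
  have iT : Integrable (fun p => β (v p) * fderiv ℝ ψ p (dirT d)) :=
    integrable_mul_of_continuousOn hSc c0 (cψ1 _).continuousOn (zψ1 _)
  have iX : ∀ i ∈ Finset.univ, Integrable (fun p => β (v p) *
      fderiv ℝ (fun q => fderiv ℝ ψ q (dirX d i)) p (dirX d i)) := fun i _ =>
    integrable_mul_of_continuousOn hSc c0 (cψ2 _).continuousOn (zψ2 _)
  have iT' : Integrable (fun p => β' (v p) * (fderiv ℝ m p (dirT d) - U' p.1) * ψ p) :=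
    integrable_mul_of_continuousOn hSc
        (c1.mul ((cm _).continuousOn.sub hU'c)) cψ.continuousOn zψ
  have iX' : ∀ i ∈ Finset.univ, Integrable (fun p => (β'' (v p) * fderiv ℝ m p (dirX d i) ^ 2 +
      β' (v p) * fderiv ℝ (fun q => fderiv ℝ m q (dirX d i)) p (dirX d i)) * ψ p) := fun i _ =>
    integrable_mul_of_continuousOn hSc
        ((c2.mul ((cm _).pow 2).continuousOn).add (c1.mul (cmm _).continuousOn))
        cψ.continuousOn zψ
  have e1 : ∫ p, β (v p) * heatAdj ψ p =
      ∫ p, -(β' (v p) * (fderiv ℝ m p (dirT d) - U' p.1) * ψ p) +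
        ∑ i, (β'' (v p) * fderiv ℝ m p (dirX d i) ^ 2 +
      β' (v p) * fderiv ℝ (fun q => fderiv ℝ m q (dirX d i)) p (dirX d i)) * ψ p := by
    have iT'' : Integrable (fun p => -(β' (v p) * (fderiv ℝ m p (dirT d) - U' p.1) * ψ p)) :=
      iT'.neg
    simp_rw [heatAdj, lapX, mul_add, Finset.mul_sum]
    rw [integral_add iT (integrable_finsetSum _ iX), integral_finsetSum _ iX, dT,
      integral_add iT'' (integrable_finsetSum _ iX'), integral_neg,
      integral_finsetSum _ iX']
    congr 1
    refine Finset.sum_congr rfl fun i _ => ?_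
    rw [dX1, dX2, neg_neg]
  rw [e1]
  have e2 : ∀ p, β' (v p) * ((U' p.1 - g p) * ψ p) =
      β' (v p) * (U' p.1 - (fderiv ℝ m p (dirT d) - lapX m p)) * ψ p := by
    intro p
    by_cases hp : p ∈ S
    · rw [hg p hp]; ring
    · simp [zψ p hp]
  rw [integral_congr_ae (ae_of_all _ e2)]
  refine integral_mono ?_ (iT'.neg.add (integrable_finsetSum _ iX')) fun p => ?_
  · exact integrable_mul_of_continuousOn hSc (c1.mul (hU'c.sub ((cm _).continuousOn.sub
      (continuous_lapX hm).continuousOn))) cψ.continuousOn zψ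
  · simp only [lapX]
    rw [← Finset.sum_mul, Finset.sum_add_distrib, ← Finset.mul_sum, ← Finset.mul_sum]
    -- The identity becomes an inequality on discarding `β''(v)|∇m|² ψ`, which is nonnegative by
    -- convexity.
    have h1 : 0 ≤ β'' (v p) * ∑ i, fderiv ℝ m p (dirX d i) ^ 2 :=
      mul_nonneg (hβ0 _) (Finset.sum_nonneg fun i _ => sq_nonneg _)
    have h2 := mul_nonneg h1 (hψ0 p)
    linarith

/-- Kato's inequality for distributional solutions of `∂ₜ n = Δ n + f`. -/
theorem kato {Ω : Set (ℝ × E d)} (hΩ : IsOpen Ω) {n f : ℝ × E d → ℝ}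
    (hn : LocallyIntegrableOn n Ω) (hf : LocallyIntegrableOn f Ω)
    (heq : ∀ ψ : ℝ × E d → ℝ, ContDiff ℝ ∞ ψ → HasCompactSupport ψ → tsupport ψ ⊆ Ω →
      ∫ p, n p * heatAdj ψ p = -∫ p, f p * ψ p)
    {β β' β'' : ℝ → ℝ} (hβ : ∀ s, HasDerivAt β (β' s) s) (hβ' : ∀ s, HasDerivAt β' (β'' s) s)
    (hβc : Continuous β'') (hβ0 : ∀ s, 0 ≤ β'' s) {C : ℝ≥0} (hC : ∀ s, |β' s| ≤ C) {U U' : ℝ → ℝ}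
    (hU : ∀ p ∈ Ω, HasDerivAt U (U' p.1) p.1) (hU' : ContinuousOn (fun p : ℝ × E d => U' p.1) Ω)
    {ψ : ℝ × E d → ℝ} (hψ : ContDiff ℝ ∞ ψ) (hs : HasCompactSupport ψ) (hsΩ : tsupport ψ ⊆ Ω)
    (hψ0 : ∀ p, 0 ≤ ψ p) :
    ∫ p, β' (n p - U p.1) * ((U' p.1 - f p) * ψ p) ≤ ∫ p, β (n p - U p.1) * heatAdj ψ p := by
  set S := tsupport ψ with hS
  have hSc : IsCompact S := hs
  obtain ⟨K, hK, hSK, hKΩ⟩ := exists_compact_between hSc hΩ hsΩ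
  have hnK : IntegrableOn n K := hn.integrableOn_compact_subset hKΩ hK
  have hfK : IntegrableOn f K := hf.integrableOn_compact_subset hKΩ hK
  have hN : Integrable (K.indicator n) := (integrable_indicator_iff hK.measurableSet).2 hnK
  have hF : Integrable (K.indicator f) := (integrable_indicator_iff hK.measurableSet).2 hfK
  -- Once the radius of the mollifier is below `δ`, the mollified equation at points of `S` sees
  -- only values inside `K`.
  obtain ⟨δ, hδ, hδK⟩ := hSc.exists_cthickening_subset_open isOpen_interior hSK
  set m : ℕ → ℝ × E d → ℝ := fun i => smoothConv (mollifier (ℝ × E d) i) (K.indicator n) with hm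
  set g : ℕ → ℝ × E d → ℝ := fun i => smoothConv (mollifier (ℝ × E d) i) (K.indicator f) with hg
  have hβcont : Continuous β := continuous_iff_continuousAt.2 fun s => (hβ s).continuousAt
  have hβ'cont : Continuous β' := continuous_iff_continuousAt.2 fun s => (hβ' s).continuousAt
  have hmc : ∀ i, ContDiff ℝ ∞ (m i) := fun i =>
    contDiff_smoothConv (contDiff_mollifier i) (hasCompactSupport_mollifier i) hN.locallyIntegrable
  have hgc : ∀ i, Continuous (g i) := fun i =>
    (contDiff_smoothConv (contDiff_mollifier i) (hasCompactSupport_mollifier i)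
      hF.locallyIntegrable).continuous
  have hineq : ∀ᶠ i in atTop, ∫ p, β' (m i p - U p.1) * ((U' p.1 - g i p) * ψ p) ≤
      ∫ p, β (m i p - U p.1) * heatAdj ψ p := by
    filter_upwards [tendsto_bumpSeq_rOut (G := ℝ × E d) |>.eventually_lt_const hδ] with i hi
    refine kato_smooth (hmc i) hβ hβ' hβc hβ0 hU hU' hψ hs hsΩ hψ0 fun p hp => ?_
    refine heat_smoothConv hK hKΩ hnK heq (contDiff_mollifier i) (hasCompactSupport_mollifier i) p
      fun y hy => ?_
    rw [tsupport_mollifier, mem_closedBall_zero_iff, ← dist_eq_norm, dist_comm] at hy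
    exact interior_subset (hδK (Metric.mem_cthickening_of_dist_le y p δ S hp (hy.trans hi.le)))
  have hres : ∀ h : ℝ × E d → ℝ, (∀ p ∉ S, h p = 0) → ∫ p, h p = ∫ p in S, h p := fun h h0 =>
    (setIntegral_eq_integral_of_forall_compl_eq_zero h0).symm
  have zψ : ∀ p ∉ S, ψ p = 0 := fun p hp => image_eq_zero_of_notMem_tsupport hp
  have zψ' : ∀ p ∉ S, heatAdj ψ p = 0 := fun p hp => heatAdj_eq_zero hp
  have hUc : ContinuousOn (fun p : ℝ × E d => U p.1) S := fun p hp =>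
    ((hU p (hsΩ hp)).continuousAt.comp continuousAt_fst).continuousWithinAt
  have hU'c : ContinuousOn (fun p : ℝ × E d => U' p.1) S := hU'.mono hsΩ
  have hSm : MeasurableSet S := hSc.measurableSet
  have hUm : AEStronglyMeasurable (fun p : ℝ × E d => U p.1) (volume.restrict S) :=
    hUc.aestronglyMeasurable hSm
  have hlip : ∀ s t, |β s - β t| ≤ C * |s - t| := by
    intro s t
    have := Convex.norm_image_sub_le_of_norm_hasDerivWithin_le (f := β) (f' := β') (s := univ)
      (C := C) (fun x _ => (hβ x).hasDerivWithinAt) (fun x _ => hC x) convex_univ (mem_univ t)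
      (mem_univ s)
    simpa using this
  have hmn : Tendsto (fun i => eLpNorm (fun p => m i p - K.indicator n p) 1 (volume.restrict S))
      atTop (𝓝 0) := by
    have := tendsto_eLpNorm_mollify (p := 1) (by norm_num) (memLp_one_iff_integrable.2 hN)
    exact tendsto_of_tendsto_of_tendsto_of_le_of_le tendsto_const_nhds this (fun _ => zero_le)
      (fun i => eLpNorm_mono_measure _ Measure.restrict_le_self)
  have hgf : Tendsto (fun i => eLpNorm (fun p => g i p - K.indicator f p) 1 (volume.restrict S))
      atTop (𝓝 0) := by
    have := tendsto_eLpNorm_mollify (p := 1) (by norm_num) (memLp_one_iff_integrable.2 hF)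
    exact tendsto_of_tendsto_of_tendsto_of_le_of_le tendsto_const_nhds this (fun _ => zero_le)
      (fun i => eLpNorm_mono_measure _ Measure.restrict_le_self)
  have hae : ∀ᵐ p ∂(volume.restrict S), Tendsto (fun i => m i p) atTop (𝓝 (K.indicator n p)) :=
    ae_restrict_of_ae (ae_tendsto_mollify hN.locallyIntegrable)
  have hcomp : ∀ h : ℝ × E d → ℝ, AEStronglyMeasurable h (volume.restrict S) →
      ∀ γ : ℝ → ℝ, Continuous γ →
      AEStronglyMeasurable (fun p => γ (h p - U p.1)) (volume.restrict S) := fun h hh γ hγ =>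
    hγ.comp_aestronglyMeasurable (hh.sub hUm)
  obtain ⟨A, hA⟩ := hψ.continuous.bounded_above_of_compact_support hs
  have hHc : HasCompactSupport (heatAdj ψ) :=
    hs.of_isClosed_subset (isClosed_tsupport _) (closure_minimal (fun x hx => by
      by_contra h0; exact hx (heatAdj_eq_zero h0)) (isClosed_tsupport _))
  obtain ⟨A', hA'⟩ := (continuous_heatAdj hψ).bounded_above_of_compact_support hHc
  have intβ : ∀ h : ℝ × E d → ℝ, IntegrableOn h S →
      Integrable (fun p => β (h p - U p.1) * heatAdj ψ p) (volume.restrict S) := by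
    intro h hh
    have h1 : Integrable (fun p => |β 0| + C * (|h p| + |U p.1|)) (volume.restrict S) :=
      (integrableOn_const hSc.measure_lt_top.ne).add
        ((hh.norm.add (hUc.norm.integrableOn_compact hSc)).const_mul _)
    refine Integrable.mul_bdd (c := A') ?_
      (continuous_heatAdj hψ).aestronglyMeasurable (ae_of_all _ hA')
    refine h1.mono' (hcomp h hh.1 β hβcont) (ae_of_all _ fun p => ?_)
    have h3 := hlip (h p - U p.1) 0
    have h4 : |β (h p - U p.1)| ≤ |β 0| + |β (h p - U p.1) - β 0| := by
      simpa using abs_add_le (β 0) (β (h p - U p.1) - β 0)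
    have h5 : |h p - U p.1 - 0| ≤ |h p| + |U p.1| := by rw [sub_zero]; exact abs_sub _ _
    have h6 : (C : ℝ) * |h p - U p.1 - 0| ≤ C * (|h p| + |U p.1|) := by gcongr
    rw [Real.norm_eq_abs]; linarith
  have intψ : ∀ h : ℝ × E d → ℝ, IntegrableOn h S →
      Integrable (fun p => (U' p.1 - h p) * ψ p) (volume.restrict S) := fun h hh =>
    Integrable.mul_bdd (c := A) ((hU'c.integrableOn_compact hSc).sub hh)
      hψ.continuous.aestronglyMeasurable (ae_of_all _ hA)
  have L1 : Tendsto (fun i => ∫ p in S, β' (m i p - U p.1) * ((U' p.1 - g i p) * ψ p)) atTop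
      (𝓝 (∫ p in S, β' (K.indicator n p - U p.1) * ((U' p.1 - K.indicator f p) * ψ p))) := by
    refine tendsto_integral_mul_of_L1 (C := C)
      (fun i => hcomp _ (hmc i).continuous.aestronglyMeasurable β' hβ'cont)
      (fun i => ae_of_all _ fun p => hC _) ?_
      (fun i => intψ _ ((hgc i).continuousOn.integrableOn_compact hSc))
      (intψ _ hF.integrableOn) ?_
    · filter_upwards [hae] with p hp _
      exact (hβ'cont.tendsto _).comp (hp.sub_const _)
    · refine tendsto_eLpNorm_of_le_mul (C := A) (fun i => ae_of_all _ fun p => ?_) hgf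
      rw [← sub_mul, norm_mul, mul_comm, sub_sub_sub_cancel_left, norm_sub_rev]
      gcongr
      exact hA p
  -- On this side `β` is unbounded but Lipschitz, so `L¹` convergence of `m i` is enough.
  have L2 : Tendsto (fun i => ∫ p in S, β (m i p - U p.1) * heatAdj ψ p) atTop
      (𝓝 (∫ p in S, β (K.indicator n p - U p.1) * heatAdj ψ p)) := by
    have := tendsto_integral_mul_of_L1 (μ := volume.restrict S) (a := fun _ _ => 1)
      (b := fun _ => 1) (C := 1) (g := fun i p => β (m i p - U p.1) * heatAdj ψ p)
      (h := fun p => β (K.indicator n p - U p.1) * heatAdj ψ p)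
      (fun _ => aestronglyMeasurable_const) (fun _ => ae_of_all _ fun _ => by simp)
      (ae_of_all _ fun _ _ => tendsto_const_nhds)
      (fun i => intβ _ ((hmc i).continuous.continuousOn.integrableOn_compact hSc))
      (intβ _ hN.integrableOn) ?_
    · simpa using this
    · refine tendsto_eLpNorm_of_le_mul (C := A' * C) (fun i => ae_of_all _ fun p => ?_) hmn
      rw [← sub_mul, norm_mul, mul_comm, mul_assoc]
      have h1 := hlip (m i p - U p.1) (K.indicator n p - U p.1)
      rw [sub_sub_sub_cancel_right] at h1
      exact mul_le_mul (hA' p) h1 (norm_nonneg _) ((norm_nonneg _).trans (hA' p))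
  have hfin := le_of_tendsto_of_tendsto L1 L2 (hineq.mono fun i hi => by
    rwa [hres _ (fun p hp => by simp [zψ p hp]), hres _ (fun p hp => by simp [zψ' p hp])] at hi)
  rw [hres _ (fun p hp => by simp [zψ p hp]), hres _ (fun p hp => by simp [zψ' p hp])]
  have hSK' : S ⊆ K := hSK.trans interior_subset
  refine le_trans (le_of_eq ?_) (hfin.trans (le_of_eq ?_)) <;>
  · refine setIntegral_congr_fun hSm fun p hp => ?_
    simp only [indicator_of_mem (hSK' hp)]

end Kato

/-! ### Drift-diffusion systems -/

section Drift

variable {d : ℕ}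

/-- The spatial gradient. -/
noncomputable def gradX (ψ : ℝ × E d → ℝ) (p : ℝ × E d) : E d := gradient (fun y => ψ (p.1, y)) p.2

/-- A weak solution of `∂ₜ n = Δ n + ∇·(n B)`, with `∇ n = Dn` and `∇·B = D`. -/
structure DriftSystem (n : ℝ × E d → ℝ) (Dn B : ℝ × E d → E d) (D : ℝ × E d → ℝ) : Prop where
  n_L2 : ∀ a b : ℝ, 0 < a → a < b → MemLp n 2 (volume.restrict (Ioo a b ×ˢ univ))
  Dn_L2 : ∀ a b : ℝ, 0 < a → a < b → MemLp Dn 2 (volume.restrict (Ioo a b ×ˢ univ))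
  B_L2 : ∀ a b R : ℝ, 0 < a → a < b →
    MemLp B 2 (volume.restrict (Ioo a b ×ˢ Metric.ball (0 : E d) R))
  D_L2 : ∀ a b R : ℝ, 0 < a → a < b →
    MemLp D 2 (volume.restrict (Ioo a b ×ˢ Metric.ball (0 : E d) R))
  weak_grad : ∀ᵐ t ∂(volume.restrict (Ioi (0 : ℝ))),
    IsWeakGradient (fun x => n (t, x)) (fun x => Dn (t, x))
  div : ∀ᵐ t ∂(volume.restrict (Ioi (0 : ℝ))), ∀ w : E d → ℝ, ContDiff ℝ 1 w →
    HasCompactSupport w → ∫ x, inner ℝ (B (t, x)) (gradient w x) = -∫ x, D (t, x) * w x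
  eqn : ∀ ψ : ℝ × E d → ℝ, ContDiff ℝ ∞ ψ → HasCompactSupport ψ →
    tsupport ψ ⊆ Ioi (0 : ℝ) ×ˢ (univ : Set (E d)) →
    ∫ p, n p * fderiv ℝ ψ p (dirT d) = ∫ p, inner ℝ (Dn p + n p • B p) (gradX ψ p)

lemma hasFDerivAt_slice {ψ : ℝ × E d → ℝ} (hψ : Differentiable ℝ ψ) (t : ℝ) (x : E d) :
    HasFDerivAt (fun y => ψ (t, y))
      ((fderiv ℝ ψ (t, x)).comp (ContinuousLinearMap.inr ℝ ℝ (E d))) x :=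
  (hψ (t, x)).hasFDerivAt.comp x (hasFDerivAt_prodMk_right t x)

lemma gradX_eq {ψ : ℝ × E d → ℝ} (hψ : Differentiable ℝ ψ) (p : ℝ × E d) :
    gradX ψ p = (InnerProductSpace.toDual ℝ (E d)).symm
      ((fderiv ℝ ψ p).comp (ContinuousLinearMap.inr ℝ ℝ (E d))) := by
  rw [gradX, gradient, (hasFDerivAt_slice hψ p.1 p.2).fderiv]

lemma inner_gradX {ψ : ℝ × E d → ℝ} (hψ : Differentiable ℝ ψ) (p : ℝ × E d) (v : E d) :
    inner ℝ (gradX ψ p) v = fderiv ℝ ψ p (0, v) := by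
  rw [gradX_eq hψ, InnerProductSpace.toDual_symm_apply]
  simp

lemma continuous_gradX {ψ : ℝ × E d → ℝ} (hψ : ContDiff ℝ ∞ ψ) : Continuous (gradX ψ) := by
  rw [funext (gradX_eq (hψ.differentiable (by simp)))]
  have := hψ.continuous_fderiv (by simp)
  exact (LinearIsometryEquiv.continuous _).comp (this.clm_comp continuous_const)

lemma gradX_eq_zero {ψ : ℝ × E d → ℝ} (hψ : Differentiable ℝ ψ) {p : ℝ × E d}
    (hp : p ∉ tsupport ψ) : gradX ψ p = 0 := by
  rw [gradX_eq hψ, fderiv_of_notMem_tsupport (𝕜 := ℝ) hp]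
  simp

lemma inner_eq_sum (u v : E d) :
    (inner ℝ u v : ℝ) = ∑ i, inner ℝ u (EuclideanSpace.single i 1) *
      inner ℝ v (EuclideanSpace.single i 1) := by
  simp [PiLp.inner_apply, mul_comm]

lemma contDiff_slice {ψ : ℝ × E d → ℝ} (hψ : ContDiff ℝ ∞ ψ) (t : ℝ) :
    ContDiff ℝ ∞ (fun x => ψ (t, x)) := hψ.comp (contDiff_const.prodMk contDiff_id)

lemma hasCompactSupport_slice {ψ : ℝ × E d → ℝ} (hs : HasCompactSupport ψ) (t : ℝ) :
    HasCompactSupport (fun x => ψ (t, x)) :=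
  hs.comp_isClosedEmbedding (g := fun x : E d => (t, x)) (by
    exact Topology.IsClosedEmbedding.of_continuous_injective_isClosedMap (by fun_prop)
      (fun x y h => (Prod.mk.inj h).2) (isClosedMap_prodMk_left t))

/-- The weak gradient tested against a smooth vector field. -/
lemma IsWeakGradient.integral_inner_gradX {n : E d → ℝ} {Dn : E d → E d}
    (h : IsWeakGradient n Dn) {ψ : ℝ × E d → ℝ} (hψ : ContDiff ℝ ∞ ψ) (hs : HasCompactSupport ψ)
    (t : ℝ) : ∫ x, inner ℝ (Dn x) (gradX ψ (t, x)) = -∫ x, n x * lapX ψ (t, x) := by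
  have h1 : ∀ i : Fin d, ∫ x, n x * fderiv ℝ (fun q => fderiv ℝ ψ q (dirX d i)) (t, x) (dirX d i) =
      -∫ x, fderiv ℝ ψ (t, x) (dirX d i) * inner ℝ (Dn x) (EuclideanSpace.single i 1) := by
    intro i
    set θ : ℝ × E d → ℝ := fun q => fderiv ℝ ψ q (dirX d i) with hθ
    have hθc : ContDiff ℝ ∞ θ := contDiff_fderiv_apply hψ _
    have hθs : HasCompactSupport θ := hs.fderiv_apply (𝕜 := ℝ) _
    have h2 := h.2.2 _ (contDiff_slice hθc t) (hasCompactSupport_slice hθs t)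
    have h3 := congrArg (fun z => inner ℝ (EuclideanSpace.single i (1 : ℝ)) z) h2
    have i1 : Integrable (fun x => n x • gradient (fun x => θ (t, x)) x) :=
      h.1.integrable_smul_right_of_hasCompactSupport
        (continuous_gradient ((contDiff_slice hθc t).of_le (by exact_mod_cast le_top)))
        (hasCompactSupport_gradient (hasCompactSupport_slice hθs t))
    have i2 : Integrable (fun x => θ (t, x) • Dn x) :=
      h.2.1.integrable_smul_left_of_hasCompactSupport (contDiff_slice hθc t).continuous
        (hasCompactSupport_slice hθs t)
    simp only [inner_neg_right] at h3
    rw [← integral_inner i1, ← integral_inner i2] at h3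
    have e1 : ∀ x, inner ℝ (EuclideanSpace.single i (1 : ℝ)) (n x • gradient (fun x => θ (t, x)) x)
        = n x * fderiv ℝ θ (t, x) (dirX d i) := fun x => by
      rw [real_inner_smul_right, real_inner_comm]
      have := inner_gradX (hθc.differentiable (by simp)) (t, x) (EuclideanSpace.single i 1)
      rw [gradX] at this
      rw [this]; rfl
    have e2 : ∀ x, inner ℝ (EuclideanSpace.single i (1 : ℝ)) (θ (t, x) • Dn x)
        = θ (t, x) * inner ℝ (Dn x) (EuclideanSpace.single i 1) := fun x => by
      rw [real_inner_smul_right, real_inner_comm]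
    simp_rw [e1, e2] at h3
    exact h3
  have e : ∀ x, (inner ℝ (Dn x) (gradX ψ (t, x)) : ℝ) =
      ∑ i, fderiv ℝ ψ (t, x) (dirX d i) * inner ℝ (Dn x) (EuclideanSpace.single i 1) := fun x => by
    rw [inner_eq_sum]
    refine Finset.sum_congr rfl fun i _ => ?_
    rw [inner_gradX (hψ.differentiable (by simp)), mul_comm]; rfl
  simp_rw [e, lapX, Finset.mul_sum]
  rw [integral_finsetSum, integral_finsetSum, ← Finset.sum_neg_distrib]
  · refine Finset.sum_congr rfl fun i _ => ?_
    rw [h1, neg_neg]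
  · intro i _
    have hθc : ContDiff ℝ ∞ (fun q => fderiv ℝ (fun q => fderiv ℝ ψ q (dirX d i)) q (dirX d i)) :=
      contDiff_fderiv_apply (contDiff_fderiv_apply hψ _) _
    have hθs : HasCompactSupport
        (fun q => fderiv ℝ (fun q => fderiv ℝ ψ q (dirX d i)) q (dirX d i)) :=
      (hs.fderiv_apply (𝕜 := ℝ) _).fderiv_apply (𝕜 := ℝ) _
    exact h.1.integrable_smul_right_of_hasCompactSupport (contDiff_slice hθc t).continuous
      (hasCompactSupport_slice hθs t)
  · intro i _
    have hθc := contDiff_fderiv_apply hψ (dirX d i)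
    have hθs : HasCompactSupport (fun q => fderiv ℝ ψ q (dirX d i)) := hs.fderiv_apply (𝕜 := ℝ) _
    have i2 := (h.2.1.integrable_smul_left_of_hasCompactSupport (contDiff_slice hθc t).continuous
        (hasCompactSupport_slice hθs t)).inner_const (𝕜 := ℝ) (EuclideanSpace.single i 1)
    simp_rw [real_inner_smul_left] at i2
    exact i2

/-- Compact sets of positive times stay away from `t = 0`, which is where the square integrability
assumptions on slabs may fail. -/
lemma exists_box {S : Set (ℝ × E d)} (hS : IsCompact S)
    (hsub : S ⊆ Ioi (0 : ℝ) ×ˢ (univ : Set (E d))) :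
    ∃ a b R : ℝ, 0 < a ∧ a < b ∧ S ⊆ Ioo a b ×ˢ Metric.ball (0 : E d) R := by
  obtain ⟨ρ, hρ⟩ := hS.isBounded.subset_ball (0 : ℝ × E d)
  have hK : IsClosed (Prod.fst '' S) := (hS.image continuous_fst).isClosed
  have h0 : (0 : ℝ) ∉ Prod.fst '' S := by
    rintro ⟨p, hp, hp0⟩
    have := (hsub hp).1
    rw [hp0] at this
    exact lt_irrefl (0 : ℝ) this
  obtain ⟨ε, hε, hεK⟩ := Metric.isOpen_iff.1 hK.isOpen_compl 0 h0
  -- Using `|ρ| + ε` keeps the interval nondegenerate even when `ρ ≤ 0`, as can happen for empty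
  -- `S`.
  refine ⟨ε / 2, |ρ| + ε, ρ, by positivity, by have := abs_nonneg ρ; linarith, fun p hp => ?_⟩
  have hp0 : 0 < p.1 := (hsub hp).1
  have hpρ := hρ hp
  rw [mem_ball_zero_iff, Prod.norm_def, max_lt_iff] at hpρ
  refine ⟨⟨?_, ?_⟩, by simpa using hpρ.2⟩
  · by_contra h
    have h2 : p.1 ∈ Metric.ball (0 : ℝ) ε := by
      rw [mem_ball_zero_iff, Real.norm_of_nonneg hp0.le]
      linarith
    exact hεK h2 ⟨p, hp, rfl⟩
  · have h1 := hpρ.1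
    rw [Real.norm_of_nonneg hp0.le] at h1
    have := le_abs_self ρ
    linarith

/-- Fubini for `‖f‖²` on a countable family of slabs exhausting the positive times. -/
lemma ae_slice_memLp {V : Type*} [NormedAddCommGroup V] {f : ℝ × E d → V} {S : Set (E d)}
    (h : ∀ a b : ℝ, 0 < a → a < b → MemLp f 2 (volume.restrict (Ioo a b ×ˢ S))) :
    ∀ᵐ t ∂(volume.restrict (Ioi (0 : ℝ))), MemLp (fun x => f (t, x)) 2 (volume.restrict S) := by
  -- With `k + 2` in the left endpoint the interval is already nondegenerate for `k = 0`.
  have hU : Ioi (0 : ℝ) = ⋃ k : ℕ, Ioo (1 / ((k : ℝ) + 2)) ((k : ℝ) + 1) := by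
    ext t
    simp only [mem_Ioi, mem_iUnion, mem_Ioo]
    constructor
    · intro ht
      obtain ⟨k, hk⟩ := exists_nat_gt (max t (1 / t))
      refine ⟨k, ?_, (lt_of_le_of_lt (le_max_left _ _) hk).trans (by linarith)⟩
      have h1 : 1 / t < k := lt_of_le_of_lt (le_max_right _ _) hk
      rw [div_lt_iff₀ ht] at h1
      rw [div_lt_iff₀ (by positivity)]
      nlinarith
    · rintro ⟨k, hk, -⟩
      exact lt_trans (by positivity) hk
  rw [hU, ae_restrict_iUnion_iff]
  intro k
  have hlt : 1 / ((k : ℝ) + 2) < (k : ℝ) + 1 := by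
    rw [div_lt_iff₀ (by positivity)]
    have : (0 : ℝ) ≤ k := k.cast_nonneg
    nlinarith
  have hk := h _ _ (by positivity) hlt
  rw [Measure.volume_eq_prod, ← Measure.prod_restrict] at hk
  have h1 : Integrable (fun p => ‖f p‖ ^ 2)
      ((volume.restrict (Ioo (1 / ((k : ℝ) + 2)) ((k : ℝ) + 1))).prod (volume.restrict S)) :=
    (memLp_two_iff_integrable_sq_norm hk.1).1 hk
  filter_upwards [h1.prod_right_ae, hk.1.prodMk_left] with t ht1 ht2
  exact (memLp_two_iff_integrable_sq_norm ht2).2 ht1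

lemma ae_slice_memLp_ball {V : Type*} [NormedAddCommGroup V] {f : ℝ × E d → V}
    (h : ∀ a b R : ℝ, 0 < a → a < b →
      MemLp f 2 (volume.restrict (Ioo a b ×ˢ Metric.ball (0 : E d) R))) :
    ∀ᵐ t ∂(volume.restrict (Ioi (0 : ℝ))), ∀ R : ℝ,
      MemLp (fun x => f (t, x)) 2 (volume.restrict (Metric.ball 0 R)) := by
  have h1 : ∀ᵐ t ∂(volume.restrict (Ioi (0 : ℝ))), ∀ k : ℕ,
      MemLp (fun x => f (t, x)) 2 (volume.restrict (Metric.ball 0 (k : ℝ))) :=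
    ae_all_iff.2 fun k => ae_slice_memLp fun a b => h a b k
  filter_upwards [h1] with t ht R
  obtain ⟨k, hk⟩ := exists_nat_gt R
  exact (ht k).mono_measure (Measure.restrict_mono (Metric.ball_subset_ball hk.le) le_rfl)

end Drift

/-! ### Kato's inequality in the presence of a drift -/

section DriftKato

variable {d : ℕ} {n : ℝ × E d → ℝ} {Dn B : ℝ × E d → E d} {D : ℝ × E d → ℝ}

lemma integrable_inner_of_integrableOn {V : Type*} [NormedAddCommGroup V] [InnerProductSpace ℝ V]
    {F Z : ℝ × E d → V} {Q : Set (ℝ × E d)} (hF : IntegrableOn F Q) (hZ : Continuous Z)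
    (hs : HasCompactSupport Z) (h0 : ∀ p ∉ Q, Z p = 0) :
    Integrable (fun p => (inner ℝ (F p) (Z p) : ℝ)) := by
  obtain ⟨C, hC⟩ := hZ.bounded_above_of_compact_support hs
  have h1 : IntegrableOn (fun p => (inner ℝ (F p) (Z p) : ℝ)) Q := by
    refine (hF.norm.mul_const C).mono' (hF.1.inner hZ.aestronglyMeasurable)
      (ae_of_all _ fun p => (norm_inner_le_norm _ _).trans ?_)
    gcongr
    exact hC p
  refine (integrableOn_iff_integrable_of_support_subset ?_).1 h1
  intro p hp
  by_contra hpQ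
  exact hp (by simp [h0 p hpQ])

lemma integrable_mul_of_integrableOn {F Z : ℝ × E d → ℝ} {Q : Set (ℝ × E d)}
    (hF : IntegrableOn F Q) (hZ : Continuous Z)
    (hs : HasCompactSupport Z) (h0 : ∀ p ∉ Q, Z p = 0) :
    Integrable (fun p => F p * Z p) := by
  have := integrable_inner_of_integrableOn hF hZ hs h0
  simpa [mul_comm] using this

lemma hasCompactSupport_of_subset {V W : Type*} [Zero V] [Zero W] {ψ : ℝ × E d → V}
    {Z : ℝ × E d → W} (hs : HasCompactSupport ψ) (h : ∀ p ∉ tsupport ψ, Z p = 0) :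
    HasCompactSupport Z :=
  hs.of_isClosed_subset (isClosed_tsupport _) (closure_minimal (fun x hx => by
      by_contra h0; exact hx (h x h0)) (isClosed_tsupport _))

/-- Product rules and weak gradients are available only on almost every time slice; Fubini lifts
them to space-time. -/
lemma integral_eq_of_ae_slices {g₁ g₂ : ℝ × E d → ℝ} (h₁ : Integrable g₁) (h₂ : Integrable g₂)
    (h : ∀ᵐ t ∂(volume.restrict (Ioi (0 : ℝ))), ∫ x, g₁ (t, x) = ∫ x, g₂ (t, x))
    (h₁0 : ∀ p : ℝ × E d, p.1 ≤ 0 → g₁ p = 0) (h₂0 : ∀ p : ℝ × E d, p.1 ≤ 0 → g₂ p = 0) :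
    ∫ p, g₁ p = ∫ p, g₂ p := by
  rw [Measure.volume_eq_prod] at h₁ h₂ ⊢
  rw [integral_prod _ h₁, integral_prod _ h₂]
  refine integral_congr_ae ?_
  filter_upwards [(ae_restrict_iff' measurableSet_Ioi).1 h] with t ht
  by_cases h0 : 0 < t
  · exact ht h0
  · simp [h₁0 (t, _) (not_lt.1 h0), h₂0 (t, _) (not_lt.1 h0)]

lemma DriftSystem.ae_product_rule (H : DriftSystem n Dn B D) {β β' : ℝ → ℝ}
    (hβ : ∀ s, HasDerivAt β (β' s) s) (hβc : Continuous β') {C : ℝ≥0} (hC : ∀ s, |β' s| ≤ C)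
    (U : ℝ → ℝ) {ψ : ℝ × E d → ℝ} (hψ : ContDiff ℝ ∞ ψ) (hs : HasCompactSupport ψ) :
    ∀ᵐ t ∂(volume.restrict (Ioi (0 : ℝ))),
      ∫ x, β' (n (t, x) - U t) * (inner ℝ (Dn (t, x)) (B (t, x)) * ψ (t, x)) =
        -∫ x, β (n (t, x) - U t) *
          (D (t, x) * ψ (t, x) + inner ℝ (B (t, x)) (gradX ψ (t, x))) := by
  filter_upwards [ae_slice_memLp H.n_L2, ae_slice_memLp H.Dn_L2, ae_slice_memLp_ball H.B_L2,
    ae_slice_memLp_ball H.D_L2, H.weak_grad, H.div] with t h1 h2 h3 h4 h5 h6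
  rw [Measure.restrict_univ] at h1 h2
  exact integral_product_rule hβ hβc hC (U t) h1 h2 h5 h3 h4 h6
    ((contDiff_slice hψ t).of_le (by exact_mod_cast le_top)) (hasCompactSupport_slice hs t)

lemma DriftSystem.box (H : DriftSystem n Dn B D) {a b R : ℝ} (ha : 0 < a) (hab : a < b) :
    MemLp n 2 (volume.restrict (Ioo a b ×ˢ Metric.ball (0 : E d) R)) ∧
    MemLp Dn 2 (volume.restrict (Ioo a b ×ˢ Metric.ball (0 : E d) R)) ∧
    IsFiniteMeasure (volume.restrict (Ioo a b ×ˢ Metric.ball (0 : E d) R)) := by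
  have hsub : Ioo a b ×ˢ Metric.ball (0 : E d) R ⊆ Ioo a b ×ˢ univ :=
    prod_mono_right (subset_univ _)
  refine ⟨(H.n_L2 a b ha hab).mono_measure (Measure.restrict_mono hsub le_rfl),
    (H.Dn_L2 a b ha hab).mono_measure (Measure.restrict_mono hsub le_rfl), ⟨?_⟩⟩
  rw [Measure.restrict_apply_univ, Measure.volume_eq_prod, Measure.prod_prod]
  exact ENNReal.mul_lt_top (by simp) measure_ball_lt_top

/-- The drift in non-divergence form. -/
lemma DriftSystem.heat_eq (H : DriftSystem n Dn B D) {ψ : ℝ × E d → ℝ} (hψ : ContDiff ℝ ∞ ψ)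
    (hs : HasCompactSupport ψ) (hsΩ : tsupport ψ ⊆ Ioi (0 : ℝ) ×ˢ (univ : Set (E d))) :
    ∫ p, n p * heatAdj ψ p = -∫ p, (inner ℝ (Dn p) (B p) + n p * D p) * ψ p := by
  obtain ⟨a, b, R, ha, hab, hbox⟩ := exists_box hs hsΩ
  obtain ⟨b1, b2, b3⟩ := H.box (R := R) ha hab
  have b4 := H.B_L2 a b R ha hab
  have b5 := H.D_L2 a b R ha hab
  have hd := hψ.differentiable (by simp)
  have zψ : ∀ p ∉ Ioo a b ×ˢ Metric.ball (0 : E d) R, ψ p = 0 := fun p hp =>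
    image_eq_zero_of_notMem_tsupport fun h => hp (hbox h)
  have zg : ∀ p ∉ Ioo a b ×ˢ Metric.ball (0 : E d) R, gradX ψ p = 0 := fun p hp =>
    gradX_eq_zero hd fun h => hp (hbox h)
  have zl : ∀ p ∉ Ioo a b ×ˢ Metric.ball (0 : E d) R, lapX ψ p = 0 := fun p hp =>
    lapX_eq_zero fun h => hp (hbox h)
  have zt : ∀ p ∉ Ioo a b ×ˢ Metric.ball (0 : E d) R, fderiv ℝ ψ p (dirT d) = 0 := fun p hp =>
    fderiv_apply_eq_zero (fun h => hp (hbox h)) _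
  have zneg : ∀ p : ℝ × E d, p.1 ≤ 0 → p ∉ Ioo a b ×ˢ Metric.ball (0 : E d) R := fun p hp h => by
    have := h.1.1; linarith
  have sg : HasCompactSupport (gradX ψ) := hasCompactSupport_of_subset hs fun p =>
    gradX_eq_zero hd
  have sl : HasCompactSupport (lapX ψ) := hasCompactSupport_of_subset hs fun p => lapX_eq_zero
  have int_n : IntegrableOn n (Ioo a b ×ˢ Metric.ball (0 : E d) R) :=
    b1.integrable (by norm_num)
  have int_Dn : IntegrableOn Dn (Ioo a b ×ˢ Metric.ball (0 : E d) R) :=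
    b2.integrable (by norm_num)
  have int_nB : IntegrableOn (fun p => n p • B p) (Ioo a b ×ˢ Metric.ball (0 : E d) R) :=
    memLp_one_iff_integrable.1 (b4.smul b1)
  have int_nD : IntegrableOn (fun p => n p * D p) (Ioo a b ×ˢ Metric.ball (0 : E d) R) :=
    b1.integrable_mul b5
  have int_DB : IntegrableOn (fun p => (inner ℝ (Dn p) (B p) : ℝ))
    (Ioo a b ×ˢ Metric.ball (0 : E d) R) := integrable_inner_of_memLp b2 b4
  have j1 := integrable_inner_of_integrableOn int_Dn (continuous_gradX hψ) sg zg
  have j2 := integrable_mul_of_integrableOn int_n (continuous_lapX hψ) sl zl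
  have j3 := integrable_inner_of_integrableOn int_nB (continuous_gradX hψ) sg zg
  have j4 := integrable_mul_of_integrableOn int_DB hψ.continuous hs zψ
  have j5 := integrable_mul_of_integrableOn int_nD hψ.continuous hs zψ
  have j6 := integrable_mul_of_integrableOn int_n (contDiff_fderiv_apply hψ (dirT d)).continuous
    (hs.fderiv_apply (𝕜 := ℝ) _) zt
  have e1 : ∫ p, inner ℝ (Dn p) (gradX ψ p) = ∫ p, -(n p * lapX ψ p) := by
    refine integral_eq_of_ae_slices j1 j2.neg ?_ (fun p hp => by simp [zg p (zneg p hp)])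
      (fun p hp => by simp [zl p (zneg p hp)])
    filter_upwards [H.weak_grad] with t ht
    rw [integral_neg]
    exact ht.integral_inner_gradX hψ hs t
  have j7 : Integrable (fun p => n p * D p * ψ p + inner ℝ (n p • B p) (gradX ψ p)) := j5.add j3
  -- The product rule with `β = id` and `u = 0` on each slice: it trades the flux `n B·∇ψ` for the
  -- source `(Dn·B + n D)ψ`.
  have e2 : ∫ p, inner ℝ (Dn p) (B p) * ψ p =
      ∫ p, -(n p * D p * ψ p + inner ℝ (n p • B p) (gradX ψ p)) := by
    refine integral_eq_of_ae_slices j4 j7.neg ?_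
      (fun p hp => by simp [zψ p (zneg p hp)])
      (fun p hp => by simp [zg p (zneg p hp), zψ p (zneg p hp)])
    filter_upwards [H.ae_product_rule (β := fun s => s) (β' := fun _ => 1) (C := 1)
      (fun s => hasDerivAt_id s) continuous_const (by simp) (fun _ => 0) hψ hs] with t ht
    simp only [one_mul, sub_zero] at ht
    rw [ht, integral_neg]
    congr 1
    refine integral_congr_ae (ae_of_all _ fun x => ?_)
    simp only [real_inner_smul_left]
    ring
  have e3 := H.eqn ψ hψ hs hsΩ
  simp_rw [inner_add_left] at e3
  rw [integral_add j1 j3, e1] at e3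
  rw [integral_neg] at e2 e3
  rw [integral_add j5 j3] at e2
  simp_rw [heatAdj, mul_add, add_mul]
  rw [integral_add j6 j2, integral_add j4 j5]
  linarith

/-- Kato's inequality for drift-diffusion systems. -/
theorem DriftSystem.kato (H : DriftSystem n Dn B D)
    {β β' β'' : ℝ → ℝ} (hβ : ∀ s, HasDerivAt β (β' s) s) (hβ' : ∀ s, HasDerivAt β' (β'' s) s)
    (hβc : Continuous β'') (hβ0 : ∀ s, 0 ≤ β'' s) {C : ℝ≥0} (hC : ∀ s, |β' s| ≤ C) {U U' : ℝ → ℝ}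
    (hU : ∀ t, 0 < t → HasDerivAt U (U' t) t) (hU' : ContinuousOn U' (Ioi 0))
    (hsign : ∀ᵐ p ∂(volume.restrict (Ioi (0 : ℝ) ×ˢ (univ : Set (E d)))),
      0 ≤ β' (n p - U p.1) * (U' p.1 - n p * D p) + β (n p - U p.1) * D p)
    {ψ : ℝ × E d → ℝ} (hψ : ContDiff ℝ ∞ ψ) (hs : HasCompactSupport ψ)
    (hsΩ : tsupport ψ ⊆ Ioi (0 : ℝ) ×ˢ (univ : Set (E d))) (hψ0 : ∀ p, 0 ≤ ψ p) :
    0 ≤ ∫ p, β (n p - U p.1) * (heatAdj ψ p - inner ℝ (B p) (gradX ψ p)) := by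
  have hΩ : IsOpen (Ioi (0 : ℝ) ×ˢ (univ : Set (E d))) := isOpen_Ioi.prod isOpen_univ
  have hloc : ∀ F : ℝ × E d → ℝ, (∀ a b R : ℝ, 0 < a → a < b →
      IntegrableOn F (Ioo a b ×ˢ Metric.ball (0 : E d) R)) →
      LocallyIntegrableOn F (Ioi (0 : ℝ) ×ˢ (univ : Set (E d))) := by
    intro F hF
    refine (locallyIntegrableOn_iff hΩ.isLocallyClosed).2 fun k hk hkc => ?_
    obtain ⟨a, b, R, ha, hab, hbox⟩ := exists_box hkc hk
    exact (hF a b R ha hab).mono_set hbox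
  have hnloc : LocallyIntegrableOn n (Ioi (0 : ℝ) ×ˢ (univ : Set (E d))) := by
    refine hloc n fun a b R ha hab => ?_
    obtain ⟨b1, b2, b3⟩ := H.box (R := R) ha hab
    exact b1.integrable (by norm_num)
  have hfloc : LocallyIntegrableOn (fun p => inner ℝ (Dn p) (B p) + n p * D p)
      (Ioi (0 : ℝ) ×ˢ (univ : Set (E d))) := by
    refine hloc _ fun a b R ha hab => ?_
    obtain ⟨b1, b2, b3⟩ := H.box (R := R) ha hab
    exact (integrable_inner_of_memLp b2 (H.B_L2 a b R ha hab)).add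
      (b1.integrable_mul (H.D_L2 a b R ha hab))
  have hkato := NernstPlanck.kato hΩ hnloc hfloc (fun ψ h1 h2 h3 => H.heat_eq h1 h2 h3) hβ hβ' hβc
    hβ0 hC (U := U) (U' := U') (fun p hp => hU _ hp.1)
    (hU'.comp continuous_fst.continuousOn fun p hp => hp.1) hψ hs hsΩ hψ0
  obtain ⟨a, b, R, ha, hab, hbox⟩ := exists_box hs hsΩ
  obtain ⟨b1, b2, b3⟩ := H.box (R := R) ha hab
  have b4 := H.B_L2 a b R ha hab
  have b5 := H.D_L2 a b R ha hab
  set Q := Ioo a b ×ˢ Metric.ball (0 : E d) R with hQ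
  have hQm : MeasurableSet Q := measurableSet_Ioo.prod measurableSet_ball
  have hQΩ : Q ⊆ Ioi (0 : ℝ) ×ˢ (univ : Set (E d)) := fun p hp => ⟨ha.trans hp.1.1, trivial⟩
  have hd := hψ.differentiable (by simp)
  have zψ : ∀ p ∉ Q, ψ p = 0 := fun p hp =>
    image_eq_zero_of_notMem_tsupport fun h => hp (hbox h)
  have zg : ∀ p ∉ Q, gradX ψ p = 0 := fun p hp => gradX_eq_zero hd fun h => hp (hbox h)
  have zh : ∀ p ∉ Q, heatAdj ψ p = 0 := fun p hp => heatAdj_eq_zero fun h => hp (hbox h)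
  have zneg : ∀ p : ℝ × E d, p.1 ≤ 0 → p ∉ Q := fun p hp h => by
    have := h.1.1; linarith
  have sg : HasCompactSupport (gradX ψ) := hasCompactSupport_of_subset hs fun p =>
    gradX_eq_zero hd
  have sh : HasCompactSupport (heatAdj ψ) :=
    hasCompactSupport_of_subset hs fun p => heatAdj_eq_zero
  have hUc : ContinuousOn U (Icc a b) := fun t ht =>
    (hU t (ha.trans_le ht.1)).continuousAt.continuousWithinAt
  have hUcQ : ContinuousOn (fun p : ℝ × E d => U p.1) Q :=
    hUc.comp continuous_fst.continuousOn fun p hp => Ioo_subset_Icc_self hp.1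
  have hUm : AEStronglyMeasurable (fun p : ℝ × E d => U p.1) (volume.restrict Q) :=
    hUcQ.aestronglyMeasurable hQm
  obtain ⟨A, hA⟩ := isCompact_Icc.exists_bound_of_continuousOn hUc
  have hU'c : ContinuousOn U' (Icc a b) := hU'.mono fun t ht => ha.trans_le ht.1
  obtain ⟨A', hA'⟩ := isCompact_Icc.exists_bound_of_continuousOn hU'c
  have hU'm : AEStronglyMeasurable (fun p : ℝ × E d => U' p.1) (volume.restrict Q) :=
    (hU'c.comp continuous_fst.continuousOn fun p hp =>
      Ioo_subset_Icc_self hp.1).aestronglyMeasurable hQm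
  have hU'i : IntegrableOn (fun p : ℝ × E d => U' p.1) Q := by
    refine (integrable_const A').mono' hU'm ?_
    filter_upwards [ae_restrict_mem hQm] with p hp
    exact hA' _ (Ioo_subset_Icc_self hp.1)
  have hβcont : Continuous β := continuous_iff_continuousAt.2 fun s => (hβ s).continuousAt
  have hβ'cont : Continuous β' := continuous_iff_continuousAt.2 fun s => (hβ' s).continuousAt
  have hlip : ∀ s t, |β s - β t| ≤ C * |s - t| := by
    intro s t
    have := Convex.norm_image_sub_le_of_norm_hasDerivWithin_le (f := β) (f' := β') (s := univ)
      (C := C) (fun x _ => (hβ x).hasDerivWithinAt) (fun x _ => hC x) convex_univ (mem_univ t)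
      (mem_univ s)
    simpa using this
  have mβ' : AEStronglyMeasurable (fun p => β' (n p - U p.1)) (volume.restrict Q) :=
    hβ'cont.comp_aestronglyMeasurable (b1.1.sub hUm)
  have LU : MemLp (fun p : ℝ × E d => U p.1) 2 (volume.restrict Q) := by
    refine MemLp.of_bound hUm A ?_
    filter_upwards [ae_restrict_mem hQm] with p hp
    exact hA _ (Ioo_subset_Icc_self hp.1)
  have Lβ : MemLp (fun p => β (n p - U p.1)) 2 (volume.restrict Q) := by
    have h1 : MemLp (fun p => β (n p - U p.1) - β 0) 2 (volume.restrict Q) := by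
      refine (b1.sub LU).of_le_mul (c := C)
        ((hβcont.comp_aestronglyMeasurable (b1.1.sub hUm)).sub aestronglyMeasurable_const)
        (ae_of_all _ fun p => ?_)
      simpa using hlip (n p - U p.1) 0
    have h2 := h1.add (memLp_const (β 0))
    refine h2.congr_norm (by exact hβcont.comp_aestronglyMeasurable (b1.1.sub hUm))
      (ae_of_all _ fun p => by simp)
  have int_DB : IntegrableOn (fun p => β' (n p - U p.1) * inner ℝ (Dn p) (B p)) Q :=
    (integrable_inner_of_memLp b2 b4).bdd_mul mβ' (ae_of_all _ fun p => hC _)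
  have int_UD : IntegrableOn (fun p => β' (n p - U p.1) * (U' p.1 - n p * D p)) Q :=
    (hU'i.sub (b1.integrable_mul b5)).bdd_mul mβ' (ae_of_all _ fun p => hC _)
  have int_βD : IntegrableOn (fun p => β (n p - U p.1) * D p) Q := Lβ.integrable_mul b5
  have int_βB : IntegrableOn (fun p => β (n p - U p.1) • B p) Q :=
    memLp_one_iff_integrable.1 (b4.smul Lβ)
  have int_β : IntegrableOn (fun p => β (n p - U p.1)) Q := Lβ.integrable (by norm_num)
  have j1 := integrable_mul_of_integrableOn int_DB hψ.continuous hs zψ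
  have j2 := integrable_mul_of_integrableOn int_UD hψ.continuous hs zψ
  have j3 := integrable_mul_of_integrableOn int_βD hψ.continuous hs zψ
  have j4 := integrable_inner_of_integrableOn int_βB (continuous_gradX hψ) sg zg
  have j5 := integrable_mul_of_integrableOn int_β (continuous_heatAdj hψ) sh zh
  have j6 : Integrable (fun p => β (n p - U p.1) * D p * ψ p +
      inner ℝ (β (n p - U p.1) • B p) (gradX ψ p)) := j3.add j4
  -- The slice product rule removes `Dn` from the inequality; only `β(n - U)` and the drift with its
  -- divergence remain.
  have e2 : ∫ p, β' (n p - U p.1) * inner ℝ (Dn p) (B p) * ψ p =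
      ∫ p, -(β (n p - U p.1) * D p * ψ p + inner ℝ (β (n p - U p.1) • B p) (gradX ψ p)) := by
    refine integral_eq_of_ae_slices j1 j6.neg ?_
      (fun p hp => by simp [zψ p (zneg p hp)])
      (fun p hp => by simp [zg p (zneg p hp), zψ p (zneg p hp)])
    filter_upwards [H.ae_product_rule hβ hβ'cont hC U hψ hs] with t ht
    simp only [mul_assoc]
    rw [ht, integral_neg]
    congr 1
    refine integral_congr_ae (ae_of_all _ fun x => ?_)
    simp only [real_inner_smul_left]
    ring
  rw [integral_neg, integral_add j3 j4] at e2
  have e3 : ∫ p, β' (n p - U p.1) * ((U' p.1 - (inner ℝ (Dn p) (B p) + n p * D p)) * ψ p) =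
      (∫ p, β' (n p - U p.1) * (U' p.1 - n p * D p) * ψ p) -
        ∫ p, β' (n p - U p.1) * inner ℝ (Dn p) (B p) * ψ p := by
    rw [← integral_sub j2 j1]
    refine integral_congr_ae (ae_of_all _ fun p => ?_)
    simp only; ring
  have e4 : ∫ p, β (n p - U p.1) * (heatAdj ψ p - inner ℝ (B p) (gradX ψ p)) =
      (∫ p, β (n p - U p.1) * heatAdj ψ p) -
        ∫ p, inner ℝ (β (n p - U p.1) • B p) (gradX ψ p) := by
    rw [← integral_sub j5 j4]
    refine integral_congr_ae (ae_of_all _ fun p => ?_)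
    simp only [real_inner_smul_left]; ring
  -- All zeroth-order terms are collected here, and `hsign` makes their sum nonnegative.
  have e5 : 0 ≤ (∫ p, β' (n p - U p.1) * (U' p.1 - n p * D p) * ψ p) +
      ∫ p, β (n p - U p.1) * D p * ψ p := by
    rw [← integral_add j2 j3]
    refine integral_nonneg_of_ae ?_
    filter_upwards [(ae_restrict_iff' hΩ.measurableSet).1 hsign] with p hp
    by_cases hpQ : p ∈ Q
    · have := mul_nonneg (hp (hQΩ hpQ)) (hψ0 p)
      simp only [Pi.zero_apply]
      linarith
    · simp [zψ p hpQ]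
  rw [e4]
  linarith

end DriftKato

/-! ### Removing the spatial cutoff -/

section Cutoff

variable {d : ℕ} {n : ℝ × E d → ℝ} {Dn B : ℝ × E d → E d} {D : ℝ × E d → ℝ}

lemma hasFDerivAt_mul_dilation {θ : ℝ → ℝ} {g : E d → ℝ} (hθ : Differentiable ℝ θ)
    (hg : Differentiable ℝ g) (c : ℝ) (p : ℝ × E d) :
    HasFDerivAt (fun q : ℝ × E d => θ q.1 * g (c • q.2))
      (θ p.1 • ((fderiv ℝ g (c • p.2)).comp (c • ContinuousLinearMap.snd ℝ ℝ (E d))) +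
        g (c • p.2) • (deriv θ p.1 • ContinuousLinearMap.fst ℝ ℝ (E d))) p := by
  have h1 : HasFDerivAt (fun q : ℝ × E d => θ q.1)
      (deriv θ p.1 • ContinuousLinearMap.fst ℝ ℝ (E d)) p :=
    (hθ p.1).hasDerivAt.comp_hasFDerivAt p hasFDerivAt_fst
  have h2 : HasFDerivAt (fun q : ℝ × E d => g (c • q.2))
      ((fderiv ℝ g (c • p.2)).comp (c • ContinuousLinearMap.snd ℝ ℝ (E d))) p :=
    (hg (c • p.2)).hasFDerivAt.comp p (hasFDerivAt_snd.const_smul c)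
  exact h1.mul h2

lemma fderiv_mul_dilation_dirT {θ : ℝ → ℝ} {g : E d → ℝ} (hθ : Differentiable ℝ θ)
    (hg : Differentiable ℝ g) (c : ℝ) (p : ℝ × E d) :
    fderiv ℝ (fun q : ℝ × E d => θ q.1 * g (c • q.2)) p (dirT d) =
      deriv θ p.1 * g (c • p.2) := by
  rw [(hasFDerivAt_mul_dilation hθ hg c p).fderiv]
  simp [dirT, mul_comm]

lemma fderiv_mul_dilation_dirX {θ : ℝ → ℝ} {g : E d → ℝ} (hθ : Differentiable ℝ θ)
    (hg : Differentiable ℝ g) (c : ℝ) (p : ℝ × E d) (v : E d) :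
    fderiv ℝ (fun q : ℝ × E d => θ q.1 * g (c • q.2)) p (0, v) =
      c * θ p.1 * fderiv ℝ g (c • p.2) v := by
  rw [(hasFDerivAt_mul_dilation hθ hg c p).fderiv]
  simp
  ring

lemma lapX_mul_dilation {θ : ℝ → ℝ} {g : E d → ℝ} (hθ : Differentiable ℝ θ)
    (hg : ContDiff ℝ ∞ g) (c : ℝ) (p : ℝ × E d) :
    lapX (fun q : ℝ × E d => θ q.1 * g (c • q.2)) p =
      c ^ 2 * θ p.1 * ∑ i : Fin d, fderiv ℝ (fun y => fderiv ℝ g y (EuclideanSpace.single i 1))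
        (c • p.2) (EuclideanSpace.single i 1) := by
  rw [lapX, Finset.mul_sum]
  refine Finset.sum_congr rfl fun i _ => ?_
  have h1 : (fun q => fderiv ℝ (fun q : ℝ × E d => θ q.1 * g (c • q.2)) q (dirX d i)) =
      fun q => (c * θ q.1) * (fun y => fderiv ℝ g y (EuclideanSpace.single i 1)) (c • q.2) :=
    funext fun q => fderiv_mul_dilation_dirX hθ (hg.differentiable (by simp)) c q _
  have hg2 : ContDiff ℝ ∞ (fun y => fderiv ℝ g y (EuclideanSpace.single i 1)) :=
    (hg.fderiv_right (m := ∞) (by simp)).clm_apply contDiff_const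
  rw [h1]
  have := fderiv_mul_dilation_dirX (θ := fun t => c * θ t) (hθ.const_mul c)
    (hg2.differentiable (by simp)) c p (EuclideanSpace.single i 1)
  rw [dirX, this]
  ring

lemma gradX_mul_dilation {θ : ℝ → ℝ} {g : E d → ℝ} (hg : Differentiable ℝ g) (c : ℝ)
    (p : ℝ × E d) :
    gradX (fun q : ℝ × E d => θ q.1 * g (c • q.2)) p = (c * θ p.1) • gradient g (c • p.2) := by
  have h2 : HasFDerivAt (fun y : E d => θ p.1 * g (c • y))
      (θ p.1 • (fderiv ℝ g (c • p.2)).comp (c • ContinuousLinearMap.id ℝ (E d))) p.2 :=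
    ((hg (c • p.2)).hasFDerivAt.comp p.2 ((hasFDerivAt_id p.2).const_smul c)).const_mul _
  rw [gradX, gradient, h2.fderiv, gradient, ← map_smul]
  congr 1
  ext v
  simp
  ring

/-- Kato's inequality integrated over the whole space. -/
theorem DriftSystem.integral_mul_deriv_nonneg (H : DriftSystem n Dn B D)
    {β β' β'' : ℝ → ℝ} (hβ : ∀ s, HasDerivAt β (β' s) s) (hβ' : ∀ s, HasDerivAt β' (β'' s) s)
    (hβc : Continuous β'') (hβ0 : ∀ s, 0 ≤ β'' s) {C : ℝ≥0} (hC : ∀ s, |β' s| ≤ C) {U U' : ℝ → ℝ}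
    (hU : ∀ t, 0 < t → HasDerivAt U (U' t) t) (hU' : ContinuousOn U' (Ioi 0))
    (hsign : ∀ᵐ p ∂(volume.restrict (Ioi (0 : ℝ) ×ˢ (univ : Set (E d)))),
      0 ≤ β' (n p - U p.1) * (U' p.1 - n p * D p) + β (n p - U p.1) * D p)
    {a b : ℝ} (ha : 0 < a) (hab : a < b) {P : ℝ × E d → ℝ}
    (hP : MemLp P 2 (volume.restrict (Ioo a b ×ˢ univ)))
    (hBm : AEStronglyMeasurable B (volume.restrict (Ioo a b ×ˢ univ))) {C₀ : ℝ} (hC₀ : 0 ≤ C₀)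
    (hBP : ∀ᵐ p ∂(volume.restrict (Ioo a b ×ˢ univ)), ‖B p‖ ≤ P p + C₀ * (1 + ‖p.2‖))
    (hn : IntegrableOn n (Ioo a b ×ˢ univ))
    (hβn : ∀ᵐ p ∂(volume.restrict (Ioo a b ×ˢ univ)), |β (n p - U p.1)| ≤ |n p|)
    {η : ℝ → ℝ} (hη : ContDiff ℝ ∞ η) (hηs : HasCompactSupport η) (hη0 : ∀ t, 0 ≤ η t)
    (hηab : tsupport η ⊆ Ioo a b) :
    0 ≤ ∫ t, (∫ x, β (n (t, x) - U t)) * deriv η t := by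
  set Q : Set (ℝ × E d) := Ioo a b ×ˢ univ with hQ
  have hQm : MeasurableSet Q := measurableSet_Ioo.prod MeasurableSet.univ
  let χ : ContDiffBump (0 : E d) := ⟨1, 2, one_pos, one_lt_two⟩
  have hχ : ContDiff ℝ ∞ χ := χ.contDiff
  have hχd : Differentiable ℝ χ := hχ.differentiable (by simp)
  have hηd : Differentiable ℝ η := hη.differentiable (by simp)
  set Λ : E d → ℝ := fun y => ∑ i : Fin d,
    fderiv ℝ (fun y => fderiv ℝ χ y (EuclideanSpace.single i 1)) y (EuclideanSpace.single i 1)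
    with hΛ
  have hc2 : ∀ i : Fin d, ContDiff ℝ ∞ (fun y => fderiv ℝ χ y (EuclideanSpace.single i 1)) :=
    fun i => (hχ.fderiv_right (m := ∞) (by simp)).clm_apply contDiff_const
  have hΛc : Continuous Λ := continuous_finsetSum _ fun i _ =>
    ((hc2 i).continuous_fderiv (by simp)).clm_apply continuous_const
  have hΛs : HasCompactSupport Λ := χ.hasCompactSupport.of_isClosed_subset (isClosed_tsupport _)
    (closure_minimal (fun x hx => by
      by_contra h0
      refine hx (Finset.sum_eq_zero fun i _ => ?_)
      rw [fderiv_of_notMem_tsupport (𝕜 := ℝ)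
        (fun h => h0 (tsupport_fderiv_apply_subset ℝ _ h))]
      rfl) (isClosed_tsupport _))
  have hgc : Continuous (gradient χ) := continuous_gradient (χ.contDiff)
  have hgs : HasCompactSupport (gradient χ) := hasCompactSupport_gradient χ.hasCompactSupport
  obtain ⟨A₁, hA₁⟩ := hΛc.bounded_above_of_compact_support hΛs
  obtain ⟨A₂, hA₂⟩ := hgc.bounded_above_of_compact_support hgs
  -- `A₃` bounds `‖x‖ ‖∇χ(x)‖`. Evaluated at `c k • x`, it absorbs the linear growth of the drift
  -- against the factor `c k` from differentiating the dilated cutoff.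
  obtain ⟨A₃, hA₃⟩ := (continuous_norm.smul hgc).bounded_above_of_compact_support
    (hgs.smul_left (f := fun x : E d => ‖x‖))
  have hA₂0 : 0 ≤ A₂ := (norm_nonneg _).trans (hA₂ 0)
  obtain ⟨N₀, hN₀⟩ := hη.continuous.bounded_above_of_compact_support hηs
  have hη'c : Continuous (deriv η) := hη.continuous_deriv (by simp)
  obtain ⟨N₁, hN₁⟩ := hη'c.bounded_above_of_compact_support hηs.deriv
  have hN₀0 : 0 ≤ N₀ := (norm_nonneg _).trans (hN₀ 0)
  set c : ℕ → ℝ := fun k => 1 / ((k : ℝ) + 1) with hc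
  have hc0 : ∀ k, 0 < c k := fun k => by positivity
  have hc1 : ∀ k, c k ≤ 1 := fun k => by
    rw [hc]; simp only
    rw [div_le_one (by positivity)]; linarith [(Nat.cast_nonneg k : (0 : ℝ) ≤ k)]
  have hct : Tendsto c atTop (𝓝 0) := tendsto_one_div_add_atTop_nhds_zero_nat
  have hUm : AEStronglyMeasurable (fun p : ℝ × E d => U p.1) (volume.restrict Q) := by
    have hUc : ContinuousOn U (Ioo a b) := fun t ht =>
      (hU t (ha.trans ht.1)).continuousAt.continuousWithinAt
    exact (hUc.comp continuous_fst.continuousOn fun p (hp : p ∈ Q) => hp.1).aestronglyMeasurable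
      hQm
  have hβcont : Continuous β := continuous_iff_continuousAt.2 fun s => (hβ s).continuousAt
  have mβ : AEStronglyMeasurable (fun p => β (n p - U p.1)) (volume.restrict Q) :=
    hβcont.comp_aestronglyMeasurable (hn.1.sub hUm)
  set F : ℕ → ℝ × E d → ℝ := fun k p => β (n p - U p.1) *
    (deriv η p.1 * χ (c k • p.2) + c k ^ 2 * η p.1 * Λ (c k • p.2) -
      inner ℝ (B p) ((c k * η p.1) • gradient χ (c k • p.2))) with hF
  have hF0 : ∀ k, 0 ≤ ∫ p in Q, F k p := by
    intro k
    set ψ : ℝ × E d → ℝ := fun q => η q.1 * χ (c k • q.2) with hψ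
    have h1 : ContDiff ℝ ∞ ψ :=
      (hη.comp contDiff_fst).mul (hχ.comp (contDiff_snd.const_smul (c k)))
    have hK : IsCompact (tsupport η ×ˢ ((fun x : E d => (c k)⁻¹ • x) '' tsupport χ)) :=
      hηs.isCompact.prod (χ.hasCompactSupport.isCompact.image (by fun_prop))
    have hsub : tsupport ψ ⊆ tsupport η ×ˢ ((fun x : E d => (c k)⁻¹ • x) '' tsupport χ) := by
      refine closure_minimal (fun p hp => ?_) hK.isClosed
      have hp' : η p.1 * χ (c k • p.2) ≠ 0 := hp
      refine ⟨subset_tsupport _ (left_ne_zero_of_mul hp'),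
        ⟨c k • p.2, subset_tsupport _ (right_ne_zero_of_mul hp'), ?_⟩⟩
      simp [smul_smul, (hc0 k).ne']
    have h2 : HasCompactSupport ψ := hK.of_isClosed_subset (isClosed_tsupport _) hsub
    have h3 : tsupport ψ ⊆ Ioi (0 : ℝ) ×ˢ (univ : Set (E d)) := fun p hp =>
      ⟨ha.trans (hηab (hsub hp).1).1, trivial⟩
    have := H.kato hβ hβ' hβc hβ0 hC hU hU' hsign h1 h2 h3
      (fun p => mul_nonneg (hη0 _) χ.nonneg)
    have e : ∀ p, β (n p - U p.1) * (heatAdj ψ p - inner ℝ (B p) (gradX ψ p)) = F k p := fun p => by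
      rw [hF, heatAdj, hψ, fderiv_mul_dilation_dirT hηd hχd, lapX_mul_dilation hηd hχ,
        gradX_mul_dilation hχd]
    simp_rw [e] at this
    rwa [setIntegral_eq_integral_of_forall_compl_eq_zero]
    intro p hp
    have hp1 : p.1 ∉ tsupport η := fun h => hp ⟨hηab h, trivial⟩
    have e1 : η p.1 = 0 := image_eq_zero_of_notMem_tsupport hp1
    have e2 : deriv η p.1 = 0 := image_eq_zero_of_notMem_tsupport
      fun h => hp1 (tsupport_deriv_subset h)
    simp [hF, e1, e2]
  have hlim : Tendsto (fun k => ∫ p in Q, F k p) atTop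
      (𝓝 (∫ p in Q, β (n p - U p.1) * deriv η p.1)) := by
    -- The part `P` of the drift is unbounded, so `n ∈ L²` is needed here; the other terms of the
    -- majorant use `n ∈ L¹`.
    have hnP : IntegrableOn (fun p => n p * P p) Q := (H.n_L2 a b ha hab).integrable_mul hP
    refine tendsto_integral_of_dominated_convergence
      (fun p => |n p| * (N₁ + N₀ * A₁ + N₀ * (A₂ * C₀ + C₀ * A₃)) + N₀ * A₂ * |n p * P p|)
      (fun k => ?_) ((hn.abs.mul_const _).add (hnP.abs.const_mul _)) (fun k => ?_) ?_
    · refine mβ.mul (AEStronglyMeasurable.sub ?_ (hBm.inner ?_))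
      · have : Continuous fun p : ℝ × E d =>
          deriv η p.1 * χ (c k • p.2) + c k ^ 2 * η p.1 * Λ (c k • p.2) := by
          have := hχ.continuous
          have := hη.continuous
          fun_prop
        exact this.aestronglyMeasurable
      · have : Continuous fun p : ℝ × E d => (c k * η p.1) • gradient χ (c k • p.2) := by
          have := hη.continuous
          fun_prop
        exact this.aestronglyMeasurable
    · filter_upwards [hBP, hβn] with p h1 h2
      have hPb : P p ≤ |P p| := le_abs_self _
      have hg3 : c k * ‖p.2‖ * ‖gradient χ (c k • p.2)‖ ≤ A₃ := by
        have := hA₃ (c k • p.2)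
        rw [Pi.smul_apply', norm_smul, norm_norm, norm_smul, Real.norm_of_nonneg (hc0 k).le] at this
        exact this
      have hg2 := hA₂ (c k • p.2)
      have b1 : |deriv η p.1 * χ (c k • p.2)| ≤ N₁ := by
        rw [abs_mul, abs_of_nonneg χ.nonneg]
        calc _ ≤ |deriv η p.1| * 1 := by gcongr; exact χ.le_one
          _ ≤ N₁ := by simpa using hN₁ p.1
      have b2 : |c k ^ 2 * η p.1 * Λ (c k • p.2)| ≤ N₀ * A₁ := by
        rw [abs_mul, abs_mul, abs_of_nonneg (sq_nonneg _)]
        calc _ ≤ 1 * N₀ * A₁ := by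
              gcongr
              · exact pow_le_one₀ (hc0 k).le (hc1 k)
              · exact hN₀ _
              · exact hA₁ _
          _ = _ := by ring
      have b3 : |inner ℝ (B p) ((c k * η p.1) • gradient χ (c k • p.2))| ≤
          N₀ * (A₂ * C₀ + C₀ * A₃) + N₀ * A₂ * |P p| := by
        refine (abs_real_inner_le_norm _ _).trans ?_
        rw [norm_smul, norm_mul, Real.norm_of_nonneg (hc0 k).le]
        have hηp := hN₀ p.1
        calc ‖B p‖ * (c k * ‖η p.1‖ * ‖gradient χ (c k • p.2)‖)
            ≤ (|P p| + C₀ * (1 + ‖p.2‖)) * (c k * ‖η p.1‖ * ‖gradient χ (c k • p.2)‖) := by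
              gcongr; linarith
          _ = ‖η p.1‖ * (c k * (‖gradient χ (c k • p.2)‖ * (|P p| + C₀)) +
              C₀ * (c k * ‖p.2‖ * ‖gradient χ (c k • p.2)‖)) := by ring
          _ ≤ N₀ * (1 * (A₂ * (|P p| + C₀)) + C₀ * A₃) := by
              have := hc1 k
              have := (hc0 k).le
              gcongr
          _ = _ := by ring
      rw [hF, Real.norm_eq_abs, abs_mul]
      calc _ ≤ |n p| * (N₁ + N₀ * A₁ + (N₀ * (A₂ * C₀ + C₀ * A₃) + N₀ * A₂ * |P p|)) := by
            gcongr
            refine (abs_sub _ _).trans (add_le_add ((abs_add_le _ _).trans (add_le_add b1 b2)) b3)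
        _ = _ := by rw [abs_mul]; ring
    · refine ae_of_all _ fun p => ?_
      have hcx : Tendsto (fun k => c k • p.2) atTop (𝓝 0) := by
        simpa using hct.smul_const p.2
      have t1 : Tendsto (fun k => χ (c k • p.2)) atTop (𝓝 1) := by
        have := (hχ.continuous.tendsto 0).comp hcx
        rwa [χ.one_of_mem_closedBall (by simp [χ.rIn_pos.le])] at this
      have t2 : Tendsto (fun k => Λ (c k • p.2)) atTop (𝓝 (Λ 0)) := (hΛc.tendsto 0).comp hcx
      have t3 : Tendsto (fun k => gradient χ (c k • p.2)) atTop (𝓝 (gradient χ 0)) :=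
        (hgc.tendsto 0).comp hcx
      -- Pointwise, each term in which `χ` was differentiated carries a factor `c k → 0`; only the
      -- time derivative survives.
      have := (((t1.const_mul (deriv η p.1)).add (((hct.pow 2).mul_const (η p.1)).mul t2)).sub
        (((tendsto_const_nhds (x := B p)).inner
          (𝕜 := ℝ) ((hct.mul_const (η p.1)).smul t3)))).const_mul (β (n p - U p.1))
      simpa [hF] using this
  have hfin := ge_of_tendsto' hlim hF0
  have hint : IntegrableOn (fun p => β (n p - U p.1) * deriv η p.1) Q := by
    refine (hn.abs.mul_const N₁).mono' (mβ.mul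
      (hη'c.comp continuous_fst).aestronglyMeasurable) ?_
    filter_upwards [hβn] with p h2
    rw [Real.norm_eq_abs, abs_mul]
    gcongr
    exact hN₁ _
  have hz : ∀ p ∉ Q, β (n p - U p.1) * deriv η p.1 = 0 := fun p hp => by
    have hp1 : p.1 ∉ tsupport η := fun h => hp ⟨hηab h, trivial⟩
    have e2 : deriv η p.1 = 0 := image_eq_zero_of_notMem_tsupport
      fun h => hp1 (tsupport_deriv_subset h)
    simp [e2]
  rw [setIntegral_eq_integral_of_forall_compl_eq_zero hz] at hfin
  have hint' : Integrable (fun p => β (n p - U p.1) * deriv η p.1) :=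
    (integrableOn_iff_integrable_of_support_subset fun p hp => by
      by_contra h; exact hp (hz p h)).1 hint
  rw [Measure.volume_eq_prod] at hfin hint'
  rw [integral_prod _ hint'] at hfin
  simpa only [integral_mul_const] using hfin

end Cutoff

/-! ### From a distributional inequality in time to monotonicity -/

section Time

/-- A continuous function on `(0, ∞)` with nonpositive distributional derivative is antitone. -/
theorem antitoneOn_of_integral_mul_deriv_nonneg {m : ℝ → ℝ} (hm : ContinuousOn m (Ioi 0))
    (h : ∀ a b : ℝ, 0 < a → a < b → ∀ η : ℝ → ℝ, ContDiff ℝ ∞ η → HasCompactSupport η →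
      (∀ t, 0 ≤ η t) → tsupport η ⊆ Ioo a b → 0 ≤ ∫ t, m t * deriv η t) :
    AntitoneOn m (Ioi 0) := by
  intro s hs t ht hst
  rcases hst.eq_or_lt with rfl | hst
  · exact le_rfl
  have hs0 : 0 < s := hs
  refine le_of_forall_pos_le_add fun ε hε => ?_
  have hcs : ∀ x, 0 < x → ∃ δ > 0, ∀ u, |u - x| < δ → |m u - m x| < ε / 2 := fun x hx => by
    have := Metric.continuousAt_iff.1 (hm.continuousAt (Ioi_mem_nhds hx)) (ε / 2) (by positivity)
    simpa [Real.dist_eq] using this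
  obtain ⟨δ₁, hδ₁, h₁⟩ := hcs s hs0
  obtain ⟨δ₂, hδ₂, h₂⟩ := hcs t ht
  -- The scale `r` makes `m` vary by less than `ε / 2` around `s` and `t`; the bound `r ≤ s / 2`
  -- keeps the test function away from time zero.
  obtain ⟨r, hr, hr1, hr2, hr3⟩ : ∃ r : ℝ, 0 < r ∧ r ≤ δ₁ ∧ r ≤ δ₂ ∧ r ≤ s / 2 :=
    ⟨min (min δ₁ δ₂) (s / 2), by positivity, by simp, by simp, by simp⟩
  let χ : ContDiffBump (0 : ℝ) := ⟨r / 2, r, by positivity, by linarith⟩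
  set ρ : ℝ → ℝ := χ.normed volume with hρ
  have hρ1 : ContDiff ℝ ∞ ρ := χ.contDiff_normed
  have hρ0 : ∀ u, 0 ≤ ρ u := fun u => χ.nonneg_normed u
  have hρz : ∀ u, r ≤ |u| → ρ u = 0 := fun u hu => by
    by_contra h0
    have : u ∈ Function.support ρ := h0
    rw [hρ, χ.support_normed_eq, mem_ball_zero_iff] at this
    exact (lt_irrefl _ (this.trans_le hu))
  have hρi : ∫ u, ρ u = 1 := χ.integral_normed
  have hρint : ∀ x, Integrable (fun u => ρ (u - x)) := fun x =>
    (χ.continuous_normed.integrable_of_hasCompactSupport χ.hasCompactSupport_normed).comp_sub_right x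
  have hρx : ∀ x, ∫ u, ρ (u - x) = 1 := fun x => by rw [integral_sub_right_eq_self, hρi]
  have hI : ∀ x, s ≤ x → Integrable (fun u => m u * ρ (u - x)) := by
    intro x hx
    have hsub : Icc (x - r) (x + r) ⊆ Ioi 0 := fun u hu => by
      have := hu.1; simp only [mem_Ioi]; linarith
    refine (integrableOn_iff_integrable_of_support_subset (s := Icc (x - r) (x + r)) ?_).1 ?_
    · intro u hu
      by_contra hu'
      refine hu ?_
      have : r ≤ |u - x| := by
        by_contra hlt
        have := abs_lt.1 (not_le.1 hlt)
        exact hu' ⟨by linarith, by linarith⟩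
      simp [hρz _ this]
    · refine ContinuousOn.integrableOn_Icc ((hm.mono hsub).mul ?_)
      exact (hρ1.continuous.comp (continuous_id.sub continuous_const)).continuousOn
  set Θ : ℝ → ℝ := fun u => ∫ v in (0 : ℝ)..u, ρ v with hΘ
  have hΘd : ∀ u, HasDerivAt Θ (ρ u) u := fun u =>
    intervalIntegral.integral_hasDerivAt_right (hρ1.continuous.intervalIntegrable _ _)
      (hρ1.continuous.stronglyMeasurableAtFilter _ _) hρ1.continuous.continuousAt
  have hΘ' : deriv Θ = ρ := funext fun u => (hΘd u).deriv
  have hΘs : ContDiff ℝ ∞ Θ := contDiff_infty_iff_deriv.2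
    ⟨fun u => (hΘd u).differentiableAt, by rwa [hΘ']⟩
  have hΘm : Monotone Θ := monotone_of_deriv_nonneg (fun u => (hΘd u).differentiableAt)
    (fun u => by rw [hΘ']; exact hρ0 u)
  have hΘc : ∀ u v, u ≤ v → (v ≤ -r ∨ r ≤ u) → Θ v = Θ u := by
    intro u v huv hc
    have h3 : Θ v - Θ u = ∫ w in u..v, ρ w :=
      intervalIntegral.integral_interval_sub_left (hρ1.continuous.intervalIntegrable _ _)
        (hρ1.continuous.intervalIntegrable _ _)
    have h4 : ∫ w in u..v, ρ w = 0 := by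
      rw [intervalIntegral.integral_congr (g := fun _ => 0), intervalIntegral.integral_zero]
      intro w hw
      rw [uIcc_of_le huv] at hw
      refine hρz w ?_
      rcases hc with hc | hc
      · exact (by linarith [hw.2] : r ≤ -w).trans (neg_le_abs w)
      · exact (hc.trans hw.1).trans (le_abs_self w)
    linarith
  -- A smoothed indicator of `[s, t]`, whose derivative is one unit bump at `s` minus another at
  -- `t`. Testing with it compares local averages of `m` at the two times.
  set η : ℝ → ℝ := fun u => Θ (u - s) - Θ (u - t) with hη
  have hηs : ContDiff ℝ ∞ η :=
    (hΘs.comp (contDiff_id.sub contDiff_const)).sub (hΘs.comp (contDiff_id.sub contDiff_const))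
  have hη0 : ∀ u, 0 ≤ η u := fun u => sub_nonneg.2 (hΘm (by linarith))
  have hη' : ∀ u, deriv η u = ρ (u - s) - ρ (u - t) := fun u =>
    (((hΘd (u - s)).comp_sub_const u s).sub ((hΘd (u - t)).comp_sub_const u t)).deriv
  have hsub : tsupport η ⊆ Icc (s - r) (t + r) := by
    refine closure_minimal (fun u hu => ?_) isClosed_Icc
    by_contra hu'
    refine hu (sub_eq_zero.2 (hΘc (u - t) (u - s) (by linarith) ?_))
    rw [mem_Icc, not_and_or, not_le, not_le] at hu'
    rcases hu' with hu' | hu'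
    · left; linarith
    · right; linarith
  have key := h (s / 4) (t + s) (by positivity) (by linarith) η hηs
    (isCompact_Icc.of_isClosed_subset (isClosed_tsupport _) hsub) hη0
    (hsub.trans fun u hu => ⟨by linarith [hu.1], by linarith [hu.2]⟩)
  simp_rw [hη', mul_sub] at key
  rw [integral_sub (hI s le_rfl) (hI t hst.le)] at key
  have k1 : ∫ u, m u * ρ (u - s) ≤ m s + ε / 2 := by
    have : ∫ u, m u * ρ (u - s) ≤ ∫ u, (m s + ε / 2) * ρ (u - s) := by
      refine integral_mono (hI s le_rfl) ((hρint s).const_mul _) fun u => ?_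
      simp only
      by_cases hu : r ≤ |u - s|
      · simp [hρz _ hu]
      · have := (abs_lt.1 (h₁ u (lt_of_lt_of_le (not_le.1 hu) hr1))).2
        exact mul_le_mul_of_nonneg_right (by linarith) (hρ0 _)
    rwa [integral_const_mul, hρx, mul_one] at this
  have k2 : m t - ε / 2 ≤ ∫ u, m u * ρ (u - t) := by
    have : ∫ u, (m t - ε / 2) * ρ (u - t) ≤ ∫ u, m u * ρ (u - t) := by
      refine integral_mono ((hρint t).const_mul _) (hI t hst.le) fun u => ?_
      simp only
      by_cases hu : r ≤ |u - t|
      · simp [hρz _ hu]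
      · have := (abs_lt.1 (h₂ u (lt_of_lt_of_le (not_le.1 hu) hr2))).1
        exact mul_le_mul_of_nonneg_right (by linarith) (hρ0 _)
    rwa [integral_const_mul, hρx, mul_one] at this
  linarith

end Time

/-! ### A convex smoothing of the positive part -/

section Beta

/-- A convex `C²` approximation of the positive part. -/
noncomputable def smoothPos (s : ℝ) : ℝ := (max s 0) ^ 3 / (1 + max s 0) ^ 2

/-- The derivative of `smoothPos`. -/
noncomputable def smoothPos' (s : ℝ) : ℝ :=
  1 - 3 / (1 + max s 0) ^ 2 + 2 / (1 + max s 0) ^ 3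

/-- The second derivative of `smoothPos`. -/
noncomputable def smoothPos'' (s : ℝ) : ℝ := 6 * max s 0 / (1 + max s 0) ^ 4

/-- A function with vanishing derivative at `0` glues differentiably with its constant value on the
negative half-line. It is used once for each of the first two derivatives of the smoothing. -/
lemma hasDerivAt_max_zero {F F' : ℝ → ℝ} (hF : ∀ s, 0 ≤ s → HasDerivAt F (F' s) s)
    (h0 : F' 0 = 0) (s : ℝ) : HasDerivAt (fun s => F (max s 0)) (F' (max s 0)) s := by
  rcases lt_trichotomy s 0 with hs | rfl | hs
  · rw [max_eq_right hs.le, h0]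
    refine (hasDerivAt_const s (F 0)).congr_of_eventuallyEq ?_
    filter_upwards [Iio_mem_nhds hs] with u hu
    rw [max_eq_right (le_of_lt hu)]
  · rw [max_self, h0]
    have h1 := hF 0 le_rfl
    rw [h0, hasDerivAt_iff_isLittleO_nhds_zero] at h1
    rw [hasDerivAt_iff_isLittleO_nhds_zero]
    simp only [zero_add, smul_zero, sub_zero, max_self] at h1 ⊢
    have ht : Tendsto (fun u : ℝ => max u 0) (𝓝 0) (𝓝 0) := by
      have := (continuous_id.max (continuous_const (y := (0 : ℝ)))).tendsto (0 : ℝ)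
      simpa using this
    refine (h1.comp_tendsto ht).trans_le fun u => ?_
    simp only [Real.norm_eq_abs]
    rcases le_total u 0 with hu | hu
    · simp [max_eq_right hu]
    · simp [max_eq_left hu]
  · rw [max_eq_left hs.le]
    refine (hF s hs.le).congr_of_eventuallyEq ?_
    filter_upwards [Ioi_mem_nhds hs] with u hu
    rw [max_eq_left (le_of_lt hu)]

lemma hasDerivAt_smoothPos (s : ℝ) : HasDerivAt smoothPos (smoothPos' s) s := by
  refine hasDerivAt_max_zero (F := fun s => s ^ 3 / (1 + s) ^ 2)
    (F' := fun s => 1 - 3 / (1 + s) ^ 2 + 2 / (1 + s) ^ 3) (fun u hu => ?_) (by norm_num) s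
  have h1 : (1 + u) ≠ 0 := by positivity
  have h2 : HasDerivAt (fun s : ℝ => 1 + s) 1 u := (hasDerivAt_id u).const_add 1
  refine ((hasDerivAt_pow 3 u).div (h2.pow 2) (pow_ne_zero 2 h1)).congr_deriv ?_
  simp only [Nat.cast_ofNat, Nat.add_one_sub_one, pow_one, Pi.pow_apply]
  field_simp
  ring

lemma hasDerivAt_smoothPos' (s : ℝ) : HasDerivAt smoothPos' (smoothPos'' s) s := by
  refine hasDerivAt_max_zero (F := fun s => 1 - 3 / (1 + s) ^ 2 + 2 / (1 + s) ^ 3)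
    (F' := fun s => 6 * s / (1 + s) ^ 4) (fun u hu => ?_) (by norm_num) s
  have h1 : (1 + u) ≠ 0 := by positivity
  have h2 : HasDerivAt (fun s : ℝ => 1 + s) 1 u := (hasDerivAt_id u).const_add 1
  refine ((((hasDerivAt_const u (1 : ℝ)).sub ((hasDerivAt_const u (3 : ℝ)).div (h2.pow 2)
    (pow_ne_zero 2 h1))).add ((hasDerivAt_const u (2 : ℝ)).div (h2.pow 3)
    (pow_ne_zero 3 h1)))).congr_deriv ?_
  simp only [Nat.cast_ofNat, Nat.reduceSub, pow_one, Pi.pow_apply]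
  field_simp
  ring

lemma continuous_smoothPos'' : Continuous smoothPos'' := by
  refine Continuous.div (by fun_prop) (by fun_prop) fun s => ?_
  positivity

lemma smoothPos''_nonneg (s : ℝ) : 0 ≤ smoothPos'' s := by
  unfold smoothPos''; positivity

lemma smoothPos_nonneg (s : ℝ) : 0 ≤ smoothPos s := by
  unfold smoothPos; positivity

lemma smoothPos_le (s : ℝ) : smoothPos s ≤ max s 0 := by
  unfold smoothPos
  have : 0 ≤ max s 0 := le_max_right _ _
  rw [div_le_iff₀ (by positivity)]
  nlinarith [sq_nonneg (max s 0), mul_nonneg this this]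

lemma smoothPos_of_nonpos {s : ℝ} (hs : s ≤ 0) : smoothPos s = 0 := by
  simp [smoothPos, max_eq_right hs]

lemma smoothPos_pos {s : ℝ} (hs : 0 < s) : 0 < smoothPos s := by
  rw [smoothPos, max_eq_left hs.le]; positivity

lemma smoothPos'_eq (s : ℝ) :
    smoothPos' s = (max s 0) ^ 2 * (max s 0 + 3) / (1 + max s 0) ^ 3 := by
  have : 0 ≤ max s 0 := le_max_right _ _
  unfold smoothPos'
  field_simp
  ring

lemma smoothPos'_nonneg (s : ℝ) : 0 ≤ smoothPos' s := by
  rw [smoothPos'_eq]; positivity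

lemma smoothPos'_le_one (s : ℝ) : smoothPos' s ≤ 1 := by
  have : 0 ≤ max s 0 := le_max_right _ _
  rw [smoothPos'_eq, div_le_one (by positivity)]
  nlinarith

/-- Convexity together with the value `0` at `0`: the tangent at `s` lies below the function at the
origin. -/
lemma smoothPos_le_mul_smoothPos' (s : ℝ) : smoothPos s ≤ s * smoothPos' s := by
  rcases le_total s 0 with hs | hs
  · rw [smoothPos_of_nonpos hs, smoothPos'_eq, max_eq_right hs]; simp
  · rw [smoothPos'_eq, smoothPos, max_eq_left hs, mul_div_assoc', div_le_div_iff₀ (by positivity)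
      (by positivity)]
    have h : s * (s ^ 2 * (s + 3)) * (1 + s) ^ 2 - s ^ 3 * (1 + s) ^ 3 =
      2 * (s ^ 3 * (1 + s) ^ 2) := by ring
    have : 0 ≤ s ^ 3 * (1 + s) ^ 2 := by positivity
    linarith

lemma abs_smoothPos_sub_le (s t : ℝ) : |smoothPos s - smoothPos t| ≤ |s - t| := by
  have := Convex.norm_image_sub_le_of_norm_hasDerivWithin_le (f := smoothPos) (f' := smoothPos')
    (s := univ) (C := 1) (fun x _ => (hasDerivAt_smoothPos x).hasDerivWithinAt)
    (fun x _ => by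
      rw [Real.norm_of_nonneg (smoothPos'_nonneg x)]; exact smoothPos'_le_one x)
    convex_univ (mem_univ t) (mem_univ s)
  simpa using this

end Beta

/-! ### Measurability and integrability on time slabs -/

section Slab

variable {d : ℕ} {V : Type*} [NormedAddCommGroup V]

lemma restrict_slab (S : Set ℝ) :
    (volume : Measure (ℝ × E d)).restrict (S ×ˢ univ) = (volume.restrict S).prod volume := by
  rw [Measure.volume_eq_prod, ← Measure.prod_restrict, Measure.restrict_univ]

lemma ae_slab_fst {S : Set ℝ} {q : ℝ → Prop} (h : ∀ᵐ t ∂(volume.restrict S), q t) :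
    ∀ᵐ p ∂((volume : Measure (ℝ × E d)).restrict (S ×ˢ univ)), q p.1 := by
  rw [restrict_slab]
  exact Measure.quasiMeasurePreserving_fst.ae h

lemma ae_ae_of_ae_slab {S : Set ℝ} {q : ℝ × E d → Prop}
    (h : ∀ᵐ p ∂((volume : Measure (ℝ × E d)).restrict (S ×ˢ univ)), q p) :
    ∀ᵐ t ∂(volume.restrict S), ∀ᵐ x, q (t, x) := by
  rw [restrict_slab] at h
  exact Measure.ae_ae_of_ae_prod h

/-- Equality on almost every slice does not control the product measure without joint measurability.
Passing to strongly measurable representatives makes the set of equality measurable, and Fubini then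
applies. -/
lemma ae_slab_of_forall_slice {S : Set ℝ} {f g : ℝ × E d → V}
    (hf : AEStronglyMeasurable f (volume.restrict (S ×ˢ univ)))
    (hg : AEStronglyMeasurable g (volume.restrict (S ×ˢ univ)))
    (h : ∀ᵐ t ∂(volume.restrict S), ∀ᵐ x, f (t, x) = g (t, x)) :
    f =ᵐ[volume.restrict (S ×ˢ univ)] g := by
  have h1 := ae_ae_of_ae_slab hf.ae_eq_mk
  have h2 := ae_ae_of_ae_slab hg.ae_eq_mk
  have hm := hf.stronglyMeasurable_mk.measurableSet_eq_fun hg.stronglyMeasurable_mk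
  have h3 : hf.mk f =ᵐ[volume.restrict (S ×ˢ univ)] hg.mk g := by
    have := (Measure.ae_prod_iff_ae_ae (μ := volume.restrict S) (ν := volume) hm).2 (by
      filter_upwards [h, h1, h2] with t a1 a2 a3
      filter_upwards [a1, a2, a3] with x b1 b2 b3
      rw [← b2, ← b3, b1])
    rw [← restrict_slab] at this
    exact this
  exact hf.ae_eq_mk.trans (h3.trans hg.ae_eq_mk.symm)

lemma memLp_slab {F : ℝ × E d → V} {a b : ℝ} {q : ℝ≥0} (hq : q ≠ 0)
    (hF : AEStronglyMeasurable F (volume.restrict (Ioo a b ×ˢ univ))) {A : ℝ≥0}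
    (h : ∀ᵐ t ∂(volume.restrict (Ioo a b)), eLpNorm (fun x => F (t, x)) q volume ≤ A) :
    MemLp F q (volume.restrict (Ioo a b ×ˢ univ)) := by
  refine ⟨hF, ?_⟩
  have hq0 : (0 : ℝ) < q := NNReal.coe_pos.2 (pos_iff_ne_zero.2 hq)
  have h1 : eLpNorm F q (volume.restrict (Ioo a b ×ˢ univ)) ^ (q : ℝ) < ⊤ := by
    rw [eLpNorm_nnreal_pow_eq_lintegral hq, restrict_slab,
      lintegral_prod _ (by rw [← restrict_slab]; exact hF.enorm.pow_const _)]
    calc _ ≤ ∫⁻ t in Ioo a b, (A : ℝ≥0∞) ^ (q : ℝ) := by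
          refine lintegral_mono_ae ?_
          filter_upwards [h] with t ht
          rw [← eLpNorm_nnreal_pow_eq_lintegral hq]
          gcongr
      _ < ⊤ := by
          rw [lintegral_const, Measure.restrict_apply_univ]
          exact ENNReal.mul_lt_top (ENNReal.rpow_lt_top_of_nonneg hq0.le ENNReal.coe_ne_top) (by simp)
  exact (ENNReal.rpow_lt_top_iff_of_pos hq0).1 h1

/-- For almost every time a jointly measurable representative agrees with `N` on almost all of
space, so it generates exactly the same field at that time. -/
lemma aestronglyMeasurable_field_slab {N : ℝ × E d → ℝ} {S : Set ℝ}
    (hN : AEStronglyMeasurable N (volume.restrict (S ×ˢ univ))) :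
    AEStronglyMeasurable (fun p : ℝ × E d => field (fun y => N (p.1, y)) p.2)
      (volume.restrict (S ×ˢ univ)) := by
  have h1 : StronglyMeasurable (fun q : (ℝ × E d) × E d =>
      (hN.mk N) (q.1.1, q.2) • kern d (q.1.2 - q.2)) :=
    (hN.stronglyMeasurable_mk.comp_measurable (by fun_prop)).smul
      ((measurable_kern d).stronglyMeasurable.comp_measurable (by fun_prop))
  have h2 := StronglyMeasurable.integral_prod_right (ν := volume)
    (f := fun (p : ℝ × E d) (y : E d) => (hN.mk N) (p.1, y) • kern d (p.2 - y)) h1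
  refine h2.aestronglyMeasurable.congr ?_
  filter_upwards [ae_slab_fst (ae_ae_of_ae_slab hN.ae_eq_mk)] with p hp
  refine integral_congr_ae ?_
  filter_upwards [hp] with y hy
  rw [hy]

end Slab

/-! ### Divergence of a Lipschitz vector field -/

section LipschitzField

variable {d : ℕ}

/-- The divergence of a Lipschitz vector field. -/
noncomputable def divergence (F : E d → E d) (x : E d) : ℝ :=
  ∑ i, lineDeriv ℝ (fun y => F y i) x (EuclideanSpace.single i 1)

lemma lipschitzWith_apply {F : E d → E d} {L : ℝ≥0} (hF : LipschitzWith L F) (i : Fin d) :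
    LipschitzWith L (fun y => F y i) := by
  refine LipschitzWith.of_dist_le_mul fun x y => ?_
  refine le_trans ?_ (hF.dist_le_mul x y)
  rw [dist_eq_norm, dist_eq_norm]
  simpa using PiLp.norm_apply_le (F x - F y) i

/-- Applied to `∇φ`, this yields the constant `d L` in the barrier. -/
lemma abs_divergence_le {F : E d → E d} {L : ℝ≥0} (hF : LipschitzWith L F) (x : E d) :
    |divergence F x| ≤ d * L := by
  unfold divergence
  refine (Finset.abs_sum_le_sum_abs _ _).trans ?_
  calc _ ≤ ∑ _i : Fin d, (L : ℝ) := Finset.sum_le_sum fun i _ => by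
        simpa using norm_lineDeriv_le_of_lipschitz ℝ (v := EuclideanSpace.single i (1 : ℝ)) (x₀ := x)
          (lipschitzWith_apply hF i)
    _ = _ := by simp

lemma measurable_divergence {F : E d → E d} {L : ℝ≥0} (hF : LipschitzWith L F) :
    Measurable (divergence F) :=
  Finset.measurable_fun_sum _ fun i _ => measurable_lineDeriv (lipschitzWith_apply hF i).continuous

/-- Integration by parts for Lipschitz functions, coordinate by coordinate; the line derivatives
exist almost everywhere and are bounded. -/
lemma integral_inner_lipschitz_gradient {F : E d → E d} {L : ℝ≥0} (hF : LipschitzWith L F)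
    {w : E d → ℝ} (hw : ContDiff ℝ 1 w) (hs : HasCompactSupport w) :
    ∫ x, inner ℝ (F x) (gradient w x) = -∫ x, divergence F x * w x := by
  obtain ⟨D, hD⟩ := hw.lipschitzWith_of_hasCompactSupport hs one_ne_zero
  have hl : ∀ (i : Fin d) x, lineDeriv ℝ w x (EuclideanSpace.single i 1) = gradient w x i := by
    intro i x
    rw [(hw.differentiable one_ne_zero x).lineDeriv_eq_fderiv]
    have := inner_gradient (w := w) x (EuclideanSpace.single i 1)
    rw [← this, EuclideanSpace.inner_single_right]
    simp
  have hgi : ∀ i : Fin d, Continuous fun x => gradient w x i := fun i =>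
    (EuclideanSpace.proj (𝕜 := ℝ) i).continuous.comp (continuous_gradient hw)
  have hgs : ∀ i : Fin d, HasCompactSupport fun x => gradient w x i := fun i =>
    (hasCompactSupport_gradient hs).comp_left (g := fun v : E d => v i) rfl
  have h1 : ∀ x, (inner ℝ (F x) (gradient w x) : ℝ) = ∑ i, gradient w x i * F x i := fun x => by
    rw [PiLp.inner_apply]
    rfl
  simp_rw [h1, divergence, Finset.sum_mul]
  rw [integral_finsetSum, integral_finsetSum, ← Finset.sum_neg_distrib]
  · refine Finset.sum_congr rfl fun i _ => ?_
    rw [(lipschitzWith_apply hF i).integral_lineDeriv_mul_eq hD hs, ← integral_neg]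
    refine integral_congr_ae (ae_of_all _ fun x => ?_)
    simp only [lineDeriv_neg, hl, neg_mul, neg_neg]
  · intro i _
    have hm : Measurable fun x => lineDeriv ℝ (fun y => F y i) x (EuclideanSpace.single i 1) :=
      measurable_lineDeriv (lipschitzWith_apply hF i).continuous
    refine (hw.continuous.integrable_of_hasCompactSupport hs).bdd_mul (c := L)
      hm.aestronglyMeasurable (ae_of_all _ fun x => ?_)
    simpa using norm_lineDeriv_le_of_lipschitz ℝ (v := EuclideanSpace.single i (1 : ℝ)) (x₀ := x)
      (lipschitzWith_apply hF i)
  · intro i _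
    exact ((hgi i).mul (lipschitzWith_apply hF i).continuous).integrable_of_hasCompactSupport
      (hgs i).mul_right

end LipschitzField

/-! ### Weak solutions as drift-diffusion systems -/

section Solution

variable {d : ℕ} {φ n₀ : E d → ℝ} {n : ℝ → E d → ℝ} {Dn Dc : ℝ → E d → E d}

/-- The total drift `∇c + ∇φ`. -/
noncomputable def drift (φ : E d → ℝ) (n : ℝ → E d → ℝ) (p : ℝ × E d) : E d :=
  field (n p.1) p.2 + gradient φ p.2

lemma isFiniteMeasure_box (a b R : ℝ) : IsFiniteMeasure
    ((volume : Measure (ℝ × E d)).restrict (Ioo a b ×ˢ Metric.ball (0 : E d) R)) := by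
  refine ⟨?_⟩
  rw [Measure.restrict_apply_univ, Measure.volume_eq_prod, Measure.prod_prod]
  exact ENNReal.mul_lt_top (by simp) measure_ball_lt_top

lemma eLpNorm_one_eq_ofReal {f : E d → ℝ} (hf : Integrable f) :
    eLpNorm f 1 volume = ENNReal.ofReal (∫ x, |f x|) := by
  rw [eLpNorm_one_eq_lintegral_enorm]
  exact (ofReal_integral_norm_eq_lintegral_enorm hf).symm

namespace IsWeakSolutionWith

lemma tendsto_integral_abs_sub (H : IsWeakSolutionWith φ n₀ n Dn Dc) {t : ℝ} (ht : 0 ≤ t) :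
    Tendsto (fun s => ∫ x, |n s x - n t x|) (𝓝[Ici 0] t) (𝓝 0) := by
  have h := (ENNReal.tendsto_toReal ENNReal.zero_ne_top).comp (H.continuous_L1 t ht)
  rw [ENNReal.toReal_zero] at h
  refine h.congr' ?_
  filter_upwards [self_mem_nhdsWithin] with s hs
  have := eLpNorm_one_eq_ofReal ((H.integrable s hs).sub (H.integrable t ht))
  simp only [Pi.sub_apply] at this
  simp only [Function.comp_apply]
  rw [show (fun x => n s x - n t x) = n s - n t from rfl, this,
    ENNReal.toReal_ofReal (integral_nonneg fun x => abs_nonneg _)]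

/-- Continuity into `L¹` makes the norm a continuous function of time, bounded on compact intervals.
-/
lemma exists_eLpNorm_one_le (H : IsWeakSolutionWith φ n₀ n Dn Dc) (b : ℝ) :
    ∃ A : ℝ≥0, ∀ t ∈ Icc 0 b, eLpNorm (n t) 1 volume ≤ A := by
  have hc : ContinuousOn (fun t => ∫ x, |n t x|) (Icc 0 b) := by
    intro t ht
    have h1 := (H.tendsto_integral_abs_sub ht.1).mono_left
      (nhdsWithin_mono t (fun u (hu : u ∈ Icc 0 b) => hu.1))
    refine tendsto_iff_norm_sub_tendsto_zero.2
      (squeeze_zero' (Eventually.of_forall fun s => norm_nonneg _) ?_ h1)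
    filter_upwards [self_mem_nhdsWithin] with s hs
    have i1 := H.integrable s hs.1
    have i2 := H.integrable t ht.1
    rw [← integral_sub i1.abs i2.abs]
    refine (norm_integral_le_integral_norm _).trans ?_
    exact integral_mono (i1.abs.sub i2.abs).norm (i1.sub i2).abs
      fun x => abs_abs_sub_abs_le (n s x) (n t x)
  obtain ⟨A, hA⟩ := isCompact_Icc.exists_bound_of_continuousOn hc
  refine ⟨A.toNNReal, fun t ht => ?_⟩
  rw [eLpNorm_one_eq_ofReal (H.integrable t ht.1)]
  exact ENNReal.ofReal_le_ofReal ((le_abs_self _).trans (hA t ht))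

lemma aestronglyMeasurable_slab (H : IsWeakSolutionWith φ n₀ n Dn Dc) {a b : ℝ} (ha : 0 < a) :
    AEStronglyMeasurable (fun p : ℝ × E d => n p.1 p.2) (volume.restrict (Ioo a b ×ˢ univ)) :=
  H.measurable.mono_measure (Measure.restrict_mono
    (prod_mono_left fun _ ht => ha.trans ht.1) le_rfl)

lemma aestronglyMeasurable_drift (H : IsWeakSolutionWith φ n₀ n Dn Dc)
    {L : ℝ≥0} (hL : LipschitzWith L (gradient φ)) :
    AEStronglyMeasurable (drift φ n) (volume.restrict (Ioi 0 ×ˢ univ)) :=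
  (aestronglyMeasurable_field_slab H.measurable).add
    (hL.continuous.comp continuous_snd).aestronglyMeasurable

lemma memLp_two_slab (H : IsWeakSolutionWith φ n₀ n Dn Dc) {a b : ℝ} (ha : 0 < a) (hab : a < b) :
    MemLp (fun p : ℝ × E d => n p.1 p.2) 2 (volume.restrict (Ioo a b ×ˢ univ)) := by
  obtain ⟨A, hA⟩ := H.bounded_L2 a b ha hab
  refine memLp_slab (q := 2) two_ne_zero (H.aestronglyMeasurable_slab ha) (A := A) ?_
  filter_upwards [ae_restrict_mem measurableSet_Ioo] with t ht
  exact hA t (Ioo_subset_Icc_self ht)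

lemma integrableOn_slab (H : IsWeakSolutionWith φ n₀ n Dn Dc) {a b : ℝ} (ha : 0 < a) :
    IntegrableOn (fun p : ℝ × E d => n p.1 p.2) (Ioo a b ×ˢ univ) := by
  obtain ⟨A, hA⟩ := H.exists_eLpNorm_one_le b
  refine memLp_one_iff_integrable.1
    (memLp_slab (q := 1) one_ne_zero (H.aestronglyMeasurable_slab ha) (A := A) ?_)
  filter_upwards [ae_restrict_mem measurableSet_Ioo] with t ht
  exact hA t ⟨(ha.trans ht.1).le, ht.2.le⟩

/-- The singular part of the field is in `L²` by Young, the outer part is bounded by the mass, and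
the Lipschitz gradient `∇φ` grows at most linearly. -/
lemma exists_norm_drift_le (H : IsWeakSolutionWith φ n₀ n Dn Dc) (hd : d = 2 ∨ d = 3)
    {L : ℝ≥0} (hL : LipschitzWith L (gradient φ)) {a b : ℝ} (ha : 0 < a) (hab : a < b) :
    ∃ (P : ℝ × E d → ℝ) (C₀ : ℝ), 0 ≤ C₀ ∧ MemLp P 2 (volume.restrict (Ioo a b ×ˢ univ)) ∧
      ∀ p, ‖drift φ n p‖ ≤ P p + C₀ * (1 + ‖p.2‖) := by
  obtain ⟨A, hA⟩ := H.exists_eLpNorm_one_le b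
  obtain ⟨A₂, hA₂⟩ := H.bounded_L2 a b ha hab
  have hω : 0 ≤ (sphereArea d)⁻¹ := inv_nonneg.2 (sphereArea_pos d).le
  set C₁ : ℝ := (sphereArea d)⁻¹ * A with hC₁
  have hC₁0 : 0 ≤ C₁ := by positivity
  -- `P` is the excess of the field over the bound `C₁` for its outer part, hence is dominated by
  -- the convolution with the singular part.
  refine ⟨fun p => max (‖field (n p.1) p.2‖ - C₁) 0, C₁ + ‖gradient φ 0‖ + L, by positivity,
    ?_, fun p => ?_⟩
  · have hm : AEStronglyMeasurable (fun p : ℝ × E d => max (‖field (n p.1) p.2‖ - C₁) 0)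
        (volume.restrict (Ioo a b ×ˢ univ)) :=
      ((aestronglyMeasurable_field_slab (H.aestronglyMeasurable_slab ha)).norm.sub
        aestronglyMeasurable_const).sup aestronglyMeasurable_const
    have hk := lintegral_kernIn_lt_top hd
    refine memLp_slab (q := 2) two_ne_zero hm (A := ((∫⁻ x, kernIn d x) * A₂).toNNReal) ?_
    filter_upwards [ae_restrict_mem measurableSet_Ioo] with t ht
    have ht0 : 0 < t := ha.trans ht.1
    have hnm := (H.integrable t ht0.le).1
    rw [ENNReal.coe_toNNReal (ENNReal.mul_lt_top hk (by simp)).ne]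
    calc _ ≤ eLpNorm (fun x => ∫⁻ y, kernIn d (x - y) * ‖n t y‖ₑ) 2 volume := by
          refine eLpNorm_mono_enorm fun x => ?_
          rw [Real.enorm_of_nonneg (le_max_right _ _), enorm_eq_self]
          have h1 := enorm_field_le hnm x
          have h2 := lintegral_kernOut_le hd (n t) x
          have h3 : ENNReal.ofReal (sphereArea d)⁻¹ * eLpNorm (n t) 1 volume ≤
              ENNReal.ofReal C₁ := by
            rw [hC₁, ENNReal.ofReal_mul hω, ENNReal.ofReal_coe_nnreal]
            gcongr
            exact hA t ⟨ht0.le, ht.2.le⟩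
          rw [ENNReal.ofReal_max, ENNReal.ofReal_zero, max_eq_left zero_le,
            ENNReal.ofReal_sub _ hC₁0, ofReal_norm, tsub_le_iff_right]
          exact h1.trans (by gcongr; exact h2.trans h3)
      _ ≤ (∫⁻ x, kernIn d x) * eLpNorm (n t) 2 volume := eLpNorm_kernIn_conv_le hnm (by norm_num)
      _ ≤ _ := by gcongr; exact hA₂ t (Ioo_subset_Icc_self ht)
  · have h1 : ‖gradient φ p.2‖ ≤ ‖gradient φ 0‖ + L * ‖p.2‖ := by
      have := hL.norm_sub_le p.2 0
      rw [sub_zero] at this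
      have h2 := norm_le_norm_add_norm_sub' (gradient φ p.2) (gradient φ 0)
      linarith
    have h2 : ‖field (n p.1) p.2‖ ≤ max (‖field (n p.1) p.2‖ - C₁) 0 + C₁ := by
      linarith [le_max_left (‖field (n p.1) p.2‖ - C₁) 0]
    have h3 : 0 ≤ (C₁ + ‖gradient φ 0‖) * ‖p.2‖ := by positivity
    have h4 : (0 : ℝ) ≤ L := L.2
    calc _ ≤ ‖field (n p.1) p.2‖ + ‖gradient φ p.2‖ := norm_add_le _ _
      _ ≤ _ := by
        simp only
        nlinarith

/-- By uniqueness, `Dc t` is the field for almost every `t`. The identity is stated after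
multiplication by `n`, since joint measurability is given for `n • Dc` but not for `Dc`. -/
lemma smul_field_ae_eq (H : IsWeakSolutionWith φ n₀ n Dn Dc) (hd : d = 2 ∨ d = 3) :
    (fun p : ℝ × E d => n p.1 p.2 • Dc p.1 p.2) =ᵐ[volume.restrict (Ioi 0 ×ˢ univ)]
      fun p => n p.1 p.2 • field (n p.1) p.2 := by
  refine ae_slab_of_forall_slice H.drift_integrable.aestronglyMeasurable
    (H.measurable.smul (aestronglyMeasurable_field_slab H.measurable)) ?_
  filter_upwards [H.gradient_c, ae_restrict_mem measurableSet_Ioi] with t h1 ht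
  have h2 := isWeakGradient_field hd (H.integrable t (le_of_lt ht)) (H.potential_c t ht)
  filter_upwards [h1.ae_eq h2] with x hx
  simp only [hx]

/-- The divergence of the drift is that of `∇φ` minus `n`, by the Poisson equation
`integral_inner_field_gradient`. This is where the absorption term enters. -/
theorem driftSystem (H : IsWeakSolutionWith φ n₀ n Dn Dc) (hd : d = 2 ∨ d = 3)
    {L : ℝ≥0} (hL : LipschitzWith L (gradient φ)) :
    DriftSystem (fun p => n p.1 p.2) (fun p => Dn p.1 p.2) (drift φ n)
      (fun p => divergence (gradient φ) p.2 - n p.1 p.2) where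
  n_L2 a b ha hab := H.memLp_two_slab ha hab
  Dn_L2 := H.gradient_L2
  B_L2 a b R ha hab := by
    obtain ⟨P, C₀, hC₀, hP, hB⟩ := H.exists_norm_drift_le hd hL ha hab
    have hsub : Ioo a b ×ˢ Metric.ball (0 : E d) R ⊆ Ioo a b ×ˢ univ :=
      prod_mono_right (subset_univ _)
    have := isFiniteMeasure_box (d := d) a b R
    have h1 : MemLp (fun p : ℝ × E d => P p + C₀ * (1 + R)) 2
        (volume.restrict (Ioo a b ×ˢ Metric.ball (0 : E d) R)) :=
      (hP.mono_measure (Measure.restrict_mono hsub le_rfl)).add (memLp_const _)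
    refine h1.mono ((H.aestronglyMeasurable_drift hL).mono_measure (Measure.restrict_mono
      (prod_mono (fun t ht => ha.trans ht.1) (subset_univ _)) le_rfl)) ?_
    filter_upwards [ae_restrict_mem (measurableSet_Ioo.prod measurableSet_ball)] with p hp
    have hR : ‖p.2‖ ≤ R := by simpa using (Metric.mem_ball.1 hp.2).le
    refine ((hB p).trans ?_).trans (le_abs_self _)
    gcongr
  D_L2 a b R ha hab := by
    have hsub : Ioo a b ×ˢ Metric.ball (0 : E d) R ⊆ Ioo a b ×ˢ univ :=
      prod_mono_right (subset_univ _)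
    have := isFiniteMeasure_box (d := d) a b R
    refine MemLp.sub (MemLp.of_bound
      ((measurable_divergence hL).comp measurable_snd).aestronglyMeasurable (d * L)
      (ae_of_all _ fun p => abs_divergence_le hL p.2))
      ((H.memLp_two_slab ha hab).mono_measure (Measure.restrict_mono hsub le_rfl))
  weak_grad := H.gradient_n
  div := by
    filter_upwards [ae_restrict_mem measurableSet_Ioi] with t ht w hw hs
    have hn := H.integrable t (le_of_lt ht)
    have hgc := continuous_gradient hw
    have hgs := hasCompactSupport_gradient hs
    have hfl : LocallyIntegrable (field (n t)) :=
      (isWeakGradient_field hd hn (H.potential_c t ht)).2.1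
    have i1 : Integrable (fun x => (inner ℝ (field (n t) x) (gradient w x) : ℝ)) := by
      obtain ⟨A, hA⟩ := hgc.bounded_above_of_compact_support hgs
      refine (integrableOn_iff_integrable_of_support_subset (s := tsupport (gradient w))
        fun x hx => ?_).1 (((hfl.integrableOn_isCompact hgs).norm.mul_const A).mono'
          (hfl.aestronglyMeasurable.restrict.inner hgc.aestronglyMeasurable)
          (ae_of_all _ fun x => (norm_inner_le_norm _ _).trans (by gcongr; exact hA x)))
      by_contra h
      exact hx (by simp [image_eq_zero_of_notMem_tsupport h])
    have i2 : Integrable (fun x => (inner ℝ (gradient φ x) (gradient w x) : ℝ)) := by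
      refine (hL.continuous.inner hgc).integrable_of_hasCompactSupport ?_
      exact hgs.mono fun x hx h => hx (by simp [h])
    have i3 : Integrable (fun x => n t x * w x) := by
      obtain ⟨A, hA⟩ := hw.continuous.bounded_above_of_compact_support hs
      exact hn.mul_bdd (c := A) hw.continuous.aestronglyMeasurable (ae_of_all _ hA)
    have i4 : Integrable (fun x => divergence (gradient φ) x * w x) :=
      (hw.continuous.integrable_of_hasCompactSupport hs).bdd_mul (c := d * L)
        (measurable_divergence hL).aestronglyMeasurable
        (ae_of_all _ fun x => abs_divergence_le hL x)
    simp_rw [drift, inner_add_left, sub_mul]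
    rw [integral_add i1 i2, integral_sub i4 i3, integral_inner_field_gradient hd hn hw hs,
      integral_inner_lipschitz_gradient hL hw hs]
    ring
  eqn ψ hψ hs hsΩ := by
    have hd' := hψ.differentiable (by simp)
    have h := H.equation ψ hψ hs hsΩ
    have e1 : ∀ p : ℝ × E d, deriv (fun s => ψ (s, p.2)) p.1 = fderiv ℝ ψ p (dirT d) := fun p =>
      ((hd' p).hasFDerivAt.comp_hasDerivAt p.1
        ((hasDerivAt_id p.1).prodMk (hasDerivAt_const p.1 p.2))).deriv
    simp_rw [e1] at h
    rw [h]
    refine integral_congr_ae ?_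
    have hm : MeasurableSet (Ioi (0 : ℝ) ×ˢ (univ : Set (E d))) :=
      measurableSet_Ioi.prod MeasurableSet.univ
    filter_upwards [(ae_restrict_iff' hm).1 (H.smul_field_ae_eq hd)] with p hp
    change inner ℝ _ (gradX ψ p) = _
    by_cases hpΩ : p ∈ Ioi (0 : ℝ) ×ˢ (univ : Set (E d))
    · rw [add_assoc, hp hpΩ, drift, smul_add]
    · rw [gradX_eq_zero hd' fun h => hpΩ (hsΩ h), inner_zero_right, inner_zero_right]

end IsWeakSolutionWith

end Solution

/-! ### Mass, the barrier and uniform bounds on the field -/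

section Comparison

variable {d : ℕ} {φ n₀ : E d → ℝ} {n : ℝ → E d → ℝ} {Dn Dc : ℝ → E d → E d}

namespace IsWeakSolutionWith

lemma ae_nonneg_slab (H : IsWeakSolutionWith φ n₀ n Dn Dc) :
    ∀ᵐ p ∂(volume.restrict (Ioi (0 : ℝ) ×ˢ (univ : Set (E d)))), 0 ≤ n p.1 p.2 := by
  have h := ae_slab_of_forall_slice (f := fun p : ℝ × E d => n p.1 p.2)
    (g := fun p => |n p.1 p.2|) H.measurable H.measurable.norm (by
      filter_upwards [ae_restrict_mem measurableSet_Ioi] with t ht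
      filter_upwards [H.nonneg t (le_of_lt ht)] with x hx
      exact (abs_of_nonneg hx).symm)
  filter_upwards [h] with p hp
  rw [hp]
  exact abs_nonneg _

lemma integrable_comp (H : IsWeakSolutionWith φ n₀ n Dn Dc) {β : ℝ → ℝ} (hβ : Continuous β)
    {s u : ℝ} (hs : 0 ≤ s) (hb : ∀ v, 0 ≤ v → |β (v - u)| ≤ v) :
    Integrable (fun x => β (n s x - u)) := by
  refine (H.integrable s hs).mono' (hβ.comp_aestronglyMeasurable
    ((H.integrable s hs).1.sub aestronglyMeasurable_const)) ?_
  filter_upwards [H.nonneg s hs] with x hx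
  exact hb _ hx

/-- The two time dependences are separated: with `n` frozen the barrier moves and domination by `n`
applies; changing `n` costs at most its `L¹` increment, as `β` is `1`-Lipschitz. -/
lemma continuousOn_integral_comp (H : IsWeakSolutionWith φ n₀ n Dn Dc) {β U : ℝ → ℝ}
    (hβ : ∀ s t, |β s - β t| ≤ |s - t|) (hU : ContinuousOn U (Ioi 0))
    (hb : ∀ t, 0 < t → ∀ v, 0 ≤ v → |β (v - U t)| ≤ v) :
    ContinuousOn (fun t => ∫ x, β (n t x - U t)) (Ioi 0) := by
  have hβc : Continuous β := (LipschitzWith.of_dist_le_mul (K := 1)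
    fun s t => by simpa [Real.dist_eq] using hβ s t).continuous
  intro t ht
  have ht0 : 0 < t := ht
  have h1 : Tendsto (fun s => ∫ x, β (n t x - U s)) (𝓝[Ioi 0] t) (𝓝 (∫ x, β (n t x - U t))) := by
    refine tendsto_integral_filter_of_dominated_convergence (n t) ?_ ?_
      (H.integrable t ht0.le) ?_
    · filter_upwards with s
      exact hβc.comp_aestronglyMeasurable ((H.integrable t ht0.le).1.sub aestronglyMeasurable_const)
    · filter_upwards [self_mem_nhdsWithin] with s hs
      filter_upwards [H.nonneg t ht0.le] with x hx
      exact hb s hs _ hx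
    · refine ae_of_all _ fun x => ?_
      exact (hβc.tendsto _).comp (tendsto_const_nhds.sub (hU t ht))
  have h2 : Tendsto (fun s => (∫ x, β (n s x - U s)) - ∫ x, β (n t x - U s)) (𝓝[Ioi 0] t)
      (𝓝 0) := by
    refine squeeze_zero_norm' ?_ ((H.tendsto_integral_abs_sub ht0.le).mono_left
      (nhdsWithin_mono t Ioi_subset_Ici_self))
    filter_upwards [self_mem_nhdsWithin] with s hs
    have i1 := H.integrable_comp hβc (le_of_lt hs) (hb s hs)
    have i2 := H.integrable_comp hβc ht0.le (hb s hs)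
    rw [← integral_sub i1 i2]
    refine (norm_integral_le_integral_norm _).trans (integral_mono (i1.sub i2).norm
      ((H.integrable s (le_of_lt hs)).sub (H.integrable t ht0.le)).abs fun x => ?_)
    simpa using hβ (n s x - U s) (n t x - U s)
  have := h2.add h1
  simpa [ContinuousWithinAt] using this

/-- Kato's inequality without cutoffs, integrated in time. In `hsign`, `v` stands for the density
and `D` for the divergence of the drift, so that `D + v` is the divergence of `∇φ`, bounded by `d
L`. -/
theorem antitoneOn_integral_comp (H : IsWeakSolutionWith φ n₀ n Dn Dc) (hd : d = 2 ∨ d = 3)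
    {L : ℝ≥0} (hL : LipschitzWith L (gradient φ)) {β β' β'' : ℝ → ℝ}
    (hβ : ∀ s, HasDerivAt β (β' s) s) (hβ' : ∀ s, HasDerivAt β' (β'' s) s)
    (hβc : Continuous β'') (hβ0 : ∀ s, 0 ≤ β'' s) (hC : ∀ s, |β' s| ≤ 1) {U U' : ℝ → ℝ}
    (hU : ∀ t, 0 < t → HasDerivAt U (U' t) t) (hU' : ContinuousOn U' (Ioi 0))
    (hb : ∀ t, 0 < t → ∀ v, 0 ≤ v → |β (v - U t)| ≤ v)
    (hsign : ∀ t, 0 < t → ∀ v, 0 ≤ v → ∀ D : ℝ, |D + v| ≤ (d : ℝ) * (L : ℝ) →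
      0 ≤ β' (v - U t) * (U' t - v * D) + β (v - U t) * D) :
    AntitoneOn (fun t => ∫ x, β (n t x - U t)) (Ioi 0) := by
  have hlip : ∀ s t, |β s - β t| ≤ |s - t| := by
    intro s t
    have := Convex.norm_image_sub_le_of_norm_hasDerivWithin_le (f := β) (f' := β')
      (s := univ) (C := 1) (fun x _ => (hβ x).hasDerivWithinAt) (fun x _ => hC x)
      convex_univ (mem_univ t) (mem_univ s)
    simpa using this
  refine antitoneOn_of_integral_mul_deriv_nonneg (H.continuousOn_integral_comp hlip
    (fun t ht => (hU t ht).continuousAt.continuousWithinAt) hb)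
    fun a b ha hab η hη hηs hη0 hηab => ?_
  obtain ⟨P, C₀, hC₀, hP, hB⟩ := H.exists_norm_drift_le hd hL ha hab
  have hsub : Ioo a b ×ˢ (univ : Set (E d)) ⊆ Ioi (0 : ℝ) ×ˢ (univ : Set (E d)) :=
    prod_mono_left fun t ht => ha.trans ht.1
  refine (H.driftSystem hd hL).integral_mul_deriv_nonneg hβ hβ' hβc hβ0 (C := 1) (by simpa using hC)
    hU hU' ?_ ha hab hP ((H.aestronglyMeasurable_drift hL).mono_measure
      (Measure.restrict_mono hsub le_rfl)) hC₀ (ae_of_all _ hB) (H.integrableOn_slab ha) ?_ hη hηs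
      hη0 hηab
  · filter_upwards [H.ae_nonneg_slab, ae_restrict_mem (measurableSet_Ioi.prod MeasurableSet.univ)]
      with p hp hp0
    refine hsign p.1 hp0.1 _ hp _ ?_
    rw [sub_add_cancel]
    exact abs_divergence_le hL _
  · filter_upwards [ae_restrict_of_ae_restrict_of_subset hsub H.ae_nonneg_slab,
      ae_restrict_mem (measurableSet_Ioo.prod MeasurableSet.univ)] with p hp hp0
    exact (hb p.1 (ha.trans hp0.1.1) _ hp).trans (le_abs_self _)

/-- The mass does not increase. -/
theorem integral_le_of_le (H : IsWeakSolutionWith φ n₀ n Dn Dc) (hd : d = 2 ∨ d = 3)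
    {L : ℝ≥0} (hL : LipschitzWith L (gradient φ)) {s t : ℝ} (hs : 0 < s) (hst : s ≤ t) :
    ∫ x, n t x ≤ ∫ x, n s x := by
  -- For the identity and zero barrier the expression in the sign condition vanishes identically.
  have := H.antitoneOn_integral_comp hd hL (β := fun s => s) (β' := fun _ => 1) (β'' := fun _ => 0)
    (U := fun _ => 0) (U' := fun _ => 0) (fun s => hasDerivAt_id s)
    (fun s => hasDerivAt_const s 1) continuous_const (fun _ => le_rfl) (by simp)
    (fun t _ => hasDerivAt_const t 0) continuousOn_const
    (fun t _ v hv => by simp [abs_of_nonneg hv]) (fun t _ v hv D _ => by simp)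
    (mem_Ioi.2 hs) (mem_Ioi.2 (hs.trans_le hst)) hst
  simpa using this

/-- The instantaneous `L^∞` bound. -/
theorem ae_le_barrier (H : IsWeakSolutionWith φ n₀ n Dn Dc) (hd : d = 2 ∨ d = 3)
    {L : ℝ≥0} (hL : LipschitzWith L (gradient φ)) {t : ℝ} (ht : 0 < t) :
    ∀ᵐ x, n t x ≤ d * L + t⁻¹ := by
  set K : ℝ := d * L with hK
  have hK0 : 0 ≤ K := by positivity
  set U : ℝ → ℝ := fun t => K + t⁻¹ with hUdef
  have hU0 : ∀ t, 0 < t → 0 ≤ U t := fun t ht => by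
    have : 0 < t⁻¹ := inv_pos.2 ht
    simp only [hUdef]; linarith
  have hb : ∀ t, 0 < t → ∀ v, 0 ≤ v → |smoothPos (v - U t)| ≤ v := fun t ht v hv => by
    rw [abs_of_nonneg (smoothPos_nonneg _)]
    exact (smoothPos_le _).trans (max_le (by linarith [hU0 t ht]) hv)
  have hanti : AntitoneOn (fun t => ∫ x, smoothPos (n t x - U t)) (Ioi 0) := by
    refine H.antitoneOn_integral_comp hd hL hasDerivAt_smoothPos hasDerivAt_smoothPos'
      continuous_smoothPos'' smoothPos''_nonneg (fun s => by
        rw [abs_of_nonneg (smoothPos'_nonneg s)]; exact smoothPos'_le_one s)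
      (U' := fun t => -(t ^ 2)⁻¹) (fun t ht => (hasDerivAt_inv ht.ne').const_add K) ?_ hb ?_
    · exact ((continuousOn_id.pow 2).inv₀ fun t ht => pow_ne_zero 2 (ne_of_gt ht)).neg
    · intro t ht v hv D hD
      rcases le_or_gt (v - U t) 0 with hs | hs
      · rw [smoothPos_of_nonpos hs, smoothPos'_eq, max_eq_right hs]
        simp
      · have h1 : D ≤ K - v := by linarith [(abs_le.1 hD).2]
        have hti : 0 < t⁻¹ := inv_pos.2 ht
        have hU : U t = K + t⁻¹ := rfl
        have h2 : D ≤ 0 := by linarith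
        -- Above the barrier `D ≤ K - v < -1/t`. Multiplying `β(s) ≤ s β'(s)` by `D ≤ 0` reduces the
        -- sign condition to `U' - U D ≥ 0`, which holds because `U D ≤ -K/t - 1/t²` and `U' =
        -- -1/t²`.
        have h3 : (v - U t) * smoothPos' (v - U t) * D ≤ smoothPos (v - U t) * D :=
          mul_le_mul_of_nonpos_right (smoothPos_le_mul_smoothPos' _) h2
        have h4 : 0 ≤ -(t ^ 2)⁻¹ - U t * D := by
          have h5 : U t * D ≤ U t * (-t⁻¹) :=
            mul_le_mul_of_nonneg_left (by linarith) (hU0 t ht)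
          have h6 : U t * (-t⁻¹) = -(K * t⁻¹) - (t ^ 2)⁻¹ := by
            rw [hU, ← inv_pow]; ring
          have h7 : 0 ≤ K * t⁻¹ := by positivity
          linarith
        have h5 := mul_nonneg (smoothPos'_nonneg (v - U t)) h4
        linarith
  have hint : ∀ s, 0 ≤ s → ∀ r, 0 < r → Integrable (fun x => smoothPos (n s x - U r)) :=
    fun s hs r hr => H.integrable_comp (continuous_iff_continuousAt.2 fun s =>
      (hasDerivAt_smoothPos s).continuousAt) hs (hb r hr)
  -- Near time zero `n s` is replaced by `n 0` up to an `L¹` error, and the barrier tends to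
  -- infinity, so the positive part vanishes pointwise under the majorant `n 0`.
  have hlim : Tendsto (fun s => (∫ x, |n s x - n 0 x|) + ∫ x, smoothPos (n 0 x - U s))
      (𝓝[>] 0) (𝓝 0) := by
    have h1 := (H.tendsto_integral_abs_sub le_rfl).mono_left
      (nhdsWithin_mono 0 Ioi_subset_Ici_self)
    have h2 : Tendsto (fun s => ∫ x, smoothPos (n 0 x - U s)) (𝓝[>] 0) (𝓝 (∫ _x : E d, 0)) := by
      refine tendsto_integral_filter_of_dominated_convergence (n 0) ?_ ?_
        (H.integrable 0 le_rfl) ?_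
      · filter_upwards [self_mem_nhdsWithin] with s hs
        exact (hint 0 le_rfl s hs).1
      · filter_upwards [self_mem_nhdsWithin] with s hs
        filter_upwards [H.nonneg 0 le_rfl] with x hx
        exact hb s hs _ hx
      · refine ae_of_all _ fun x => tendsto_const_nhds.congr' ?_
        filter_upwards [tendsto_inv_nhdsGT_zero.eventually_ge_atTop (n 0 x)] with s hs
        rw [smoothPos_of_nonpos]
        simp only [hUdef]; linarith
    simpa using h1.add h2
  have hzero : ∫ x, smoothPos (n t x - U t) ≤ 0 := by
    refine ge_of_tendsto hlim ?_
    filter_upwards [Ioo_mem_nhdsGT ht] with s hs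
    refine (hanti (mem_Ioi.2 hs.1) (mem_Ioi.2 ht) hs.2.le).trans ?_
    have i0 := ((H.integrable s hs.1.le).sub (H.integrable 0 le_rfl)).abs
    simp only [Pi.sub_apply] at i0
    rw [← integral_add i0 (hint 0 le_rfl s hs.1)]
    refine integral_mono (hint s hs.1.le s hs.1) (i0.add (hint 0 le_rfl s hs.1)) fun x => ?_
    have := (abs_le.1 (abs_smoothPos_sub_le (n s x - U s) (n 0 x - U s))).2
    rw [sub_sub_sub_cancel_right] at this
    linarith
  have h0 := (integral_eq_zero_iff_of_nonneg (fun x => smoothPos_nonneg _) (hint t ht.le t ht)).1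
    (le_antisymm hzero (integral_nonneg fun x => smoothPos_nonneg _))
  filter_upwards [h0] with x hx
  by_contra hlt
  exact (smoothPos_pos (sub_pos.2 (not_le.1 hlt))).ne' hx

/-- Uniform bounds on the field for times `t ≥ 1`. -/
theorem exists_eLpNorm_field_le (H : IsWeakSolutionWith φ n₀ n Dn Dc) (hd : d = 2 ∨ d = 3)
    {L : ℝ≥0} (hL : LipschitzWith L (gradient φ)) {q₀ : ℝ≥0∞} (hq₀ : 1 ≤ q₀) (hq₀t : q₀ ≠ ⊤)
    (hq : (d : ℝ) < (d - 1) * q₀.toReal) :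
    ∃ C : ℝ≥0, 0 < C ∧ ∀ t, 1 ≤ t → ∀ q, q₀ ≤ q → eLpNorm (field (n t)) q volume ≤ C := by
  set A : ℝ≥0∞ := ENNReal.ofReal (∫ x, n 1 x) with hA
  set S : ℝ≥0∞ := ENNReal.ofReal (d * L + 1) with hS
  set k : ℝ≥0∞ := ∫⁻ x, kernIn d x with hk
  have hkt : k < ⊤ := lintegral_kernIn_lt_top hd
  have hq₀0 : q₀ ≠ 0 := (one_pos.trans_le hq₀).ne'
  have hout := eLpNorm_kernOut_lt_top hd hq₀0 hq₀t hq
  have houtt : eLpNorm (kernOut d) ⊤ volume < ⊤ :=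
    (eLpNorm_kernOut_top_le hd).trans_lt ENNReal.ofReal_lt_top
  set T : ℝ≥0∞ := k * max A S + max (eLpNorm (kernOut d) q₀ volume)
    (eLpNorm (kernOut d) ⊤ volume) * A with hT
  have hTt : T < ⊤ := ENNReal.add_lt_top.2
    ⟨ENNReal.mul_lt_top hkt (max_lt ENNReal.ofReal_lt_top ENNReal.ofReal_lt_top),
      ENNReal.mul_lt_top (max_lt hout houtt) ENNReal.ofReal_lt_top⟩
  -- The added `1` only ensures that the constant is positive.
  refine ⟨T.toNNReal + 1, by positivity, fun t ht q hq => ?_⟩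
  have ht0 : 0 < t := one_pos.trans_le ht
  have hn := H.integrable t ht0.le
  have n1 : eLpNorm (n t) 1 volume ≤ A := by
    rw [eLpNorm_one_eq_ofReal hn]
    refine ENNReal.ofReal_le_ofReal ((integral_congr_ae ?_).trans_le
      (H.integral_le_of_le hd hL one_pos ht))
    filter_upwards [H.nonneg t ht0.le] with x hx
    exact abs_of_nonneg hx
  have nt : eLpNorm (n t) ⊤ volume ≤ S := by
    rw [eLpNorm_exponent_top]
    refine eLpNormEssSup_le_of_ae_bound ?_
    filter_upwards [H.nonneg t ht0.le, H.ae_le_barrier hd hL ht0] with x hx hx'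
    rw [Real.norm_of_nonneg hx]
    have : t⁻¹ ≤ 1 := inv_le_one_of_one_le₀ ht
    linarith
  -- Interpolation between the mass at time `1` and the barrier, which is at most `d L + 1` for `t ≥
  -- 1`.
  have nq : eLpNorm (n t) q₀ volume ≤ max A S :=
    (eLpNorm_le_max hn.1 one_ne_zero hq₀).trans (max_le_max n1 nt)
  have f0 : eLpNorm (field (n t)) q₀ volume ≤ T := (eLpNorm_field_le hn.1 hq₀).trans (by
    rw [hT]
    gcongr
    exact le_max_left _ _)
  have ft : eLpNorm (field (n t)) ⊤ volume ≤ T := (eLpNorm_field_le hn.1 le_top).trans (by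
    rw [hT]
    gcongr
    · exact nt.trans (le_max_right _ _)
    · exact le_max_right _ _)
  calc _ ≤ max (eLpNorm (field (n t)) q₀ volume) (eLpNorm (field (n t)) ⊤ volume) :=
        eLpNorm_le_max (aestronglyMeasurable_field hn.1) hq₀0 hq
    _ ≤ T := max_le f0 ft
    _ ≤ _ := by
      rw [ENNReal.coe_add, ENNReal.coe_toNNReal hTt.ne]
      exact le_self_add

end IsWeakSolutionWith

end Comparison

end NernstPlanck

/-! ### The theorem -/

theorem mainTheorem11 (d : ℕ) (hd : d = 2 ∨ d = 3) (M : ℝ) (hM : 0 < M)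
    (φ : NernstPlanck.E d → ℝ) (hφ : NernstPlanck.IsConfining M φ)
    (n₀ : NernstPlanck.E d → ℝ) (hn₀ : Integrable n₀) (hn₀_nonneg : ∀ᵐ x, 0 ≤ n₀ x)
    (hmass : ∫ x, n₀ x = M) (henergy : NernstPlanck.freeEnergy φ n₀ < ⊤)
    (n : ℝ → NernstPlanck.E d → ℝ) (hn : NernstPlanck.IsWeakSolution φ n₀ n) :
    ∃ T : ℝ, 0 < T ∧
      (∀ q₀ : ℝ≥0∞, 2 < q₀ → ∃ C : ℝ≥0, 0 < C ∧ ∀ t : ℝ, T ≤ t →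
        ∃ g : NernstPlanck.E d → NernstPlanck.E d,
          NernstPlanck.IsWeakGradient (NernstPlanck.potential (n t)) g ∧
            ∀ q : ℝ≥0∞, q₀ ≤ q → eLpNorm g q volume ≤ C) ∧
      (d = 3 → ∃ C : ℝ≥0, 0 < C ∧ ∀ t : ℝ, T ≤ t →
        ∃ g : NernstPlanck.E d → NernstPlanck.E d,
          NernstPlanck.IsWeakGradient (NernstPlanck.potential (n t)) g ∧
            ∀ q : ℝ≥0∞, 2 < q → eLpNorm g q volume ≤ C) := by
  obtain ⟨L, hL⟩ := hφ.lipschitz_gradient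
  obtain ⟨Dn, Dc, H⟩ := hn
  have hgrad : ∀ t : ℝ, 1 ≤ t → NernstPlanck.IsWeakGradient (NernstPlanck.potential (n t))
      (NernstPlanck.field (n t)) := fun t ht =>
    NernstPlanck.isWeakGradient_field hd (H.integrable t (by linarith))
      (H.potential_c t (by linarith))
  -- Any positive time would serve as `T`, since the barrier is finite and decreasing on positive
  -- times.
  refine ⟨1, one_pos, fun q₀ hq₀ => ?_, fun hd3 => ?_⟩
  · obtain ⟨q₁, hq₁, hq₁'⟩ := exists_between hq₀
    have hq₁t : q₁ ≠ ⊤ := (hq₁'.trans_le le_top).ne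
    have h2 : (2 : ℝ) < q₁.toReal := by
      simpa using (ENNReal.toReal_lt_toReal ENNReal.ofNat_ne_top hq₁t).2 hq₁
    -- In dimension three the exponent `2` itself is admissible, as `3 < 2 · 2`, so one constant
    -- serves for all `q > 2`.
    obtain ⟨C, hC, hb⟩ := H.exists_eLpNorm_field_le hd hL
      (one_le_two.trans hq₁.le) hq₁t (by rcases hd with rfl | rfl <;> norm_num <;> linarith)
    exact ⟨C, hC, fun t ht => ⟨_, hgrad t ht, fun q hq => hb t ht q (hq₁'.le.trans hq)⟩⟩
  · obtain ⟨C, hC, hb⟩ := H.exists_eLpNorm_field_le hd hL (q₀ := 2) one_le_two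
      ENNReal.ofNat_ne_top (by subst hd3; norm_num)
    exact ⟨C, hC, fun t ht => ⟨_, hgrad t ht, fun q hq => hb t ht q hq.le⟩⟩
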